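/- Consider an edge-to-edge tiling of the unit sphere by $f$ congruent copies (reflections allowed) of a simple spherical quadrilateral $ABCD$, such that every vertex of the tiling has degree at least $3$. The edges of $ABCD$ are arcs of great circles with lengths $|AB|=|DA|=a$, $|BC|=b$, $|CD|=c$, where $a,b,c$ are distinct, and $\alpha,\beta,\gamma,\delta$ are its interior angles at $A,B,C,D$ respectively (values $\ge\pi$ are allowed). A vertex of the tiling at which exactly $p$ angles $\alpha$, $q$ angles $\beta$, $r$ angles $\gamma$ and $s$ angles $\delta$ meet is denoted by $\alpha^p\beta^q\gamma^r\delta^s$ (the angles are distinguished by their position in the tile, even if they have equal values). If $\alpha^3$ and $\alpha\beta^2$ occur as vertices of the tiling and $\beta\gamma\delta$ does not, then $f=24$, and every vertex of the tiling is one of $$\alpha^3,\quad \alpha\beta^2,\quad \gamma^4,\quad \alpha^2\delta^2,\quad \beta^2\delta^2,\quad \alpha\delta^4,\quad \delta^6;$$ moreover all seven of these combinations $\alpha^p\beta^q\gamma^r\delta^s$ satisfy the angle sum equation $p\alpha+q\beta+r\gamma+s\delta=2\pi$. -/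

import Mathlib

open Set Filter Topology

noncomputable section

/-- Euclidean three-space; the unit sphere is `Metric.sphere (0 : E3) 1`. -/
abbrev E3 : Type := EuclideanSpace ℝ (Fin 3)

/-- The unit sphere. -/
def unitSphere : Set E3 := Metric.sphere 0 1

/-- A geodesic arc on the unit sphere, i.e. an arc of a great circle: it starts at `start` with unit
tangent direction `dir` and has length `len`, where `0 < len < 2π`. -/
structure GeodesicArc where
  start : E3
  dir : E3
  len : ℝ
  norm_start : ‖start‖ = 1
  norm_dir : ‖dir‖ = 1
  orth : inner ℝ start dir = 0
  len_pos : 0 < len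
  len_lt : len < 2 * Real.pi

namespace GeodesicArc

/-- The unit speed parametrisation. -/
def pt (e : GeodesicArc) (t : ℝ) : E3 := Real.cos t • e.start + Real.sin t • e.dir

/-- The end point of the arc. -/
def finish (e : GeodesicArc) : E3 := e.pt e.len

/-- The unit tangent vector at the end point that points back along the arc. -/
def backDir (e : GeodesicArc) : E3 := Real.sin e.len • e.start - Real.cos e.len • e.dir

/-- The closed arc, as a subset of the sphere. -/
def carrier (e : GeodesicArc) : Set E3 := e.pt '' Icc 0 e.len

/-- The arc without its two end points. -/
def relInterior (e : GeodesicArc) : Set E3 := e.pt '' Ioo 0 e.len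

end GeodesicArc

/-- A simple spherical quadrilateral.  Its four edges are geodesic arcs that form a simple closed
curve (edge `k` runs from vertex `k` to vertex `k + 1`, indices modulo `4`), and its interior is one
of the connected components of the complement of this curve in the sphere. -/
structure SimpleQuadrilateral where
  edge : Fin 4 → GeodesicArc
  closed : ∀ k, (edge k).finish = (edge (k + 1)).start
  adjacent_edges : ∀ k, (edge k).carrier ∩ (edge (k + 1)).carrier = {(edge (k + 1)).start}
  opposite_edges : ∀ k, Disjoint (edge k).carrier (edge (k + 2)).carrier
  inside : Set E3
  inside_component : ∃ x ∈ unitSphere \ ⋃ k, (edge k).carrier,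
    inside = connectedComponentIn (unitSphere \ ⋃ k, (edge k).carrier) x

namespace SimpleQuadrilateral

/-- The `k`-th vertex. -/
def vertex (Q : SimpleQuadrilateral) (k : Fin 4) : E3 := (Q.edge k).start

/-- The closed region bounded by the four edges. -/
def region (Q : SimpleQuadrilateral) : Set E3 := closure Q.inside

end SimpleQuadrilateral

/-- `IsInteriorAngle P p u w θ`: near its corner `p`, the subset `P` of the sphere is exactly the
closed sector of opening `θ`, `0 < θ < 2π`, whose two sides leave `p` in the unit tangent directions
`u` and `w`.  Here `n` is the unit tangent vector at `p` orthogonal to `u` on the side to which the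
sector opens, and `(t, φ)` are geodesic polar coordinates about `p`. -/
def IsInteriorAngle (P : Set E3) (p u w : E3) (θ : ℝ) : Prop :=
  0 < θ ∧ θ < 2 * Real.pi ∧
  ∃ n : E3, ‖n‖ = 1 ∧ inner ℝ p n = 0 ∧ inner ℝ u n = 0 ∧
    w = Real.cos θ • u + Real.sin θ • n ∧
    ∃ r > 0, ∀ t ∈ Ioo 0 r, ∀ φ ∈ Ico 0 (2 * Real.pi),
      (Real.cos t • p + Real.sin t • (Real.cos φ • u + Real.sin φ • n) ∈ P ↔ φ ≤ θ)

/-- The quadrilateral `ABCD` of edge type `a²bc`: `AB` and `DA` have length `a`, `BC` has length `b`,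
`CD` has length `c`, and `a, b, c` are distinct.  The vertices `A, B, C, D` are numbered
`0, 1, 2, 3`. The interior angles at `A, B, C, D` are `α, β, γ, δ`; so `α` lies between the two
`a`-edges, `β` between `a` and `b`, `γ` between `b` and `c`, `δ` between `c` and `a`. -/
structure QuadrilateralA2BC extends SimpleQuadrilateral where
  a : ℝ
  b : ℝ
  c : ℝ
  len_edge : ∀ k, (edge k).len = ![a, b, c, a] k
  a_ne_b : a ≠ b
  b_ne_c : b ≠ c
  c_ne_a : c ≠ a
  α : ℝ
  β : ℝ
  γ : ℝ
  δ : ℝ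
  angle_vertex : ∀ k, IsInteriorAngle toSimpleQuadrilateral.region
    (toSimpleQuadrilateral.vertex k) (edge k).dir (edge (k - 1)).backDir (![α, β, γ, δ] k)

/-- An edge-to-edge tiling of the sphere by `f` congruent copies of the quadrilateral `Q`, with all
vertices of degree at least `3`.  The tiles are the images of `Q` under linear isometries of `E3`,
i.e. under isometries of the sphere, reflections included. -/
structure SphericalTiling (Q : QuadrilateralA2BC) (f : ℕ) where
  place : Fin f → (E3 ≃ₗᵢ[ℝ] E3)
  covers : ⋃ i, place i '' Q.region = unitSphere
  nonoverlapping : ∀ i j, i ≠ j → Disjoint (place i '' Q.inside) (place j '' Q.inside)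
  /-- No vertex of a tile is a relatively interior point of an edge of a tile. -/
  edge_to_edge : ∀ i j k l, place i (Q.vertex k) ∉ place j '' (Q.edge l).relInterior
  three_le_degree : ∀ i k,
    3 ≤ {x : Fin f × Fin 4 | place x.1 (Q.vertex x.2) = place i (Q.vertex k)}.ncard

namespace SphericalTiling

variable {Q : QuadrilateralA2BC} {f : ℕ}

/-- The vertices of the tiling. -/
def vertices (T : SphericalTiling Q f) : Set E3 := {p | ∃ i k, T.place i (Q.vertex k) = p}

/-- The angle combination at the point `p`: the numbers of angles `α, β, γ, δ` of tiles at `p`. -/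
def angleCombination (T : SphericalTiling Q f) (p : E3) : Fin 4 → ℕ :=
  fun k => {i : Fin f | T.place i (Q.vertex k) = p}.ncard

/-- The set of all the angle combinations at vertices of the tiling; `![a, b, c, d]` stands for the
vertex `α^a β^b γ^c δ^d`. -/
def avc (T : SphericalTiling Q f) : Set (Fin 4 → ℕ) := T.angleCombination '' T.vertices

end SphericalTiling

/-- The seven combinations `α³, αβ², γ⁴, α²δ², β²δ², αδ⁴, δ⁶`. -/
def sevenCombinations : Set (Fin 4 → ℕ) :=
  {![3, 0, 0, 0], ![1, 2, 0, 0], ![0, 0, 4, 0], ![2, 0, 0, 2], ![0, 2, 0, 2], ![1, 0, 0, 4],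
    ![0, 0, 0, 6]}

end

/-!
The argument has a geometric part, which turns the tiling into counting data, and a combinatorial
part, in which angles are measured in units of `π` and `p, q, r, s` are the numbers of angles
`α, β, γ, δ` at a vertex.

*Geometry.* Each edge of a tile has an inward normal, and consecutive inward normals differ by a
rotation through the interior angle (`QuadrilateralA2BC.exists_isInwardNormal`). Three facts rest
on this.

* The angle sum of a tile is `4π/f` modulo `2π`
  (`SphericalTiling.exists_sum_angle_eq`). Off a point `x` the tangent bundle of the sphere is
  trivialised by parallel transport along the geodesics to `-x`. In this trivialisation, parallel
  transport along an edge turns a vector by twice the argument of an explicit complex number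
  `edgeFactor`, so the product of the squares of these four numbers has the sum of the angles as its
  argument (`QuadrilateralA2BC.prod_edgeFactor_sq`). The sum of the doubled arguments, as a
  function of `x`, jumps by `4π` exactly where `x` crosses the boundary; with this jump compensated
  it is continuous off the four vertices, hence constant. Its mean over the sphere is the area term alone, because the
  reflection in the plane of an edge conjugates the corresponding `edgeFactor`.
* The angles at each vertex of the tiling add up to `2π` (`SphericalTiling.sum_corners_angle`):
  small circles about the vertex are cut by the tiles into arcs of these angles.
* Every edge of a tile coincides with exactly one edge of another tile, of the same length
  (`SphericalTiling.partner`). So `q + r` and `r + s` are even at each vertex.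

Counting vertices, of which there are at least four and, since degrees are at least three, at most
`4f/3`, removes the ambiguity modulo `2π`: the angle sum is `2π + 4π/f`
(`SphericalTiling.sum_angle_eq`).

*Combinatorics.* The two given vertices yield `α = β = 2/3`, so that `γ + δ = 2/3 + 4/f`. At the
vertex `α³` the edges `AB` cannot be matched among themselves, as three is odd; so an edge `AB` is
matched with an edge `AD`, which leads to a vertex with a `β` and a `δ`
(`SphericalTiling.exists_beta_delta`). Moreover `δ ≠ 2/3`: if `β = δ`, the reflection symmetry of
the triangle `ABD` and `b ≠ c` force `γ = π` (`QuadrilateralA2BC.gamma_eq_pi`), but then `γ` fits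
into no vertex of degree at least three.

Let `y` be the larger of `γ, δ` and `x` the other one. At each vertex other than `y⁴` there are at
most as many `y` as `x`, with equality only at `x²y²` and at vertices without `x` and `y`
(`multiplicity_lt_or`). The vertex with a `β` and a `δ` is none of these, so it has more `x` than
`y`. As both angles occur `f` times altogether, some vertex has more `y` than `x`; so `y⁴` is a
vertex, and `y = 1/2`. The vertex with a `β` and a `δ` then leaves two possibilities: it is `β²δ²`,
where `γ = 1/2`, `δ = 1/3` and `f = 24`; or it contains `x³` and `x = 5/18`. In the latter case
`α³` and `αβ²` are the only vertices with several `α` or several `β`, and following matched edges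
from a vertex with more `δ` than `β` leads to a contradiction
(`SphericalTiling.false_of_partner_delta`). For `γ = 1/2` and `δ = 1/3` the angle sum equation
and the parity conditions have exactly the seven solutions.
-/

noncomputable section

open scoped RealInnerProductSpace

/-! ### Orthonormal frames -/

/-- `p, u, n` is an orthonormal basis of `E3`, of either orientation. -/
structure IsFrame (p u n : E3) : Prop where
  pp : ⟪p, p⟫ = 1
  uu : ⟪u, u⟫ = 1
  nn : ⟪n, n⟫ = 1
  pu : ⟪p, u⟫ = 0
  pn : ⟪p, n⟫ = 0
  un : ⟪u, n⟫ = 0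

lemma inner_self_eq_one_iff {x : E3} : ⟪x, x⟫ = 1 ↔ ‖x‖ = 1 := by
  rw [real_inner_self_eq_norm_sq]
  constructor
  · intro h
    have := norm_nonneg x
    nlinarith
  · intro h; rw [h]; norm_num

lemma mem_unitSphere {x : E3} : x ∈ unitSphere ↔ ‖x‖ = 1 := by
  simp [unitSphere]

lemma mem_unitSphere' {x : E3} : x ∈ unitSphere ↔ ⟪x, x⟫ = 1 := by
  rw [mem_unitSphere, inner_self_eq_one_iff]

namespace IsFrame

variable {p u n : E3}

lemma orthonormal (h : IsFrame p u n) : Orthonormal ℝ ![p, u, n] := by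
  have up : ⟪u, p⟫ = 0 := by rw [real_inner_comm]; exact h.pu
  have np : ⟪n, p⟫ = 0 := by rw [real_inner_comm]; exact h.pn
  have nu : ⟪n, u⟫ = 0 := by rw [real_inner_comm]; exact h.un
  rw [orthonormal_iff_ite]
  intro i j
  fin_cases i <;> fin_cases j <;> simp [h.pu, h.pn, h.un, up, np, nu,
    inner_self_eq_one_iff.1 h.pp, inner_self_eq_one_iff.1 h.uu, inner_self_eq_one_iff.1 h.nn]

/-- The orthonormal basis given by a frame. -/
def basis (h : IsFrame p u n) : OrthonormalBasis (Fin 3) ℝ E3 :=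
  (basisOfOrthonormalOfCardEqFinrank h.orthonormal (by simp)).toOrthonormalBasis
    (by simpa using h.orthonormal)

lemma coe_basis (h : IsFrame p u n) : (h.basis : Fin 3 → E3) = ![p, u, n] := by
  simp [basis]

lemma expand (h : IsFrame p u n) (x : E3) : x = ⟪x, p⟫ • p + ⟪x, u⟫ • u + ⟪x, n⟫ • n := by
  have := h.basis.sum_repr' x
  rw [Fin.sum_univ_three, h.coe_basis] at this
  simpa [real_inner_comm] using this.symm

lemma inner_eq (h : IsFrame p u n) (x y : E3) :
    ⟪x, y⟫ = ⟪x, p⟫ * ⟪y, p⟫ + ⟪x, u⟫ * ⟪y, u⟫ + ⟪x, n⟫ * ⟪y, n⟫ := by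
  conv_lhs => rw [h.expand x]
  simp only [inner_add_left, real_inner_smul_left]
  rw [real_inner_comm y p, real_inner_comm y u, real_inner_comm y n]

lemma neg (h : IsFrame p u n) : IsFrame p u (-n) :=
  ⟨h.pp, h.uu, by simpa using h.nn, h.pu, by simpa using h.pn, by simpa using h.un⟩

/-- The first two vectors of a frame determine the third one up to sign. -/
lemma eq_or_eq_neg {n' : E3} (h : IsFrame p u n) (h' : IsFrame p u n') : n' = n ∨ n' = -n := by
  have e := h.expand n'
  rw [real_inner_comm, h'.pn, real_inner_comm, h'.un] at e
  simp only [zero_smul, zero_add] at e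
  have e2 := h'.nn
  rw [e] at e2
  simp only [real_inner_smul_left, real_inner_smul_right, h.nn, mul_one] at e2
  rcases mul_self_eq_one_iff.1 e2 with h1 | h1
  · left; rw [e, h1, one_smul]
  · right; rw [e, h1, neg_one_smul]

/-- A frame rotated about its third vector. -/
lemma rotate (h : IsFrame p u n) (t : ℝ) :
    IsFrame (Real.cos t • p + Real.sin t • u) (-Real.sin t • p + Real.cos t • u) n := by
  have up : ⟪u, p⟫ = 0 := by rw [real_inner_comm]; exact h.pu
  have := Real.sin_sq_add_cos_sq t
  constructor <;> simp only [inner_add_left, inner_add_right, real_inner_smul_left,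
    real_inner_smul_right, h.pp, h.uu, h.nn, h.pu, h.pn, h.un, up] <;>
    first | linear_combination this | ring

lemma perm (h : IsFrame p u n) : IsFrame u n p :=
  ⟨h.uu, h.nn, h.pp, h.un, by rw [real_inner_comm]; exact h.pu, by rw [real_inner_comm]; exact h.pn⟩

lemma swap (h : IsFrame p u n) : IsFrame p n u :=
  ⟨h.pp, h.nn, h.uu, h.pn, h.pu, by rw [real_inner_comm]; exact h.un⟩

end IsFrame

/-- Two orthogonal unit vectors extend to a frame. -/
lemma exists_isFrame_of_pair {p u : E3} (hp : ⟪p, p⟫ = 1) (hu : ⟪u, u⟫ = 1) (h : ⟪p, u⟫ = 0) :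
    ∃ n, IsFrame p u n := by
  have hfr : Module.finrank ℝ E3 = 3 := by simp
  have hlt : Module.finrank ℝ (Submodule.span ℝ ({p, u} : Set E3)) < Module.finrank ℝ E3 := by
    have h1 := finrank_span_finset_le_card (R := ℝ) ({p, u} : Finset E3)
    have h2 : ({p, u} : Finset E3).card ≤ 2 := Finset.card_le_two
    rw [hfr]
    simp only [Finset.coe_insert, Finset.coe_singleton] at h1
    change _ ≤ _ at h1
    have : Module.finrank ℝ (Submodule.span ℝ ({p, u} : Set E3)) ≤ 2 := le_trans h1 h2
    omega
  have hne : (Submodule.span ℝ ({p, u} : Set E3))ᗮ ≠ ⊥ := by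
    intro hb
    rw [Submodule.orthogonal_eq_bot_iff] at hb
    rw [hb] at hlt
    simp at hlt
  obtain ⟨v, hv, hv0⟩ := Submodule.exists_mem_ne_zero_of_ne_bot hne
  rw [Submodule.mem_orthogonal] at hv
  have hpv := hv p (Submodule.subset_span (by simp))
  have huv := hv u (Submodule.subset_span (by simp))
  refine ⟨‖v‖⁻¹ • v, hp, hu, ?_, h, ?_, ?_⟩
  · rw [inner_self_eq_one_iff]; exact norm_smul_inv_norm hv0
  · rw [real_inner_smul_right, hpv, mul_zero]
  · rw [real_inner_smul_right, huv, mul_zero]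

/-- A unit vector extends to a frame. -/
lemma exists_isFrame {p : E3} (hp : ⟪p, p⟫ = 1) : ∃ u n, IsFrame p u n := by
  have hne : (Submodule.span ℝ ({p} : Set E3))ᗮ ≠ ⊥ := by
    intro hb
    rw [Submodule.orthogonal_eq_bot_iff] at hb
    have h1 := finrank_span_le_card (R := ℝ) ({p} : Set E3)
    rw [hb] at h1
    simp at h1
  obtain ⟨v, hv, hv0⟩ := Submodule.exists_mem_ne_zero_of_ne_bot hne
  rw [Submodule.mem_orthogonal] at hv
  have hpv := hv p (Submodule.subset_span (by simp))
  obtain ⟨n, hn⟩ := exists_isFrame_of_pair (p := p) (u := ‖v‖⁻¹ • v) hp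
    (by rw [inner_self_eq_one_iff]; exact norm_smul_inv_norm hv0)
    (by rw [real_inner_smul_right, hpv, mul_zero])
  exact ⟨_, n, hn⟩

/-! ### Caps and half-caps -/

lemma norm_sub_sq_unit {x y : E3} (hx : ⟪x, x⟫ = 1) (hy : ⟪y, y⟫ = 1) :
    ‖x - y‖ ^ 2 = 2 - 2 * ⟪x, y⟫ := by
  rw [← real_inner_self_eq_norm_sq, inner_sub_left, inner_sub_right, inner_sub_right, hx, hy,
    real_inner_comm]
  ring

/-- Radial projection: the unit vectors of a convex cone without apex form a connected set. -/
lemma isPreconnected_sphere_inter_cone {K : Set E3} (hK : Convex ℝ K) (h0 : (0 : E3) ∉ K)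
    (hc : ∀ x ∈ K, ∀ r : ℝ, 0 < r → r • x ∈ K) : IsPreconnected (unitSphere ∩ K) := by
  have : unitSphere ∩ K = (fun x : E3 => ‖x‖⁻¹ • x) '' K := by
    ext x
    constructor
    · rintro ⟨h1, h2⟩
      refine ⟨x, h2, ?_⟩
      rw [mem_unitSphere] at h1
      simp [h1]
    · rintro ⟨y, hy, rfl⟩
      have hy0 : y ≠ 0 := fun h => h0 (h ▸ hy)
      refine ⟨mem_unitSphere.2 (norm_smul_inv_norm hy0), hc _ hy _ ?_⟩
      exact inv_pos.2 (norm_pos_iff.2 hy0)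
  rw [this]
  refine hK.isPreconnected.image _ ?_
  intro x hx
  have hx0 : x ≠ 0 := fun h => h0 (h ▸ hx)
  have hn : ‖x‖ ≠ 0 := norm_ne_zero_iff.2 hx0
  exact (ContinuousAt.smul (continuousAt_id.norm.inv₀ hn) continuousAt_id).continuousWithinAt

/-- The open spherical cap about `y` consisting of the points `x` with `c < ⟪x, y⟫`. -/
def cap (y : E3) (c : ℝ) : Set E3 := unitSphere ∩ {x | c < ⟪x, y⟫}

/-- The part of `cap y c` on the side of the plane `n⊥` to which `n` points. -/
def halfCap (y n : E3) (c : ℝ) : Set E3 := cap y c ∩ {x | 0 < ⟪x, n⟫}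

lemma convex_capCone (y : E3) {c : ℝ} (hc : 0 ≤ c) : Convex ℝ {x : E3 | c * ‖x‖ < ⟪x, y⟫} := by
  intro a ha b hb s t hs ht hst
  simp only [mem_ofPred_eq] at *
  rw [inner_add_left, real_inner_smul_left, real_inner_smul_left]
  have h1 : ‖s • a + t • b‖ ≤ s * ‖a‖ + t * ‖b‖ := by
    refine (norm_add_le _ _).trans_eq ?_
    rw [norm_smul, norm_smul, Real.norm_of_nonneg hs, Real.norm_of_nonneg ht]
  have h2 := mul_le_mul_of_nonneg_left h1 hc
  rcases eq_or_lt_of_le hs with rfl | hs'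
  · have : t = 1 := by linarith
    subst this
    linarith
  · have h3 := mul_lt_mul_of_pos_left ha hs'
    have h4 := mul_le_mul_of_nonneg_left hb.le ht
    linarith

lemma isPreconnected_cap (y : E3) {c : ℝ} (hc : 0 ≤ c) : IsPreconnected (cap y c) := by
  have : cap y c = unitSphere ∩ {x : E3 | c * ‖x‖ < ⟪x, y⟫} := by
    ext x
    simp only [cap, mem_inter_iff, mem_ofPred_eq]
    refine and_congr_right fun h => ?_
    rw [mem_unitSphere.1 h, mul_one]
  rw [this]
  refine isPreconnected_sphere_inter_cone (convex_capCone y hc) (by simp) ?_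
  intro x hx r hr
  simp only [mem_ofPred_eq] at *
  rw [norm_smul, Real.norm_of_nonneg hr.le, real_inner_smul_left]
  have := mul_lt_mul_of_pos_left hx hr
  linarith

lemma isPreconnected_halfCap (y n : E3) {c : ℝ} (hc : 0 ≤ c) :
    IsPreconnected (halfCap y n c) := by
  have : halfCap y n c = unitSphere ∩ ({x : E3 | c * ‖x‖ < ⟪x, y⟫} ∩ {x | 0 < ⟪x, n⟫}) := by
    ext x
    simp only [halfCap, cap, mem_inter_iff, mem_ofPred_eq, and_assoc]
    refine and_congr_right fun h => ?_
    rw [mem_unitSphere.1 h, mul_one]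
  rw [this]
  refine isPreconnected_sphere_inter_cone ((convex_capCone y hc).inter ?_) (by simp) ?_
  · intro a ha b hb s t hs ht hst
    simp only [mem_ofPred_eq] at *
    rw [inner_add_left, real_inner_smul_left, real_inner_smul_left]
    rcases eq_or_lt_of_le hs with rfl | hs'
    · have : t = 1 := by linarith
      subst this
      linarith
    · have h3 := mul_pos hs' ha
      have h4 := mul_nonneg ht hb.le
      linarith
  · intro x hx r hr
    simp only [mem_inter_iff, mem_ofPred_eq] at *
    rw [norm_smul, Real.norm_of_nonneg hr.le, real_inner_smul_left, real_inner_smul_left]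
    have := mul_lt_mul_of_pos_left hx.1 hr
    exact ⟨by linarith, mul_pos hr hx.2⟩

/-- Small caps form a neighbourhood basis of the sphere. -/
lemma exists_cap_subset {y : E3} (hy : ⟪y, y⟫ = 1) {U : Set E3} (hU : U ∈ 𝓝 y) :
    ∃ c, 0 ≤ c ∧ c < 1 ∧ cap y c ⊆ U := by
  obtain ⟨ε, hε, hb⟩ := Metric.mem_nhds_iff.1 hU
  refine ⟨max 0 (1 - ε ^ 2 / 2), le_max_left _ _, max_lt one_pos (by nlinarith), ?_⟩
  rintro x ⟨hx, hxy⟩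
  apply hb
  rw [Metric.mem_ball, dist_eq_norm]
  have h1 := norm_sub_sq_unit (mem_unitSphere'.1 hx) hy
  have h2 : 1 - ε ^ 2 / 2 < ⟪x, y⟫ := lt_of_le_of_lt (le_max_right _ _) hxy
  exact lt_of_pow_lt_pow_left₀ 2 hε.le (by linarith)

lemma setOf_lt_inner_mem_nhds {y : E3} (hy : ⟪y, y⟫ = 1) {c : ℝ} (hc : c < 1) :
    {x : E3 | c < ⟪x, y⟫} ∈ 𝓝 y := by
  have : Continuous fun x : E3 => ⟪x, y⟫ := by fun_prop
  exact this.continuousAt.eventually_const_lt (by simpa only [hy] using hc)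

/-- The filter of one-sided neighbourhoods of `y` in the sphere, on the side of the plane `n⊥` to
which `n` points. -/
def sideNhds (y n : E3) : Filter E3 := 𝓝[unitSphere ∩ {x | 0 < ⟪x, n⟫}] y

lemma halfCap_mem_sideNhds {y n : E3} (hy : ⟪y, y⟫ = 1) {c : ℝ} (hc : c < 1) :
    halfCap y n c ∈ sideNhds y n := by
  rw [sideNhds, mem_nhdsWithin_iff_exists_mem_nhds_inter]
  refine ⟨_, setOf_lt_inner_mem_nhds hy hc, ?_⟩
  rintro x ⟨h1, h2, h3⟩
  exact ⟨⟨h2, h1⟩, h3⟩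

/-- Every set of one-sided neighbourhoods contains a half-cap. -/
lemma mem_sideNhds_iff {y n : E3} (hy : ⟪y, y⟫ = 1) {S : Set E3} :
    S ∈ sideNhds y n ↔ ∃ c, 0 ≤ c ∧ c < 1 ∧ halfCap y n c ⊆ S := by
  constructor
  · intro h
    rw [sideNhds, mem_nhdsWithin_iff_exists_mem_nhds_inter] at h
    obtain ⟨U, hU, hUS⟩ := h
    obtain ⟨c, h0, h1, hc⟩ := exists_cap_subset hy hU
    exact ⟨c, h0, h1, fun x hx => hUS ⟨hc hx.1, hx.1.1, hx.2⟩⟩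
  · rintro ⟨c, -, h1, h⟩
    exact mem_of_superset (halfCap_mem_sideNhds hy h1) h

/-- A great circle through `y` whose direction `d` satisfies `0 < ⟪d, n⟫` enters the side of `n`. -/
lemma tendsto_sideNhds {y n d : E3} (hy : ⟪y, y⟫ = 1) (hd : ⟪d, d⟫ = 1) (hyd : ⟪y, d⟫ = 0)
    (hyn : ⟪y, n⟫ = 0) (hdn : 0 < ⟪d, n⟫) :
    Tendsto (fun t : ℝ => Real.cos t • y + Real.sin t • d) (𝓝[>] 0) (sideNhds y n) := by
  rw [sideNhds, tendsto_nhdsWithin_iff]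
  constructor
  · have : Continuous fun t : ℝ => Real.cos t • y + Real.sin t • d := by fun_prop
    have h := this.tendsto 0
    simp only [Real.cos_zero, one_smul, Real.sin_zero, zero_smul, add_zero] at h
    exact h.mono_left nhdsWithin_le_nhds
  · have : Ioo (0 : ℝ) Real.pi ∈ 𝓝[>] (0 : ℝ) := Ioo_mem_nhdsGT Real.pi_pos
    filter_upwards [this] with t ht
    have hdy : ⟪d, y⟫ = 0 := by rw [real_inner_comm]; exact hyd
    refine ⟨?_, ?_⟩
    · rw [mem_unitSphere']
      simp only [inner_add_left, inner_add_right, real_inner_smul_left, real_inner_smul_right,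
        hy, hd, hyd, hdy]
      linear_combination Real.sin_sq_add_cos_sq t
    · simp only [mem_ofPred_eq, inner_add_left, real_inner_smul_left, hyn, mul_zero, zero_add]
      exact mul_pos (Real.sin_pos_of_pos_of_lt_pi ht.1 ht.2) hdn

lemma sideNhds_neBot {y n : E3} (hy : ⟪y, y⟫ = 1) (hn : ⟪n, n⟫ = 1) (hyn : ⟪y, n⟫ = 0) :
    (sideNhds y n).NeBot :=
  (tendsto_sideNhds hy hn hyn hyn (by rw [hn]; exact one_pos)).neBot

lemma sideNhds_le (y n : E3) : sideNhds y n ≤ 𝓝[unitSphere] y :=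
  nhdsWithin_mono _ inter_subset_left

/-! ### Geodesic arcs -/

namespace GeodesicArc

variable (e : GeodesicArc)

/-- The unit tangent vector of the arc at `e.pt t`. -/
def vel (t : ℝ) : E3 := -Real.sin t • e.start + Real.cos t • e.dir

lemma start_inner : ⟪e.start, e.start⟫ = 1 := inner_self_eq_one_iff.2 e.norm_start

lemma dir_inner : ⟪e.dir, e.dir⟫ = 1 := inner_self_eq_one_iff.2 e.norm_dir

lemma exists_isFrame : ∃ n, IsFrame e.start e.dir n :=
  exists_isFrame_of_pair e.start_inner e.dir_inner e.orth

variable {e}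

lemma isFrame_pt {n : E3} (h : IsFrame e.start e.dir n) (t : ℝ) :
    IsFrame (e.pt t) (e.vel t) n := h.rotate t

variable (e)

lemma pt_inner_pt (s t : ℝ) : ⟪e.pt s, e.pt t⟫ = Real.cos (s - t) := by
  have h := e.orth
  have h' : ⟪e.dir, e.start⟫ = 0 := by rw [real_inner_comm]; exact h
  simp only [pt, inner_add_left, inner_add_right, real_inner_smul_left, real_inner_smul_right,
    e.start_inner, e.dir_inner, h, h', Real.cos_sub]
  ring

lemma pt_inner_self (t : ℝ) : ⟪e.pt t, e.pt t⟫ = 1 := by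
  rw [pt_inner_pt, sub_self, Real.cos_zero]

lemma pt_mem_unitSphere (t : ℝ) : e.pt t ∈ unitSphere := mem_unitSphere'.2 (e.pt_inner_self t)

lemma pt_zero : e.pt 0 = e.start := by simp [pt]

lemma pt_len : e.pt e.len = e.finish := rfl

lemma backDir_eq : e.backDir = -e.vel e.len := by
  simp only [backDir, vel]; module

lemma pt_add (t s : ℝ) : e.pt (t + s) = Real.cos s • e.pt t + Real.sin s • e.vel t := by
  simp only [pt, vel, Real.cos_add, Real.sin_add]; module

lemma vel_add (t s : ℝ) : e.vel (t + s) = -Real.sin s • e.pt t + Real.cos s • e.vel t := by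
  simp only [pt, vel, Real.cos_add, Real.sin_add]; module

/-- Near its end, the arc is traced backwards from its end point in the direction `backDir`. -/
lemma pt_len_sub (s : ℝ) :
    e.pt (e.len - s) = Real.cos s • e.finish + Real.sin s • e.backDir := by
  rw [sub_eq_add_neg, pt_add, backDir_eq, pt_len]; simp

lemma continuous_pt : Continuous e.pt := by unfold pt; fun_prop

variable {e}

lemma pt_injOn {s t : ℝ} (hs : s ∈ Icc 0 e.len) (ht : t ∈ Icc 0 e.len) (h : e.pt s = e.pt t) :
    s = t := by
  have h1 : Real.cos (s - t) = 1 := by rw [← pt_inner_pt, h, pt_inner_self]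
  have := e.len_lt
  rw [Real.cos_eq_one_iff_of_lt_of_lt (by linarith [hs.1, ht.2]) (by linarith [hs.2, ht.1])] at h1
  linarith

variable (e)

lemma isCompact_carrier : IsCompact e.carrier := isCompact_Icc.image e.continuous_pt

lemma carrier_subset : e.carrier ⊆ unitSphere := by
  rintro _ ⟨t, -, rfl⟩; exact e.pt_mem_unitSphere t

lemma relInterior_subset_carrier : e.relInterior ⊆ e.carrier :=
  image_mono Ioo_subset_Icc_self

lemma start_mem_carrier : e.start ∈ e.carrier := ⟨0, ⟨le_rfl, e.len_pos.le⟩, e.pt_zero⟩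

lemma start_notMem_relInterior : e.start ∉ e.relInterior := by
  rintro ⟨t, ht, h⟩
  rw [← e.pt_zero] at h
  have := pt_injOn (Ioo_subset_Icc_self ht) ⟨le_rfl, e.len_pos.le⟩ h
  linarith [ht.1]

lemma finish_notMem_relInterior : e.finish ∉ e.relInterior := by
  rintro ⟨t, ht, h⟩
  have := pt_injOn (Ioo_subset_Icc_self ht) ⟨e.len_pos.le, le_rfl⟩ h
  linarith [ht.2]

lemma start_ne_finish : e.start ≠ e.finish := by
  intro h
  rw [← e.pt_zero] at h
  have := pt_injOn ⟨le_rfl, e.len_pos.le⟩ ⟨e.len_pos.le, le_rfl⟩ h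
  linarith [e.len_pos]

lemma carrier_eq : e.carrier = e.relInterior ∪ {e.start, e.finish} := by
  have := e.len_pos
  rw [carrier, relInterior, ← Ioo_union_both e.len_pos.le, image_union, image_pair, pt_zero, pt_len]

variable {e}

lemma inner_normal {n : E3} (h : IsFrame e.start e.dir n) {x : E3} (hx : x ∈ e.carrier) :
    ⟪x, n⟫ = 0 := by
  obtain ⟨t, -, rfl⟩ := hx
  exact (isFrame_pt h t).pn

/-- The points of the great circle of an arc, with the parameter in a prescribed period. -/
lemma exists_pt_eq {n : E3} (h : IsFrame e.start e.dir n) {x : E3} (hx : x ∈ unitSphere)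
    (hxn : ⟪x, n⟫ = 0) (c : ℝ) : ∃ t ∈ Ioc c (c + 2 * Real.pi), x = e.pt t := by
  have hexp := h.expand x
  have h1 := h.inner_eq x x
  rw [mem_unitSphere'.1 hx, hxn] at h1
  rw [hxn, zero_smul, add_zero] at hexp
  obtain ⟨t, ht⟩ : ∃ t : ℝ, Real.cos t = ⟪x, e.start⟫ ∧ Real.sin t = ⟪x, e.dir⟫ := by
    have hn : ‖(⟨⟪x, e.start⟫, ⟪x, e.dir⟫⟩ : ℂ)‖ = 1 := by
      rw [Complex.norm_def, Complex.normSq_mk, Real.sqrt_eq_one]; linarith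
    refine ⟨Complex.arg ⟨⟪x, e.start⟫, ⟪x, e.dir⟫⟩, ?_, ?_⟩
    · rw [Complex.cos_arg (by intro h0; rw [h0] at hn; simp at hn), hn, div_one]
    · rw [Complex.sin_arg, hn, div_one]
  refine ⟨toIocMod Real.two_pi_pos c t, toIocMod_mem_Ioc _ _ _, ?_⟩
  rw [hexp, ← ht.1, ← ht.2, toIocMod, pt]
  simp only [zsmul_eq_mul, Real.cos_sub_int_mul_two_pi, Real.sin_sub_int_mul_two_pi]

/-- The image of an arc under an isometry. -/
def map (e : GeodesicArc) (g : E3 ≃ₗᵢ[ℝ] E3) : GeodesicArc where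
  start := g e.start
  dir := g e.dir
  len := e.len
  norm_start := by rw [LinearIsometryEquiv.norm_map, e.norm_start]
  norm_dir := by rw [LinearIsometryEquiv.norm_map, e.norm_dir]
  orth := by rw [LinearIsometryEquiv.inner_map_map, e.orth]
  len_pos := e.len_pos
  len_lt := e.len_lt

lemma map_pt (e : GeodesicArc) (g : E3 ≃ₗᵢ[ℝ] E3) (t : ℝ) : (e.map g).pt t = g (e.pt t) := by
  simp [map, pt]

lemma map_backDir (e : GeodesicArc) (g : E3 ≃ₗᵢ[ℝ] E3) : (e.map g).backDir = g e.backDir := by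
  simp [map, backDir]

lemma map_carrier (e : GeodesicArc) (g : E3 ≃ₗᵢ[ℝ] E3) :
    (e.map g).carrier = g '' e.carrier := by
  rw [carrier, carrier, image_image]
  exact image_congr fun t _ => map_pt e g t

lemma map_relInterior (e : GeodesicArc) (g : E3 ≃ₗᵢ[ℝ] E3) :
    (e.map g).relInterior = g '' e.relInterior := by
  rw [relInterior, relInterior, image_image]
  exact image_congr fun t _ => map_pt e g t

end GeodesicArc

/-! ### The inside of a simple quadrilateral -/

namespace SimpleQuadrilateral

variable (Q : SimpleQuadrilateral)

/-- The boundary curve. -/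
def boundary : Set E3 := ⋃ k, (Q.edge k).carrier

lemma isClosed_boundary : IsClosed Q.boundary :=
  isClosed_iUnion_of_finite fun k => (Q.edge k).isCompact_carrier.isClosed

lemma carrier_subset_boundary (k : Fin 4) : (Q.edge k).carrier ⊆ Q.boundary :=
  subset_iUnion (fun k => (Q.edge k).carrier) k

lemma vertex_mem_boundary (k : Fin 4) : Q.vertex k ∈ Q.boundary :=
  Q.carrier_subset_boundary k (Q.edge k).start_mem_carrier

lemma boundary_subset : Q.boundary ⊆ unitSphere := iUnion_subset fun k => (Q.edge k).carrier_subset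

lemma vertex_succ (k : Fin 4) : Q.vertex (k + 1) = (Q.edge k).finish := (Q.closed k).symm

lemma mem_boundary {x : E3} (hx : x ∈ Q.boundary) :
    (∃ k, x = Q.vertex k) ∨ ∃ k, x ∈ (Q.edge k).relInterior := by
  obtain ⟨k, hk⟩ := mem_iUnion.1 hx
  rw [GeodesicArc.carrier_eq] at hk
  rcases hk with h | h | h
  · exact Or.inr ⟨k, h⟩
  · exact Or.inl ⟨k, h⟩
  · exact Or.inl ⟨k + 1, by rw [vertex_succ]; exact h⟩

lemma vertex_injective : Function.Injective Q.vertex := by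
  have h1 : ∀ k, Q.vertex k ≠ Q.vertex (k + 1) := fun k => by
    rw [vertex_succ]; exact (Q.edge k).start_ne_finish
  have h2 : ∀ k, Q.vertex k ≠ Q.vertex (k + 2) := fun k h =>
    (Q.opposite_edges k).ne_of_mem (Q.edge k).start_mem_carrier (Q.edge (k + 2)).start_mem_carrier h
  intro j k h
  have : ∀ j k : Fin 4, j = k ∨ k = j + 1 ∨ k = j + 2 ∨ j = k + 1 := by decide
  rcases this j k with h' | h' | h' | h'
  · exact h'
  · subst h'; exact absurd h (h1 j)
  · subst h'; exact absurd h (h2 j)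
  · subst h'; exact absurd h.symm (h1 k)

variable {Q}

lemma notMem_carrier_of_mem_relInterior {k j : Fin 4} (hjk : j ≠ k) {y : E3}
    (hy : y ∈ (Q.edge k).relInterior) : y ∉ (Q.edge j).carrier := by
  intro hj
  have hk := (Q.edge k).relInterior_subset_carrier hy
  have : ∀ j k : Fin 4, j = k ∨ j = k + 1 ∨ j = k + 2 ∨ k = j + 1 := by decide
  rcases this j k with h | h | h | h
  · exact hjk h
  · subst h
    have := (Q.adjacent_edges k).subset ⟨hk, hj⟩
    rw [← Q.closed k] at this
    rw [mem_singleton_iff.1 this] at hy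
    exact (Q.edge k).finish_notMem_relInterior hy
  · subst h
    exact (Q.opposite_edges k).ne_of_mem hk hj rfl
  · subst h
    have := (Q.adjacent_edges j).subset ⟨hj, hk⟩
    rw [mem_singleton_iff.1 this] at hy
    exact (Q.edge (j + 1)).start_notMem_relInterior hy

lemma eq_of_mem_relInterior {k j : Fin 4} {y : E3} (hk : y ∈ (Q.edge k).relInterior)
    (hj : y ∈ (Q.edge j).relInterior) : j = k := by
  by_contra h
  exact notMem_carrier_of_mem_relInterior h hk ((Q.edge j).relInterior_subset_carrier hj)

variable (Q)

lemma inside_subset : Q.inside ⊆ unitSphere \ Q.boundary := by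
  obtain ⟨x, hx, h⟩ := Q.inside_component
  rw [h]; exact connectedComponentIn_subset _ _

lemma inside_nonempty : Q.inside.Nonempty := by
  obtain ⟨x, hx, h⟩ := Q.inside_component
  rw [h]; exact ⟨x, mem_connectedComponentIn hx⟩

variable {Q}

lemma subset_inside {S : Set E3} (hS : IsPreconnected S) (hsub : S ⊆ unitSphere \ Q.boundary)
    (hne : (S ∩ Q.inside).Nonempty) : S ⊆ Q.inside := by
  obtain ⟨x, hx, h⟩ := Q.inside_component
  obtain ⟨y, hyS, hy⟩ := hne
  rw [h] at hy ⊢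
  rw [connectedComponentIn_eq hy]
  exact hS.subset_connectedComponentIn hyS hsub

/-- Off the boundary curve, being inside is locally constant. -/
lemma eventually_inside_iff {x : E3} (hx : x ∈ unitSphere) (hxb : x ∉ Q.boundary) :
    ∀ᶠ y in 𝓝[unitSphere] x, (y ∈ Q.inside ↔ x ∈ Q.inside) := by
  have hx1 := mem_unitSphere'.1 hx
  obtain ⟨c, h0, h1, hc⟩ := exists_cap_subset hx1 (Q.isClosed_boundary.isOpen_compl.mem_nhds hxb)
  have hsub : cap x c ⊆ unitSphere \ Q.boundary := fun y hy => ⟨hy.1, hc hy⟩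
  have hxc : x ∈ cap x c := ⟨hx, by simpa only [mem_ofPred_eq, hx1] using h1⟩
  have hpre := isPreconnected_cap x h0
  have : cap x c ∈ 𝓝[unitSphere] x :=
    inter_mem self_mem_nhdsWithin (mem_nhdsWithin_of_mem_nhds (setOf_lt_inner_mem_nhds hx1 h1))
  filter_upwards [this] with y hy
  exact ⟨fun h => subset_inside hpre hsub ⟨y, hy, h⟩ hxc,
    fun h => subset_inside hpre hsub ⟨x, hxc, h⟩ hy⟩

lemma eventually_inside {x : E3} (hx : x ∈ Q.inside) : ∀ᶠ y in 𝓝[unitSphere] x, y ∈ Q.inside := by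
  have h := Q.inside_subset hx
  filter_upwards [eventually_inside_iff h.1 h.2] with y hy
  exact hy.2 hx

variable (Q)

lemma inside_subset_region : Q.inside ⊆ Q.region := subset_closure

lemma isClosed_region : IsClosed Q.region := isClosed_closure

lemma region_subset_unitSphere : Q.region ⊆ unitSphere :=
  closure_minimal (Q.inside_subset.trans sdiff_subset) Metric.isClosed_sphere

lemma region_subset : Q.region ⊆ Q.inside ∪ Q.boundary := by
  intro x hx
  by_cases hb : x ∈ Q.boundary
  · exact Or.inr hb
  · left
    have hxs := Q.region_subset_unitSphere hx
    have h := eventually_inside_iff hxs hb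
    have hf : ∃ᶠ y in 𝓝[unitSphere] x, y ∈ Q.inside := by
      have := mem_closure_iff_frequently.1 hx
      rw [frequently_nhdsWithin_iff]
      exact this.mono fun y hy => ⟨hy, (Q.inside_subset hy).1⟩
    obtain ⟨y, hy1, hy2⟩ := (hf.and_eventually h).exists
    exact hy2.1 hy1

variable {Q}

/-- A set which is a neighbourhood in the sphere of one of its points in the region meets the
inside. -/
lemma frequently_inside {x : E3} (hx : x ∈ Q.region) : ∃ᶠ y in 𝓝[unitSphere] x, y ∈ Q.inside := by
  rw [frequently_nhdsWithin_iff]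
  exact (mem_closure_iff_frequently.1 hx).mono fun y hy => ⟨hy, (Q.inside_subset hy).1⟩

lemma halfCap_mem_nhdsWithin {y n : E3} {c : ℝ} {x : E3} (hx : x ∈ halfCap y n c) :
    halfCap y n c ∈ 𝓝[unitSphere] x := by
  have h1 : IsOpen {z : E3 | c < ⟪z, y⟫} := isOpen_lt (by fun_prop) (by fun_prop)
  have h2 : IsOpen {z : E3 | 0 < ⟪z, n⟫} := isOpen_lt (by fun_prop) (by fun_prop)
  exact inter_mem (inter_mem self_mem_nhdsWithin (mem_nhdsWithin_of_mem_nhds (h1.mem_nhds hx.1.2)))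
    (mem_nhdsWithin_of_mem_nhds (h2.mem_nhds hx.2))

lemma eventually_notMem_region {y n : E3} (hy : ⟪y, y⟫ = 1)
    (h : ∀ᶠ x in sideNhds y n, x ∉ Q.inside) : ∀ᶠ x in sideNhds y n, x ∉ Q.region := by
  obtain ⟨c, h0, h1, hc⟩ := (mem_sideNhds_iff hy).1 h
  refine (mem_sideNhds_iff hy).2 ⟨c, h0, h1, fun x hx hxr => ?_⟩
  obtain ⟨z, hz1, hz2⟩ := ((frequently_inside hxr).and_eventually (halfCap_mem_nhdsWithin hx)).exists
  exact hc hz2 hz1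

/-- Next to an interior point of an edge, each side of the edge is locally inside or outside, and
the same holds at the nearby points of the edge. -/
lemma side_dichotomy {k : Fin 4} {n : E3} (hn : IsFrame (Q.edge k).start (Q.edge k).dir n) {t : ℝ}
    (ht : t ∈ Ioo 0 (Q.edge k).len) :
    (∀ᶠ s in 𝓝 t, ∀ᶠ x in sideNhds ((Q.edge k).pt s) n, x ∈ Q.inside) ∨
      ∀ᶠ s in 𝓝 t, ∀ᶠ x in sideNhds ((Q.edge k).pt s) n, x ∉ Q.inside := by
  set y := (Q.edge k).pt t with hy
  have hyr : y ∈ (Q.edge k).relInterior := ⟨t, ht, rfl⟩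
  have hy1 : ⟪y, y⟫ = 1 := (Q.edge k).pt_inner_self t
  have hcl : IsClosed (⋃ j ∈ {j : Fin 4 | j ≠ k}, (Q.edge j).carrier) :=
    (Set.toFinite _).isClosed_biUnion fun j _ => (Q.edge j).isCompact_carrier.isClosed
  have hyn : y ∉ ⋃ j ∈ {j : Fin 4 | j ≠ k}, (Q.edge j).carrier := by
    simp only [mem_iUnion, not_exists]
    intro j hj
    exact notMem_carrier_of_mem_relInterior hj hyr
  obtain ⟨c, h0, h1, hc⟩ := exists_cap_subset hy1 (hcl.isOpen_compl.mem_nhds hyn)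
  have hsub : halfCap y n c ⊆ unitSphere \ Q.boundary := by
    intro x hx
    refine ⟨hx.1.1, fun hb => ?_⟩
    obtain ⟨j, hj⟩ := mem_iUnion.1 hb
    by_cases hjk : j = k
    · subst hjk
      exact hx.2.ne' (GeodesicArc.inner_normal hn hj)
    · exact hc hx.1 (mem_biUnion (show j ∈ {j : Fin 4 | j ≠ k} from hjk) hj)
  have hev : ∀ᶠ s in 𝓝 t, halfCap y n c ∈ sideNhds ((Q.edge k).pt s) n := by
    have hcont : Continuous fun s => ⟪(Q.edge k).pt s, y⟫ :=
      (Q.edge k).continuous_pt.inner continuous_const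
    have hlt : c < ⟪(Q.edge k).pt t, y⟫ := by rw [← hy, hy1]; exact h1
    filter_upwards [hcont.continuousAt.eventually_const_lt hlt] with s hs
    have ho : IsOpen {z : E3 | c < ⟪z, y⟫} := isOpen_lt (by fun_prop) (by fun_prop)
    rw [sideNhds, mem_nhdsWithin_iff_exists_mem_nhds_inter]
    exact ⟨_, ho.mem_nhds hs, fun x hx => ⟨⟨hx.2.1, hx.1⟩, hx.2.2⟩⟩
  by_cases hne : (halfCap y n c ∩ Q.inside).Nonempty
  · left
    have := subset_inside (isPreconnected_halfCap y n h0) hsub hne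
    filter_upwards [hev] with s hs
    exact mem_of_superset hs this
  · right
    filter_upwards [hev] with s hs
    exact mem_of_superset hs fun x hx hxi => hne ⟨x, hx, hxi⟩

variable (Q)

/-- The inside is adjacent to the edge `k` on the side to which `n` points. -/
def InsideOn (k : Fin 4) (n : E3) : Prop :=
  ∀ t ∈ Ioo 0 (Q.edge k).len, ∀ᶠ x in sideNhds ((Q.edge k).pt t) n, x ∈ Q.inside

/-- The outside is adjacent to the edge `k` on the side to which `n` points. -/
def OutsideOn (k : Fin 4) (n : E3) : Prop :=
  ∀ t ∈ Ioo 0 (Q.edge k).len, ∀ᶠ x in sideNhds ((Q.edge k).pt t) n, x ∉ Q.inside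

variable {Q}

lemma insideOn_or_outsideOn {k : Fin 4} {n : E3}
    (hn : IsFrame (Q.edge k).start (Q.edge k).dir n) : Q.InsideOn k n ∨ Q.OutsideOn k n := by
  set A := {t : ℝ | ∀ᶠ s in 𝓝 t, ∀ᶠ x in sideNhds ((Q.edge k).pt s) n, x ∈ Q.inside}
  set B := {t : ℝ | ∀ᶠ s in 𝓝 t, ∀ᶠ x in sideNhds ((Q.edge k).pt s) n, x ∉ Q.inside}
  have hA : IsOpen A := isOpen_iff_mem_nhds.2 fun t ht => eventually_eventually_nhds.2 ht
  have hB : IsOpen B := isOpen_iff_mem_nhds.2 fun t ht => eventually_eventually_nhds.2 ht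
  have hA' : ∀ t ∈ A, ∀ᶠ x in sideNhds ((Q.edge k).pt t) n, x ∈ Q.inside :=
    fun t ht => Eventually.self_of_nhds
      (p := fun s => ∀ᶠ x in sideNhds ((Q.edge k).pt s) n, x ∈ Q.inside) ht
  have hB' : ∀ t ∈ B, ∀ᶠ x in sideNhds ((Q.edge k).pt t) n, x ∉ Q.inside :=
    fun t ht => Eventually.self_of_nhds
      (p := fun s => ∀ᶠ x in sideNhds ((Q.edge k).pt s) n, x ∉ Q.inside) ht
  have hAB : ∀ t, t ∈ A → t ∉ B := by
    intro t h1 h2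
    have := sideNhds_neBot ((Q.edge k).pt_inner_self t) hn.nn (GeodesicArc.isFrame_pt hn t).pn
    obtain ⟨x, hx1, hx2⟩ := ((hA' t h1).and (hB' t h2)).exists
    exact hx2 hx1
  have hpre : IsPreconnected (Ioo 0 (Q.edge k).len) := isPreconnected_Ioo
  rcases hpre.subset_or_subset hA hB (disjoint_left.2 hAB) (fun t ht => side_dichotomy hn ht)
    with h | h
  · exact Or.inl fun t ht => hA' t (h ht)
  · exact Or.inr fun t ht => hB' t (h ht)

lemma insideOn_of_frequently {k : Fin 4} {n : E3}
    (hn : IsFrame (Q.edge k).start (Q.edge k).dir n) {t : ℝ} (ht : t ∈ Ioo 0 (Q.edge k).len)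
    (h : ∃ᶠ x in sideNhds ((Q.edge k).pt t) n, x ∈ Q.region) : Q.InsideOn k n :=
  (insideOn_or_outsideOn hn).resolve_right fun h' =>
    h (eventually_notMem_region ((Q.edge k).pt_inner_self t) (h' t ht))

lemma outsideOn_of_frequently {k : Fin 4} {n : E3}
    (hn : IsFrame (Q.edge k).start (Q.edge k).dir n) {t : ℝ} (ht : t ∈ Ioo 0 (Q.edge k).len)
    (h : ∃ᶠ x in sideNhds ((Q.edge k).pt t) n, x ∉ Q.region) : Q.OutsideOn k n :=
  (insideOn_or_outsideOn hn).resolve_left fun h' =>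
    h ((h' t ht).mono fun _ hx => not_not.2 (Q.inside_subset_region hx))

end SimpleQuadrilateral

/-! ### Interior angles and inward normals -/

/-- The point with geodesic polar coordinates `(t, φ)` about `p`, with respect to the tangent
vectors `u` and `n`. -/
def polarPt (p u n : E3) (t φ : ℝ) : E3 :=
  Real.cos t • p + Real.sin t • (Real.cos φ • u + Real.sin φ • n)

lemma polarPt_mem_unitSphere {p u n : E3} (h : IsFrame p u n) (t φ : ℝ) :
    polarPt p u n t φ ∈ unitSphere := by
  rw [mem_unitSphere']
  exact ((h.perm.rotate φ).perm.perm.rotate t).pp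

/-- Turning around `p` starting from `(t, φ)`. -/
lemma polarPt_add {p u n : E3} (t φ s : ℝ) :
    polarPt p u n t (φ + s) = Real.cos t • p +
      (Real.cos s • (Real.sin t • (Real.cos φ • u + Real.sin φ • n)) +
        Real.sin s • (Real.sin t • (-Real.sin φ • u + Real.cos φ • n))) := by
  simp only [polarPt, Real.cos_add, Real.sin_add]; module

/-- Turning around `p` in the positive sense from direction `φ` leads to the side of the vector
`-sin φ u + cos φ n`. -/
lemma tendsto_polarPt {p u n : E3} (h : IsFrame p u n) {t : ℝ} (ht : t ∈ Ioo 0 Real.pi) (φ : ℝ) :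
    Tendsto (fun s => polarPt p u n t (φ + s)) (𝓝[>] 0)
      (sideNhds (polarPt p u n t φ) (-Real.sin φ • u + Real.cos φ • n)) := by
  have hst := Real.sin_pos_of_pos_of_lt_pi ht.1 ht.2
  rw [sideNhds, tendsto_nhdsWithin_iff]
  constructor
  · have : Continuous fun s : ℝ => polarPt p u n t (φ + s) := by unfold polarPt; fun_prop
    have h := this.tendsto 0
    simp only [add_zero] at h
    exact h.mono_left nhdsWithin_le_nhds
  · filter_upwards [Ioo_mem_nhdsGT Real.pi_pos] with s hs
    refine ⟨polarPt_mem_unitSphere h _ _, ?_⟩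
    have hnu : ⟪n, u⟫ = 0 := by rw [real_inner_comm]; exact h.un
    simp only [mem_ofPred_eq, polarPt_add, inner_add_left, inner_add_right, real_inner_smul_left,
      real_inner_smul_right, h.pu, h.pn, h.un, hnu, h.uu, h.nn]
    have h1 := Real.sin_pos_of_pos_of_lt_pi hs.1 hs.2
    have h2 := mul_pos h1 hst
    have h3 := Real.sin_sq_add_cos_sq φ
    have : 0 < Real.sin s * Real.sin t * (Real.sin φ ^ 2 + Real.cos φ ^ 2) := by
      rw [h3, mul_one]; exact h2
    linarith

/-- Turning around `p` in the negative sense from direction `φ`. -/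
lemma tendsto_polarPt_sub {p u n : E3} (h : IsFrame p u n) {t : ℝ} (ht : t ∈ Ioo 0 Real.pi)
    (φ : ℝ) :
    Tendsto (fun s => polarPt p u n t (φ - s)) (𝓝[>] 0)
      (sideNhds (polarPt p u n t φ) (Real.sin φ • u - Real.cos φ • n)) := by
  have key : ∀ a, polarPt p u (-n) t (-a) = polarPt p u n t a := by
    intro a; simp [polarPt]
  have := tendsto_polarPt h.neg ht (-φ)
  rw [key] at this
  have e1 : (fun s => polarPt p u n t (φ - s)) = fun s => polarPt p u (-n) t (-φ + s) := by
    funext s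
    rw [← key, neg_sub, sub_eq_neg_add]
  have e2 : Real.sin φ • u - Real.cos φ • n = -Real.sin (-φ) • u + Real.cos (-φ) • -n := by
    rw [Real.sin_neg, Real.cos_neg]; module
  rw [e1, e2]
  exact this

lemma polarPt_sub_two_pi {p u n : E3} (t φ : ℝ) :
    polarPt p u n t (φ - 2 * Real.pi) = polarPt p u n t φ := by
  simp [polarPt]

namespace QuadrilateralA2BC

variable (Q : QuadrilateralA2BC)

/-- The interior angles as a function of the vertex. -/
def angle (k : Fin 4) : ℝ := ![Q.α, Q.β, Q.γ, Q.δ] k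

/-- The inward unit normals of the edges. Those at consecutive edges are related by the interior
angle between the edges. -/
structure IsInwardNormal (N : Fin 4 → E3) : Prop where
  isFrame : ∀ k, IsFrame (Q.edge k).start (Q.edge k).dir (N k)
  backDir_eq : ∀ k, (Q.edge (k - 1)).backDir =
    Real.cos (Q.angle k) • (Q.edge k).dir + Real.sin (Q.angle k) • N k
  normal_eq : ∀ k, N (k - 1) = Real.sin (Q.angle k) • (Q.edge k).dir - Real.cos (Q.angle k) • N k
  insideOn : ∀ k, Q.InsideOn k (N k)
  outsideOn : ∀ k, Q.OutsideOn k (-N k)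
  sector : ∀ k, ∃ r > 0, ∀ t ∈ Ioo 0 r, ∀ φ ∈ Ico 0 (2 * Real.pi),
    (polarPt (Q.vertex k) (Q.edge k).dir (N k) t φ ∈ Q.region ↔ φ ≤ Q.angle k)

lemma angle_pos (k : Fin 4) : 0 < Q.angle k := (Q.angle_vertex k).1

lemma angle_lt (k : Fin 4) : Q.angle k < 2 * Real.pi := (Q.angle_vertex k).2.1

theorem exists_isInwardNormal : ∃ N, Q.IsInwardNormal N := by
  choose hpos hlt n hn1 hn2 hn3 hw r hr hsec using Q.angle_vertex
  have hF : ∀ k, IsFrame (Q.edge k).start (Q.edge k).dir (n k) := fun k =>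
    ⟨(Q.edge k).start_inner, (Q.edge k).dir_inner, inner_self_eq_one_iff.2 (hn1 k),
      (Q.edge k).orth, hn2 k, hn3 k⟩
  have hsec' : ∀ k, ∀ t ∈ Ioo 0 (r k), ∀ φ ∈ Ico 0 (2 * Real.pi),
    (polarPt (Q.vertex k) (Q.edge k).dir (n k) t φ ∈ Q.region ↔ φ ≤ Q.angle k) := hsec
  -- a small radius at which all the local descriptions apply
  have hsmall : ∀ k j, ∃ t, t ∈ Ioo 0 (r k) ∧ t ∈ Ioo 0 Real.pi ∧ t ∈ Ioo 0 (Q.edge j).len := by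
    intro k j
    obtain ⟨t, ht0, ht⟩ := exists_between (lt_min (lt_min (hr k) Real.pi_pos) (Q.edge j).len_pos)
    rw [lt_min_iff, lt_min_iff] at ht
    exact ⟨t, ⟨ht0, ht.1.1⟩, ⟨ht0, ht.1.2⟩, ht0, ht.2⟩
  have hin : ∀ k, Q.InsideOn k (n k) := by
    intro k
    obtain ⟨t, ht1, ht2, ht3⟩ := hsmall k k
    refine SimpleQuadrilateral.insideOn_of_frequently (hF k) ht3 ?_
    have hT := tendsto_polarPt (hF k) ht2 0
    have e : polarPt (Q.edge k).start (Q.edge k).dir (n k) t 0 = (Q.edge k).pt t := by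
      simp [polarPt, GeodesicArc.pt]
    simp only [e, Real.sin_zero, neg_zero, zero_smul, Real.cos_zero, one_smul, zero_add] at hT
    refine hT.frequently (Eventually.frequently ?_)
    filter_upwards [Ioo_mem_nhdsGT (hpos k)] with s hs
    exact (hsec' k t ht1 s ⟨hs.1.le, hs.2.trans (hlt k)⟩).2 hs.2.le
  have hout : ∀ k, Q.OutsideOn k (-n k) := by
    intro k
    obtain ⟨t, ht1, ht2, ht3⟩ := hsmall k k
    refine SimpleQuadrilateral.outsideOn_of_frequently (hF k).neg ht3 ?_
    have hT := tendsto_polarPt_sub (hF k) ht2 0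
    have e : polarPt (Q.edge k).start (Q.edge k).dir (n k) t 0 = (Q.edge k).pt t := by
      simp [polarPt, GeodesicArc.pt]
    simp only [e, Real.sin_zero, zero_smul, Real.cos_zero, one_smul, zero_sub] at hT
    refine hT.frequently (Eventually.frequently ?_)
    filter_upwards [Ioo_mem_nhdsGT (show (0 : ℝ) < 2 * Real.pi - Q.angle k by
      linarith [Q.angle_lt k])] with s hs
    have hs2 : 2 * Real.pi - s ∈ Ico 0 (2 * Real.pi) :=
      ⟨by linarith [hs.2, Q.angle_pos k], by linarith [hs.1]⟩
    have := (hsec' k t ht1 _ hs2).not.2 (by linarith [hs.2])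
    rw [← polarPt_sub_two_pi, show 2 * Real.pi - s - 2 * Real.pi = -s by ring] at this
    exact this
  have hnorm : ∀ k, n (k - 1) =
      Real.sin (Q.angle k) • (Q.edge k).dir - Real.cos (Q.angle k) • n k := by
    intro k
    set θ := Q.angle k with hθ
    obtain ⟨t, ht1, ht2, ht3⟩ := hsmall k (k - 1)
    set e := Q.edge (k - 1) with he
    have hv : Q.vertex k = e.finish := by
      have := Q.closed (k - 1)
      rw [sub_add_cancel] at this
      exact this.symm
    have hw' : e.backDir = Real.cos θ • (Q.edge k).dir + Real.sin θ • n k := hw k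
    -- the candidate for the inward normal of the previous edge
    set N' := Real.sin θ • (Q.edge k).dir - Real.cos θ • n k with hN'
    have hst : (Q.edge k).start = e.finish := hv
    have hfr : IsFrame e.finish e.backDir N' := by
      have h1 := ((hF k).perm.rotate θ).perm.perm
      rw [hst] at h1
      have h2 : N' = -(-Real.sin θ • (Q.edge k).dir + Real.cos θ • n k) := by rw [hN']; module
      rw [hw', h2]
      exact h1.neg
    have hF' : IsFrame e.start e.dir N' := by
      have hn' : IsFrame (e.pt e.len) (e.vel e.len) N' := by
        have : e.vel e.len = -e.backDir := by rw [e.backDir_eq, neg_neg]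
        rw [this, e.pt_len]
        exact hfr.swap.neg.swap
      have h1 := hn'.rotate (-e.len)
      have e1 := e.pt_add e.len (-e.len)
      have e2 := e.vel_add e.len (-e.len)
      rw [add_neg_cancel] at e1 e2
      rw [← e1, ← e2] at h1
      simpa [GeodesicArc.pt, GeodesicArc.vel] using h1
    have hm : e.len - t ∈ Ioo 0 e.len := ⟨by linarith [ht3.2], by linarith [ht3.1]⟩
    have hpt : polarPt (Q.vertex k) (Q.edge k).dir (n k) t θ = e.pt (e.len - t) := by
      rw [e.pt_len_sub, hw', polarPt, hv]
    have hin' : Q.InsideOn (k - 1) N' := by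
      refine SimpleQuadrilateral.insideOn_of_frequently hF' hm ?_
      have hT := tendsto_polarPt_sub (hF k) ht2 θ
      rw [show (Q.edge k).start = Q.vertex k from rfl, hpt] at hT
      refine hT.frequently (Eventually.frequently ?_)
      filter_upwards [Ioo_mem_nhdsGT (Q.angle_pos k)] with s hs
      exact (hsec' k t ht1 _ ⟨by linarith [hs.2], by linarith [hs.1, Q.angle_lt k]⟩).2
        (by linarith [hs.1])
    rcases (hF (k - 1)).eq_or_eq_neg hF' with h | h
    · exact h.symm
    · exfalso
      rw [h] at hin'
      have := sideNhds_neBot (e.pt_inner_self (e.len - t)) (hF (k - 1)).neg.nn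
        (GeodesicArc.isFrame_pt (hF (k - 1)).neg _).pn
      obtain ⟨x, hx1, hx2⟩ := ((hin' _ hm).and (hout (k - 1) _ hm)).exists
      exact hx2 hx1
  exact ⟨n, hF, hw, hnorm, hin, hout, fun k => ⟨r k, hr k, hsec' k⟩⟩

/-- A choice of the inward normals. -/
def normal : Fin 4 → E3 := Q.exists_isInwardNormal.choose

lemma isInwardNormal : Q.IsInwardNormal Q.normal := Q.exists_isInwardNormal.choose_spec

/-! ### The image of a quadrilateral under an isometry -/

lemma _root_.image_unitSphere (g : E3 ≃ₗᵢ[ℝ] E3) : g '' unitSphere = unitSphere := by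
  simp [unitSphere]

/-- The image of a quadrilateral under an isometry of the sphere. -/
def map (g : E3 ≃ₗᵢ[ℝ] E3) : QuadrilateralA2BC where
  edge k := (Q.edge k).map g
  closed k := by
    change ((Q.edge k).map g).pt (Q.edge k).len = g (Q.edge (k + 1)).start
    rw [GeodesicArc.map_pt, ← Q.closed k]; rfl
  adjacent_edges k := by
    rw [GeodesicArc.map_carrier, GeodesicArc.map_carrier, ← image_inter g.injective,
      Q.adjacent_edges k, image_singleton]; rfl
  opposite_edges k := by
    rw [GeodesicArc.map_carrier, GeodesicArc.map_carrier, disjoint_image_iff g.injective]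
    exact Q.opposite_edges k
  inside := g '' Q.inside
  inside_component := by
    obtain ⟨x, hx, h⟩ := Q.inside_component
    have e : unitSphere \ ⋃ k, ((Q.edge k).map g).carrier =
        g '' (unitSphere \ ⋃ k, (Q.edge k).carrier) := by
      rw [image_sdiff g.injective, image_unitSphere, image_iUnion]
      simp only [GeodesicArc.map_carrier]
    refine ⟨g x, ?_, ?_⟩
    · rw [e]; exact mem_image_of_mem _ hx
    · rw [e, h]
      exact g.toHomeomorph.image_connectedComponentIn hx
  a := Q.a
  b := Q.b
  c := Q.c
  len_edge := Q.len_edge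
  a_ne_b := Q.a_ne_b
  b_ne_c := Q.b_ne_c
  c_ne_a := Q.c_ne_a
  α := Q.α
  β := Q.β
  γ := Q.γ
  δ := Q.δ
  angle_vertex k := by
    obtain ⟨h1, h2, n, h3, h4, h5, h6, r, hr, h7⟩ := Q.angle_vertex k
    have e : closure (g '' Q.inside) = g '' closure Q.inside :=
      (g.toHomeomorph.image_closure Q.inside).symm
    refine ⟨h1, h2, g n, by rw [g.norm_map, h3], ?_, ?_, ?_, r, hr, fun t ht φ hφ => ?_⟩
    · exact (g.inner_map_map _ _).trans h4
    · exact (g.inner_map_map _ _).trans h5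
    · rw [GeodesicArc.map_backDir, h6]; simp [GeodesicArc.map]
    · rw [← h7 t ht φ hφ]
      change _ ∈ closure (g '' Q.inside) ↔ _ ∈ closure Q.inside
      rw [e, ← g.injective.mem_set_image (s := closure Q.inside)]
      simp [SimpleQuadrilateral.vertex, GeodesicArc.map]

lemma map_region (g : E3 ≃ₗᵢ[ℝ] E3) : (Q.map g).region = g '' Q.region :=
  (g.toHomeomorph.image_closure Q.inside).symm

lemma map_relInterior (g : E3 ≃ₗᵢ[ℝ] E3) (k : Fin 4) :
    ((Q.map g).edge k).relInterior = g '' (Q.edge k).relInterior := GeodesicArc.map_relInterior _ _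

end QuadrilateralA2BC

/-! ### The holonomy of the boundary curve -/

/-- A complex coordinate of the tangent vector `w` at the point `p` of the sphere, `p ≠ -v`: up to
the factor `1 + ⟪p, v⟫`, the coordinate with respect to `e₁, e₂` of the vector obtained from `w` by
the shortest rotation that takes `p` to `v`. -/
def tangentCoord (e₁ e₂ v p w : E3) : ℂ :=
  (1 + ⟪p, v⟫) * (⟪w, e₁⟫ + ⟪w, e₂⟫ * Complex.I) - ⟪w, v⟫ * (⟪p, e₁⟫ + ⟪p, e₂⟫ * Complex.I)

/-- `n` is the cross product of `p` and `u` in the coordinates given by `e₁, e₂, v`. -/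
def IsCross (e₁ e₂ v p u n : E3) : Prop :=
  ⟪n, e₁⟫ = ⟪p, e₂⟫ * ⟪u, v⟫ - ⟪p, v⟫ * ⟪u, e₂⟫ ∧
  ⟪n, e₂⟫ = ⟪p, v⟫ * ⟪u, e₁⟫ - ⟪p, e₁⟫ * ⟪u, v⟫ ∧
  ⟪n, v⟫ = ⟪p, e₁⟫ * ⟪u, e₂⟫ - ⟪p, e₂⟫ * ⟪u, e₁⟫

/-- Every unit vector is the last vector of a frame of the same orientation as a given frame. -/
lemma exists_isCross {p u n v : E3} (h : IsFrame p u n) (hv : ⟪v, v⟫ = 1) :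
    ∃ e₁ e₂, IsFrame e₁ e₂ v ∧ IsCross e₁ e₂ v p u n := by
  obtain ⟨e₁, e₂, he⟩ := exists_isFrame hv
  replace he := he.perm
  set c := (⟪p, e₂⟫ * ⟪u, v⟫ - ⟪p, v⟫ * ⟪u, e₂⟫) • e₁ +
    (⟪p, v⟫ * ⟪u, e₁⟫ - ⟪p, e₁⟫ * ⟪u, v⟫) • e₂ +
    (⟪p, e₁⟫ * ⟪u, e₂⟫ - ⟪p, e₂⟫ * ⟪u, e₁⟫) • v with hc
  have he21 : ⟪e₂, e₁⟫ = 0 := by rw [real_inner_comm]; exact he.pu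
  have he31 : ⟪v, e₁⟫ = 0 := by rw [real_inner_comm]; exact he.pn
  have he32 : ⟪v, e₂⟫ = 0 := by rw [real_inner_comm]; exact he.un
  have c1 : ⟪c, e₁⟫ = ⟪p, e₂⟫ * ⟪u, v⟫ - ⟪p, v⟫ * ⟪u, e₂⟫ := by
    simp only [hc, inner_add_left, real_inner_smul_left, he.pp, he21, he31]; ring
  have c2 : ⟪c, e₂⟫ = ⟪p, v⟫ * ⟪u, e₁⟫ - ⟪p, e₁⟫ * ⟪u, v⟫ := by
    simp only [hc, inner_add_left, real_inner_smul_left, he.uu, he.pu, he32]; ring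
  have c3 : ⟪c, v⟫ = ⟪p, e₁⟫ * ⟪u, e₂⟫ - ⟪p, e₂⟫ * ⟪u, e₁⟫ := by
    simp only [hc, inner_add_left, real_inner_smul_left, he.nn, he.un, he.pn]; ring
  have hpp := he.inner_eq p p
  have huu := he.inner_eq u u
  have hpu := he.inner_eq p u
  rw [h.pp] at hpp
  rw [h.uu] at huu
  rw [h.pu] at hpu
  have hfr : IsFrame p u c := by
    refine ⟨h.pp, h.uu, ?_, h.pu, ?_, ?_⟩
    · rw [he.inner_eq, c1, c2, c3]
      linear_combination -(⟪u, e₁⟫ * ⟪u, e₁⟫ + ⟪u, e₂⟫ * ⟪u, e₂⟫ + ⟪u, v⟫ * ⟪u, v⟫) * hpp - huu +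
        (⟪p, e₁⟫ * ⟪u, e₁⟫ + ⟪p, e₂⟫ * ⟪u, e₂⟫ + ⟪p, v⟫ * ⟪u, v⟫) * hpu
    · rw [he.inner_eq, c1, c2, c3]; ring
    · rw [he.inner_eq, c1, c2, c3]; ring
  rcases hfr.eq_or_eq_neg h with hn | hn
  · refine ⟨e₁, e₂, he, ?_⟩
    rw [hn]; exact ⟨c1, c2, c3⟩
  · refine ⟨e₁, -e₂, he.swap.neg.swap, ?_⟩
    rw [hn]
    refine ⟨?_, ?_, ?_⟩ <;> simp only [inner_neg_left, inner_neg_right, c1, c2, c3] <;> ring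

section

variable {e₁ e₂ v p u n : E3}

lemma IsCross.rotate (h : IsCross e₁ e₂ v p u n) (t : ℝ) :
    IsCross e₁ e₂ v (Real.cos t • p + Real.sin t • u) (-Real.sin t • p + Real.cos t • u) n := by
  obtain ⟨h1, h2, h3⟩ := h
  have := Real.sin_sq_add_cos_sq t
  simp only [IsCross, inner_add_left, real_inner_smul_left]
  refine ⟨?_, ?_, ?_⟩
  · rw [h1]; linear_combination -(⟪p, e₂⟫ * ⟪u, v⟫ - ⟪p, v⟫ * ⟪u, e₂⟫) * this
  · rw [h2]; linear_combination -(⟪p, v⟫ * ⟪u, e₁⟫ - ⟪p, e₁⟫ * ⟪u, v⟫) * this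
  · rw [h3]; linear_combination -(⟪p, e₁⟫ * ⟪u, e₂⟫ - ⟪p, e₂⟫ * ⟪u, e₁⟫) * this

lemma IsCross.swap (he : IsFrame e₁ e₂ v) (hf : IsFrame p u n) (h : IsCross e₁ e₂ v p u n) :
    IsCross e₁ e₂ v p n (-u) := by
  obtain ⟨h1, h2, h3⟩ := h
  have hpp := he.inner_eq p p
  have hpu := he.inner_eq p u
  rw [hf.pp] at hpp
  rw [hf.pu] at hpu
  simp only [IsCross, inner_neg_left, h1, h2, h3]
  refine ⟨?_, ?_, ?_⟩
  · linear_combination -⟪u, e₁⟫ * hpp + ⟪p, e₁⟫ * hpu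
  · linear_combination -⟪u, e₂⟫ * hpp + ⟪p, e₂⟫ * hpu
  · linear_combination -⟪u, v⟫ * hpp + ⟪p, v⟫ * hpu

lemma IsCross.add {u' n' : E3} (a b : ℝ) (h : IsCross e₁ e₂ v p u n)
    (h' : IsCross e₁ e₂ v p u' n') : IsCross e₁ e₂ v p (a • u + b • u') (a • n + b • n') := by
  obtain ⟨h1, h2, h3⟩ := h
  obtain ⟨h1', h2', h3'⟩ := h'
  simp only [IsCross, inner_add_left, real_inner_smul_left, h1, h2, h3, h1', h2', h3']
  refine ⟨?_, ?_, ?_⟩ <;> ring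

lemma tangentCoord_comb (a b : ℝ) (w w' : E3) : tangentCoord e₁ e₂ v p (a • w + b • w') =
    a * tangentCoord e₁ e₂ v p w + b * tangentCoord e₁ e₂ v p w' := by
  simp only [tangentCoord, inner_add_left, real_inner_smul_left]
  push_cast; ring

lemma tangentCoord_cross (he : IsFrame e₁ e₂ v) (hf : IsFrame p u n)
    (h : IsCross e₁ e₂ v p u n) :
    tangentCoord e₁ e₂ v p n = Complex.I * tangentCoord e₁ e₂ v p u := by
  obtain ⟨h1, h2, h3⟩ := h
  have hpp := he.inner_eq p p
  have hpu := he.inner_eq p u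
  rw [hf.pp] at hpp
  rw [hf.pu] at hpu
  apply Complex.ext <;> simp [tangentCoord, h1, h2, h3]
  · linear_combination ⟪u, e₂⟫ * hpp - ⟪p, e₂⟫ * hpu
  · linear_combination -⟪u, e₁⟫ * hpp + ⟪p, e₁⟫ * hpu

lemma tangentCoord_point (he : IsFrame e₁ e₂ v) (hf : IsFrame p u n)
    (h : IsCross e₁ e₂ v p u n) :
    (1 + ⟪p, v⟫ : ℂ) * (⟪p, e₁⟫ + ⟪p, e₂⟫ * Complex.I) =
      -(⟪u, v⟫ + Complex.I * ⟪n, v⟫) * tangentCoord e₁ e₂ v p u := by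
  obtain ⟨h1, h2, h3⟩ := h
  have hpp := he.inner_eq p p
  have hpu := he.inner_eq p u
  have huu := he.inner_eq u u
  rw [hf.pp] at hpp
  rw [hf.uu] at huu
  rw [hf.pu] at hpu
  apply Complex.ext <;> simp [tangentCoord, h3]
  · linear_combination (1 + ⟪p, v⟫) * (⟪p, e₁⟫ * huu - ⟪u, e₁⟫ * hpu) +
      ⟪u, v⟫ * (⟪u, e₁⟫ * hpp - ⟪p, e₁⟫ * hpu)
  · linear_combination (1 + ⟪p, v⟫) * (⟪p, e₂⟫ * huu - ⟪u, e₂⟫ * hpu) +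
      ⟪u, v⟫ * (⟪u, e₂⟫ * hpp - ⟪p, e₂⟫ * hpu)

lemma tangentCoord_ne_zero (he : IsFrame e₁ e₂ v) (hf : IsFrame p u n)
    (h : IsCross e₁ e₂ v p u n) (hp : 1 + ⟪p, v⟫ ≠ 0) : tangentCoord e₁ e₂ v p u ≠ 0 := by
  intro h0
  have h1 := tangentCoord_point he hf h
  rw [h0, mul_zero] at h1
  have hp' : (1 + ⟪p, v⟫ : ℂ) ≠ 0 := by exact_mod_cast hp
  have h2 := (mul_eq_zero.1 h1).resolve_left hp'
  rw [tangentCoord, h2, mul_zero, sub_zero] at h0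
  have h3 := (mul_eq_zero.1 h0).resolve_left hp'
  have a1 := congrArg Complex.re h2
  have a2 := congrArg Complex.im h2
  have a3 := congrArg Complex.re h3
  have a4 := congrArg Complex.im h3
  simp at a1 a2 a3 a4
  have hpp := he.inner_eq p p
  have hpu := he.inner_eq p u
  have huu := he.inner_eq u u
  rw [hf.pp, a1, a2] at hpp
  rw [hf.uu, a3, a4] at huu
  rw [hf.pu, a1, a2] at hpu
  have : (⟪p, v⟫ * ⟪u, v⟫) * (⟪p, v⟫ * ⟪u, v⟫) = 1 := by nlinarith
  nlinarith

/-- Along a geodesic the tangent vector is parallel, so the argument of its complex coordinate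
turns by twice the argument of an explicit complex number. -/
lemma tangentCoord_geodesic (he : IsFrame e₁ e₂ v) (hf : IsFrame p u n)
    (h : IsCross e₁ e₂ v p u n) (t : ℝ) :
    tangentCoord e₁ e₂ v (Real.cos (2 * t) • p + Real.sin (2 * t) • u)
        (-Real.sin (2 * t) • p + Real.cos (2 * t) • u) * (1 + ⟪p, v⟫) ^ 2 =
      tangentCoord e₁ e₂ v p u *
        (Real.cos t * (1 + ⟪p, v⟫) + Real.sin t * (⟪u, v⟫ + Complex.I * ⟪n, v⟫)) ^ 2 := by
  have hz := tangentCoord_point he hf h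
  have hT : tangentCoord e₁ e₂ v p u = (1 + ⟪p, v⟫) * (⟪u, e₁⟫ + ⟪u, e₂⟫ * Complex.I) -
    ⟪u, v⟫ * (⟪p, e₁⟫ + ⟪p, e₂⟫ * Complex.I) := rfl
  have hvv := hf.inner_eq v v
  rw [he.nn, real_inner_comm p v, real_inner_comm u v, real_inner_comm n v] at hvv
  have hvv' : (1 : ℂ) = ⟪p, v⟫ * ⟪p, v⟫ + ⟪u, v⟫ * ⟪u, v⟫ + ⟪n, v⟫ * ⟪n, v⟫ := by
    exact_mod_cast hvv
  have hcs : (Real.sin t : ℂ) ^ 2 + (Real.cos t : ℂ) ^ 2 = 1 := by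
    exact_mod_cast Real.sin_sq_add_cos_sq t
  have hI := Complex.I_sq
  generalize tangentCoord e₁ e₂ v p u = T at *
  simp only [tangentCoord, inner_add_left, real_inner_smul_left]
  have e1 : ((Real.cos (2 * t) : ℝ) : ℂ) = 2 * (Real.cos t : ℂ) ^ 2 - 1 := by
    rw [Real.cos_two_mul]; push_cast; ring
  have e2 : ((Real.sin (2 * t) : ℝ) : ℂ) = 2 * (Real.sin t : ℂ) * (Real.cos t : ℂ) := by
    rw [Real.sin_two_mul]; push_cast; ring
  push_cast only [Complex.ofReal_add, Complex.ofReal_mul, Complex.ofReal_neg]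
  rw [e1, e2]
  generalize (Real.cos t : ℂ) = c at *
  generalize (Real.sin t : ℂ) = s at *
  generalize (⟪p, v⟫ : ℂ) = p3 at *
  generalize (⟪u, v⟫ : ℂ) = u3 at *
  generalize (⟪n, v⟫ : ℂ) = n3 at *
  generalize (⟪p, e₁⟫ : ℂ) = p1 at *
  generalize (⟪p, e₂⟫ : ℂ) = p2 at *
  generalize (⟪u, e₁⟫ : ℂ) = u1 at *
  generalize (⟪u, e₂⟫ : ℂ) = u2 at *
  -- the bracket in `tangentCoord` does not change when the frame turns about its normal
  have step : (1 + ((2 * c ^ 2 - 1) * p3 + 2 * s * c * u3)) *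
      ((-(2 * s * c) * p1 + (2 * c ^ 2 - 1) * u1) +
        (-(2 * s * c) * p2 + (2 * c ^ 2 - 1) * u2) * Complex.I) -
      (-(2 * s * c) * p3 + (2 * c ^ 2 - 1) * u3) *
      (((2 * c ^ 2 - 1) * p1 + 2 * s * c * u1) +
        ((2 * c ^ 2 - 1) * p2 + 2 * s * c * u2) * Complex.I) =
      -(2 * s * c) * (p1 + p2 * Complex.I) + (2 * c ^ 2 - 1) * (u1 + u2 * Complex.I) + T -
        (u1 + u2 * Complex.I) := by
    linear_combination 4 * c ^ 2 * (p3 * (u1 + u2 * Complex.I) - u3 * (p1 + p2 * Complex.I)) * hcs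
      - hT
  rw [step]
  linear_combination (-(2 * s * c) * (1 + p3) + (2 * c ^ 2 - 2) * u3) * hz
    - (2 * c ^ 2 - 2) * (1 + p3) * hT
    + T * (2 * ((1 + p3) - u3 * (u3 + Complex.I * n3)) - (1 + p3) ^ 2) * hcs
    - T * s ^ 2 * hvv' - T * s ^ 2 * n3 ^ 2 * hI

end

namespace QuadrilateralA2BC

variable (Q : QuadrilateralA2BC)

/-- Half the argument turned by a vector carried by parallel transport along the edge `k`, in the
trivialisation of the tangent bundle off `x`, is the argument of this complex number. It vanishes
only at the end points of the edge, and is negative real exactly on the edge. -/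
def edgeFactor (k : Fin 4) (x : E3) : ℂ :=
  ⟨Real.cos ((Q.edge k).len / 2) - ⟪x, (Q.edge k).pt ((Q.edge k).len / 2)⟫,
    -(Real.sin ((Q.edge k).len / 2) * ⟪x, Q.normal k⟫)⟩

/-- The total turning along the boundary curve is the sum of the interior angles. -/
theorem prod_edgeFactor_sq {x : E3} (hx : x ∈ unitSphere) (hxv : ∀ k, x ≠ Q.vertex k) :
    ∏ k, Q.edgeFactor k x ^ 2 =
      Complex.exp ((∑ k, Q.angle k : ℝ) * Complex.I) * ∏ k, (1 - ⟪Q.vertex k, x⟫ : ℂ) ^ 2 := by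
  have hN := Q.isInwardNormal
  set N := Q.normal with hNdef
  have hx1 := mem_unitSphere'.1 hx
  obtain ⟨e₁, e₂, he, hc0⟩ := exists_isCross (hN.isFrame 0) (v := -x) (by simpa using hx1)
  have hend : ∀ k, IsCross e₁ e₂ (-x) (Q.edge k).start (Q.edge k).dir (N k) →
      IsCross e₁ e₂ (-x) (Q.edge k).finish (-(Q.edge k).backDir) (N k) := by
    intro k h
    have := h.rotate (Q.edge k).len
    rw [(Q.edge k).backDir_eq, neg_neg]
    exact this
  -- the inverse of the rotation by the interior angle
  have hdir : ∀ k, (Q.edge (k + 1)).dir = Real.cos (Q.angle (k + 1)) • (Q.edge k).backDir +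
      Real.sin (Q.angle (k + 1)) • N k := by
    intro k
    have h1 := hN.backDir_eq (k + 1)
    have h2 := hN.normal_eq (k + 1)
    rw [add_sub_cancel_right] at h1 h2
    rw [h1, h2]
    have := Real.sin_sq_add_cos_sq (Q.angle (k + 1))
    have e : (Real.cos (Q.angle (k + 1)) ^ 2 + Real.sin (Q.angle (k + 1)) ^ 2) •
      (Q.edge (k + 1)).dir = (Q.edge (k + 1)).dir := by rw [add_comm, this, one_smul]
    conv_lhs => rw [← e]
    module
  have hnor : ∀ k, N (k + 1) = Real.sin (Q.angle (k + 1)) • (Q.edge k).backDir -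
      Real.cos (Q.angle (k + 1)) • N k := by
    intro k
    have h1 := hN.backDir_eq (k + 1)
    have h2 := hN.normal_eq (k + 1)
    rw [add_sub_cancel_right] at h1 h2
    rw [h1, h2]
    have := Real.sin_sq_add_cos_sq (Q.angle (k + 1))
    have e : (Real.cos (Q.angle (k + 1)) ^ 2 + Real.sin (Q.angle (k + 1)) ^ 2) •
      N (k + 1) = N (k + 1) := by rw [add_comm, this, one_smul]
    conv_lhs => rw [← e]
    module
  have hfrend : ∀ k, IsFrame (Q.edge k).finish (-(Q.edge k).backDir) (N k) := by
    intro k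
    rw [(Q.edge k).backDir_eq, neg_neg]
    exact GeodesicArc.isFrame_pt (hN.isFrame k) _
  have hstep : ∀ k, IsCross e₁ e₂ (-x) (Q.edge k).start (Q.edge k).dir (N k) →
      IsCross e₁ e₂ (-x) (Q.edge (k + 1)).start (Q.edge (k + 1)).dir (N (k + 1)) := by
    intro k h
    have h1 := hend k h
    have h2 := h1.swap he (hfrend k)
    rw [neg_neg] at h2
    have h3 := h1.add (-Real.cos (Q.angle (k + 1))) (Real.sin (Q.angle (k + 1))) h2
    rw [← Q.closed k, hdir, hnor]
    convert h3 using 1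
    · module
    · module
  have hc : ∀ k, IsCross e₁ e₂ (-x) (Q.edge k).start (Q.edge k).dir (N k) := by
    have h1 := hstep 0 hc0
    have h2 := hstep 1 h1
    have h3 := hstep 2 h2
    intro k
    fin_cases k
    exacts [hc0, h1, h2, h3]
  set T : Fin 4 → ℂ := fun k => tangentCoord e₁ e₂ (-x) (Q.edge k).start (Q.edge k).dir with hT
  have hP : ∀ k, 1 + ⟪(Q.edge k).start, -x⟫ ≠ 0 := by
    intro k h0
    rw [inner_neg_right] at h0
    have h1 := norm_sub_sq_unit hx1 (Q.edge k).start_inner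
    rw [real_inner_comm] at h1
    have h2 : ‖x - (Q.edge k).start‖ ^ 2 = 0 := by rw [h1]; linarith
    exact hxv k (sub_eq_zero.1 (norm_eq_zero.1 (pow_eq_zero_iff two_ne_zero |>.1 h2)))
  have hT0 : ∀ k, T k ≠ 0 := fun k => tangentCoord_ne_zero he (hN.isFrame k) (hc k) (hP k)
  have hrel : ∀ k, -(T (k + 1) * Complex.exp (Q.angle (k + 1) * Complex.I)) *
      (1 - ⟪Q.vertex k, x⟫ : ℂ) ^ 2 = T k * Q.edgeFactor k x ^ 2 := by
    intro k
    have h1 := tangentCoord_geodesic he (hN.isFrame k) (hc k) ((Q.edge k).len / 2)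
    rw [show 2 * ((Q.edge k).len / 2) = (Q.edge k).len by ring] at h1
    have h2 : tangentCoord e₁ e₂ (-x) (Q.edge (k + 1)).start (Q.edge k).backDir =
        T (k + 1) * Complex.exp (Q.angle (k + 1) * Complex.I) := by
      have h3 := hN.backDir_eq (k + 1)
      rw [add_sub_cancel_right] at h3
      rw [h3, tangentCoord_comb, tangentCoord_cross he (hN.isFrame (k + 1)) (hc (k + 1)),
        Complex.exp_mul_I, hT]
      push_cast
      ring
    have h4 : tangentCoord e₁ e₂ (-x) (Real.cos (Q.edge k).len • (Q.edge k).start +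
        Real.sin (Q.edge k).len • (Q.edge k).dir) (-Real.sin (Q.edge k).len • (Q.edge k).start +
        Real.cos (Q.edge k).len • (Q.edge k).dir) =
        -(T (k + 1) * Complex.exp (Q.angle (k + 1) * Complex.I)) := by
      rw [← h2, ← Q.closed k]
      have h5 := tangentCoord_comb (e₁ := e₁) (e₂ := e₂) (v := -x) (p := (Q.edge k).finish) (-1) 0
        (Q.edge k).backDir 0
      have h6 : (-1 : ℝ) • (Q.edge k).backDir + (0 : ℝ) • (0 : E3) =
        -Real.sin (Q.edge k).len • (Q.edge k).start +
        Real.cos (Q.edge k).len • (Q.edge k).dir := by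
        rw [GeodesicArc.backDir]; module
      rw [h6] at h5
      refine Eq.trans h5 ?_
      push_cast
      ring
    rw [h4] at h1
    have h7 : (1 + ⟪(Q.edge k).start, -x⟫ : ℂ) = 1 - ⟪Q.vertex k, x⟫ := by
      rw [inner_neg_right, SimpleQuadrilateral.vertex]; push_cast; ring
    rw [h7] at h1
    rw [h1]
    congr 2
    simp only [edgeFactor, GeodesicArc.pt, inner_add_right, real_inner_smul_right,
      SimpleQuadrilateral.vertex, inner_neg_right]
    rw [real_inner_comm x, real_inner_comm x, real_inner_comm x, hNdef]
    generalize Real.cos ((Q.edge k).len / 2) = c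
    generalize Real.sin ((Q.edge k).len / 2) = s
    apply Complex.ext <;> simp
    ring
  have hprod : ∏ k, (-(T (k + 1) * Complex.exp (Q.angle (k + 1) * Complex.I)) *
      (1 - ⟪Q.vertex k, x⟫ : ℂ) ^ 2) = ∏ k, T k * Q.edgeFactor k x ^ 2 :=
    Finset.prod_congr rfl fun k _ => hrel k
  rw [Finset.prod_mul_distrib, Finset.prod_mul_distrib, Finset.prod_neg, Finset.prod_mul_distrib,
    Fintype.prod_equiv (Equiv.addRight (1 : Fin 4)) (fun k => T (k + 1)) T (fun k => rfl),
    Fintype.prod_equiv (Equiv.addRight (1 : Fin 4))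
      (fun k => Complex.exp (Q.angle (k + 1) * Complex.I))
      (fun k => Complex.exp (Q.angle k * Complex.I)) (fun k => rfl), ← Complex.exp_sum] at hprod
  have hT1 : ∏ k, T k ≠ 0 := Finset.prod_ne_zero_iff.2 fun k _ => hT0 k
  apply mul_left_cancel₀ hT1
  rw [← hprod, ← Finset.sum_mul]
  simp only [Finset.card_univ, Fintype.card_fin]
  push_cast
  ring

end QuadrilateralA2BC

/-! ### The turning function of the boundary curve -/

/-- The sphere without finitely many points is connected: project it from one of them. -/
lemma isPreconnected_unitSphere_diff {F : Set E3} (hF : F.Finite) {v : E3} (hv : v ∈ unitSphere)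
    (hvF : v ∈ F) : IsPreconnected (unitSphere \ F) := by
  have hv1 : ‖v‖ = 1 := mem_unitSphere.1 hv
  have hrank : Module.finrank ℝ (ℝ ∙ v)ᗮ = 2 := by
    have : Fact (Module.finrank ℝ E3 = 2 + 1) := ⟨by simp⟩
    exact Submodule.finrank_orthogonal_span_singleton (n := 2) (by intro h; simp [h] at hv1)
  have hrank' : 1 < Module.rank ℝ (ℝ ∙ v)ᗮ := by
    rw [← Module.finrank_eq_rank, hrank]; norm_num
  set φ := stereographic hv1 with hφ
  set ψ : (ℝ ∙ v)ᗮ → E3 := fun w => (φ.symm w : E3) with hψ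
  have hinj : Function.Injective ψ := by
    intro a b hab
    have := φ.symm.injOn (by simp [hφ]) (by simp [hφ]) (Subtype.ext hab)
    exact this
  have hcount : (ψ ⁻¹' F).Countable := (hF.preimage hinj.injOn).countable
  have hconn := (hcount.isPathConnected_compl_of_one_lt_rank hrank').isConnected.isPreconnected
  have hcont : Continuous ψ := by
    rw [← continuousOn_univ]
    have := φ.symm.continuousOn
    rw [φ.symm_source] at this
    simp only [hφ, stereographic_target] at this
    exact continuous_subtype_val.comp_continuousOn this
  have : unitSphere \ F = ψ '' (ψ ⁻¹' F)ᶜ := by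
    ext x
    constructor
    · rintro ⟨hx, hxF⟩
      have hxs : (⟨x, hx⟩ : Metric.sphere (0 : E3) 1) ∈ φ.source := by
        simp only [hφ, stereographic_source, mem_compl_iff, mem_singleton_iff]
        intro h
        have hxv : x = v := congrArg Subtype.val h
        rw [hxv] at hxF
        exact hxF hvF
      have e : ψ (φ ⟨x, hx⟩) = x := by simp only [hψ, φ.left_inv hxs]
      exact ⟨φ ⟨x, hx⟩, by simpa [e] using hxF, e⟩
    · rintro ⟨w, hw, rfl⟩
      exact ⟨(φ.symm w).2, hw⟩
  rw [this]
  exact hconn.image _ hcont.continuousOn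

/-- A continuous real function on a preconnected set that is constant modulo `2π` is constant. -/
lemma IsPreconnected.eq_of_exp_eq {S : Set E3} (hS : IsPreconnected S) {H : E3 → ℝ}
    (hH : ContinuousOn H S) {θ : ℝ}
    (he : ∀ x ∈ S, Complex.exp (H x * Complex.I) = Complex.exp (θ * Complex.I)) {x y : E3}
    (hx : x ∈ S) (hy : y ∈ S) : H x = H y := by
  have key : ∀ a ∈ H '' S, ∃ m : ℤ, a = θ + m * (2 * Real.pi) := by
    rintro _ ⟨z, hz, rfl⟩
    obtain ⟨m, hm⟩ := Complex.exp_eq_exp_iff_exists_int.1 (he z hz)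
    refine ⟨m, ?_⟩
    have := congrArg Complex.im hm
    simpa using this
  have hord := (hS.image H hH).ordConnected
  have hpi := Real.pi_pos
  have main : ∀ a ∈ H '' S, ∀ b ∈ H '' S, ¬ a < b := by
    intro a ha b hb hab
    obtain ⟨m, hm⟩ := key a ha
    obtain ⟨n, hn⟩ := key b hb
    have h1 : (m : ℝ) < n := by
      by_contra h
      push Not at h
      have := mul_le_mul_of_nonneg_right h (show 0 ≤ 2 * Real.pi by linarith)
      linarith
    have h2 : (m : ℝ) + 1 ≤ n := by exact_mod_cast h1
    have h3 := mul_le_mul_of_nonneg_right h2 (show 0 ≤ 2 * Real.pi by linarith)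
    obtain ⟨l, hl⟩ := key (a + Real.pi) (hord.out ha hb ⟨by linarith, by linarith⟩)
    have h4 : ((l - m : ℤ) : ℝ) * 2 = 1 := by
      have : Real.pi * (((l - m : ℤ) : ℝ) * 2 - 1) = 0 := by push_cast; linarith
      rcases mul_eq_zero.1 this with h | h
      · exact absurd h hpi.ne'
      · linarith
    have h5 : (l - m) * 2 = 1 := by exact_mod_cast h4
    omega
  exact le_antisymm (not_lt.1 (main _ ⟨y, hy, rfl⟩ _ ⟨x, hx, rfl⟩))
    (not_lt.1 (main _ ⟨x, hx, rfl⟩ _ ⟨y, hy, rfl⟩))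

namespace QuadrilateralA2BC

variable (Q : QuadrilateralA2BC)

lemma sin_half_len_pos (k : Fin 4) : 0 < Real.sin ((Q.edge k).len / 2) :=
  Real.sin_pos_of_pos_of_lt_pi (by linarith [(Q.edge k).len_pos]) (by linarith [(Q.edge k).len_lt])

lemma continuous_edgeFactor (k : Fin 4) : Continuous (Q.edgeFactor k) := by
  have : Q.edgeFactor k = fun x =>
    ((Real.cos ((Q.edge k).len / 2) - ⟪x, (Q.edge k).pt ((Q.edge k).len / 2)⟫ : ℝ) : ℂ) +
      ((-(Real.sin ((Q.edge k).len / 2) * ⟪x, Q.normal k⟫) : ℝ) : ℂ) * Complex.I := by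
    funext x
    exact Complex.mk_eq_add_mul_I _ _
  rw [this]
  fun_prop

variable {Q}

lemma mem_carrier_of_edgeFactor {k : Fin 4} {x : E3} (hx : x ∈ unitSphere)
    (h1 : ⟪x, Q.normal k⟫ = 0) (h2 : (Q.edgeFactor k x).re ≤ 0) : x ∈ (Q.edge k).carrier := by
  set e := Q.edge k with he
  obtain ⟨t, ht, rfl⟩ := GeodesicArc.exists_pt_eq (Q.isInwardNormal.isFrame k) hx h1
    (e.len / 2 - Real.pi)
  have h3 : Real.cos (e.len / 2) ≤ Real.cos (t - e.len / 2) := by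
    have : (Q.edgeFactor k (e.pt t)).re = Real.cos (e.len / 2) - ⟪e.pt t, e.pt (e.len / 2)⟫ := rfl
    rw [← he, this, e.pt_inner_pt] at h2
    linarith
  rw [← Real.cos_abs (t - e.len / 2)] at h3
  have hl := e.len_pos
  have hl' := e.len_lt
  have h4 : |t - e.len / 2| ≤ e.len / 2 := by
    by_contra hcon
    push Not at hcon
    have : |t - e.len / 2| ≤ Real.pi := abs_le.2 ⟨by linarith [ht.1], by linarith [ht.2]⟩
    exact absurd h3 (not_le.2 (Real.cos_lt_cos_of_nonneg_of_le_pi (by linarith) this hcon))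
  obtain ⟨h5, h6⟩ := abs_le.1 h4
  exact ⟨t, ⟨by linarith, by linarith⟩, rfl⟩

lemma edgeFactor_re_neg {k : Fin 4} {x : E3} (hx : x ∈ (Q.edge k).relInterior) :
    (Q.edgeFactor k x).re < 0 := by
  obtain ⟨t, ht, rfl⟩ := hx
  set e := Q.edge k with he
  change Real.cos (e.len / 2) - ⟪e.pt t, e.pt (e.len / 2)⟫ < 0
  rw [e.pt_inner_pt, sub_neg, ← Real.cos_abs (t - e.len / 2)]
  have hl := e.len_lt
  exact Real.cos_lt_cos_of_nonneg_of_le_pi (abs_nonneg _) (by linarith)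
    (abs_lt.2 ⟨by linarith [ht.1], by linarith [ht.2]⟩)

lemma edgeFactor_im (k : Fin 4) (x : E3) :
    (Q.edgeFactor k x).im = -(Real.sin ((Q.edge k).len / 2) * ⟪x, Q.normal k⟫) := rfl

lemma edgeFactor_mem_slitPlane {k : Fin 4} {x : E3} (hx : x ∈ unitSphere)
    (hxc : x ∉ (Q.edge k).carrier) : Q.edgeFactor k x ∈ Complex.slitPlane := by
  rw [Complex.mem_slitPlane_iff]
  by_contra! hcon
  refine hxc (mem_carrier_of_edgeFactor hx ?_ hcon.1)
  have := hcon.2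
  rw [edgeFactor_im, neg_eq_zero] at this
  exact (mul_eq_zero.1 this).resolve_left (Q.sin_half_len_pos k).ne'

lemma one_sub_inner_vertex_ne {x : E3} (hx : x ∈ unitSphere) (k : Fin 4) (h : x ≠ Q.vertex k) :
    1 - ⟪Q.vertex k, x⟫ ≠ 0 := by
  intro h0
  have h1 := norm_sub_sq_unit (mem_unitSphere'.1 hx) (Q.edge k).start_inner
  rw [real_inner_comm] at h1
  have h2 : ‖x - (Q.edge k).start‖ ^ 2 = 0 := by
    rw [h1]; change 1 - ⟪(Q.edge k).start, x⟫ = 0 at h0; linarith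
  exact h (sub_eq_zero.1 (norm_eq_zero.1 (pow_eq_zero_iff two_ne_zero |>.1 h2)))

lemma edgeFactor_ne_zero {x : E3} (hx : x ∈ unitSphere) (hxv : ∀ k, x ≠ Q.vertex k) (k : Fin 4) :
    Q.edgeFactor k x ≠ 0 := by
  have h := Q.prod_edgeFactor_sq hx hxv
  have h1 : ∏ k, Q.edgeFactor k x ^ 2 ≠ 0 := by
    rw [h]
    refine mul_ne_zero (Complex.exp_ne_zero _) (Finset.prod_ne_zero_iff.2 fun k _ => ?_)
    have := one_sub_inner_vertex_ne hx k (hxv k)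
    exact pow_ne_zero _ (by exact_mod_cast this)
  rw [Finset.prod_ne_zero_iff] at h1
  exact fun h0 => h1 k (Finset.mem_univ k) (by rw [h0]; simp)

variable (Q)

open Classical in
/-- The total turning along the boundary curve as seen from `x`, corrected by its jump of `4π`
across the curve. -/
def turning (x : E3) : ℝ :=
  ∑ k, 2 * (Q.edgeFactor k x).arg + if x ∈ Q.inside then 4 * Real.pi else 0

/-- The set of the four vertices. -/
def vertexSet : Set E3 := range Q.vertex

variable {Q}

lemma exp_turning {x : E3} (hx : x ∈ unitSphere \ Q.vertexSet) :
    Complex.exp (Q.turning x * Complex.I) = Complex.exp ((∑ k, Q.angle k : ℝ) * Complex.I) := by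
  have hxv : ∀ k, x ≠ Q.vertex k := fun k h => hx.2 ⟨k, h.symm⟩
  have h := Q.prod_edgeFactor_sq hx.1 hxv
  have h1 : ∀ k, Q.edgeFactor k x ^ 2 =
      (‖Q.edgeFactor k x‖ ^ 2 : ℝ) * Complex.exp ((2 * (Q.edgeFactor k x).arg : ℝ) * Complex.I) := by
    intro k
    conv_lhs => rw [← Complex.norm_mul_exp_arg_mul_I (Q.edgeFactor k x)]
    rw [mul_pow, ← Complex.exp_nat_mul]
    push_cast
    ring_nf
  have h2 : Complex.exp (Q.turning x * Complex.I) =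
      ∏ k, Complex.exp ((2 * (Q.edgeFactor k x).arg : ℝ) * Complex.I) := by
    rw [← Complex.exp_sum, ← Finset.sum_mul, ← Complex.ofReal_sum, turning]
    split_ifs
    · rw [Complex.exp_eq_exp_iff_exists_int]
      exact ⟨2, by push_cast; ring⟩
    · simp
  rw [Finset.prod_congr rfl fun k _ => h1 k, Finset.prod_mul_distrib, ← h2, ← Complex.ofReal_prod]
    at h
  have h3 : ∏ k, (1 - ⟪Q.vertex k, x⟫ : ℂ) ^ 2 = ((∏ k, (1 - ⟪Q.vertex k, x⟫) ^ 2 : ℝ) : ℂ) := by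
    push_cast; rfl
  rw [h3] at h
  set R := ∏ k, ‖Q.edgeFactor k x‖ ^ 2 with hR
  set R' := ∏ k, (1 - ⟪Q.vertex k, x⟫) ^ 2 with hR'
  have hRpos : 0 < R := Finset.prod_pos fun k _ =>
    pow_pos (norm_pos_iff.2 (edgeFactor_ne_zero hx.1 hxv k)) 2
  have hRpos' : 0 ≤ R' := Finset.prod_nonneg fun k _ => sq_nonneg _
  have h4 := congrArg norm h
  rw [norm_mul, norm_mul, Complex.norm_exp_ofReal_mul_I, Complex.norm_exp_ofReal_mul_I, mul_one,
    one_mul, Complex.norm_real, Complex.norm_real, Real.norm_of_nonneg hRpos.le,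
    Real.norm_of_nonneg hRpos'] at h4
  rw [← h4, mul_comm] at h
  exact mul_right_cancel₀ (by exact_mod_cast hRpos.ne') h

/-- The jumps of the argument of `edgeFactor` and of the indicator of the inside cancel. -/
lemma continuousOn_turning : ContinuousOn Q.turning (unitSphere \ Q.vertexSet) := by
  intro y hy
  suffices ContinuousWithinAt Q.turning unitSphere y from this.mono sdiff_subset
  have harg : ∀ k, y ∉ (Q.edge k).carrier → ContinuousAt (fun x => (Q.edgeFactor k x).arg) y :=
    fun k hk => (Complex.continuousAt_arg (edgeFactor_mem_slitPlane hy.1 hk)).comp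
      (Q.continuous_edgeFactor k).continuousAt
  by_cases hb : y ∈ Q.boundary
  · obtain ⟨k, hk⟩ : ∃ k, y ∈ (Q.edge k).relInterior := by
      rcases Q.mem_boundary hb with ⟨k, hk⟩ | h
      · exact absurd ⟨k, hk.symm⟩ hy.2
      · exact h
    have hyN : ⟪y, Q.normal k⟫ = 0 := GeodesicArc.inner_normal (Q.isInwardNormal.isFrame k)
      ((Q.edge k).relInterior_subset_carrier hk)
    obtain ⟨t, ht, hty⟩ := hk
    have hin := Q.isInwardNormal.insideOn k t ht
    have hout := Q.isInwardNormal.outsideOn k t ht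
    rw [hty, sideNhds, eventually_nhdsWithin_iff] at hin hout
    have hk : y ∈ (Q.edge k).relInterior := ⟨t, ht, hty⟩
    have hre : ∀ᶠ x in 𝓝 y, (Q.edgeFactor k x).re < 0 :=
      (Complex.continuous_re.comp (Q.continuous_edgeFactor k)).continuousAt.eventually_lt_const
        (edgeFactor_re_neg hk)
    set G : E3 → ℝ := fun x => ∑ j ∈ Finset.univ.erase k, 2 * (Q.edgeFactor j x).arg +
      (2 * (-Q.edgeFactor k x).arg + 2 * Real.pi) with hG
    have hGc : ContinuousAt G y := by
      refine ContinuousAt.add (tendsto_finsetSum _ fun j hj => ?_) ?_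
      · have hjk := Finset.ne_of_mem_erase hj
        exact (harg j (SimpleQuadrilateral.notMem_carrier_of_mem_relInterior hjk hk)).const_mul 2
      · refine ContinuousAt.add (ContinuousAt.const_mul ?_ 2) continuousAt_const
        refine (Complex.continuousAt_arg ?_).comp (Q.continuous_edgeFactor k).neg.continuousAt
        rw [Complex.mem_slitPlane_iff]
        left
        simpa using edgeFactor_re_neg hk
    have heq : ∀ᶠ x in 𝓝[unitSphere] y, Q.turning x = G x := by
      rw [eventually_nhdsWithin_iff]
      filter_upwards [hin, hout, hre] with x h1 h2 h3 hx
      have hs := Q.sin_half_len_pos k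
      simp only [turning, hG]
      rw [← Finset.add_sum_erase _ _ (Finset.mem_univ k)]
      rcases lt_trichotomy 0 ⟪x, Q.normal k⟫ with hpos | hzero | hneg
      · rw [if_pos (h1 ⟨hx, hpos⟩), Complex.arg_neg_eq_arg_add_pi_of_im_neg]
        · ring
        · rw [edgeFactor_im]; have := mul_pos hs hpos; linarith
      · rw [if_neg, (Complex.arg_eq_pi_iff (z := Q.edgeFactor k x)).2 ⟨h3, by
          rw [edgeFactor_im, ← hzero]; simp⟩, (Complex.arg_eq_zero_iff (z := -Q.edgeFactor k x)).2
          ⟨by simpa using h3.le, by rw [Complex.neg_im, edgeFactor_im, ← hzero]; simp⟩]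
        · ring
        · intro hxi
          exact (Q.inside_subset hxi).2 (Q.carrier_subset_boundary k
            (mem_carrier_of_edgeFactor hx hzero.symm h3.le))
      · rw [if_neg (h2 ⟨hx, by simpa using hneg⟩), Complex.arg_neg_eq_arg_sub_pi_of_im_pos]
        · ring
        · rw [edgeFactor_im]; have := mul_neg_of_pos_of_neg hs hneg; linarith
    exact hGc.continuousWithinAt.congr_of_eventuallyEq heq (heq.self_of_nhdsWithin hy.1)
  · refine ContinuousWithinAt.add (tendsto_finsetSum _ fun k _ => ?_) ?_
    · have := harg k fun h => hb (Q.carrier_subset_boundary k h)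
      exact (this.const_mul 2).continuousWithinAt
    · classical
      refine (continuousWithinAt_const
        (b := if y ∈ Q.inside then 4 * Real.pi else 0)).congr_of_eventuallyEq ?_ rfl
      filter_upwards [SimpleQuadrilateral.eventually_inside_iff hy.1 hb] with x hx
      simp only [hx]

lemma exists_turning_eq : ∃ C : ℝ, (∀ x ∈ unitSphere \ Q.vertexSet, Q.turning x = C) ∧
    Complex.exp (C * Complex.I) = Complex.exp ((∑ k, Q.angle k : ℝ) * Complex.I) := by
  obtain ⟨x, hx⟩ := Q.inside_nonempty
  have hxs := Q.inside_subset hx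
  have hx' : x ∈ unitSphere \ Q.vertexSet := by
    refine ⟨hxs.1, ?_⟩
    rintro ⟨k, rfl⟩
    exact hxs.2 (Q.vertex_mem_boundary k)
  have hpre : IsPreconnected (unitSphere \ Q.vertexSet) :=
    isPreconnected_unitSphere_diff (finite_range _)
      (Q.boundary_subset (Q.vertex_mem_boundary 0)) ⟨0, rfl⟩
  exact ⟨Q.turning x, fun y hy =>
    hpre.eq_of_exp_eq continuousOn_turning (fun z hz => exp_turning hz) hy hx', exp_turning hx'⟩

end QuadrilateralA2BC

open MeasureTheory

/-! ### The area of a tile -/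

/-- The rotation invariant measure on the sphere, as a measure on `E3`: the volume of the part of
the unit ball that projects radially into a given subset. -/
def sphereMeasure : Measure E3 :=
  (volume.restrict (Metric.ball (0 : E3) 1)).map fun x => ‖x‖⁻¹ • x

lemma measurable_radialProj : Measurable fun x : E3 => ‖x‖⁻¹ • x := by fun_prop

instance : IsFiniteMeasure sphereMeasure := by
  have : IsFiniteMeasure (volume.restrict (Metric.ball (0 : E3) 1)) :=
    ⟨by rw [Measure.restrict_apply_univ]; exact measure_ball_lt_top⟩
  unfold sphereMeasure; infer_instance

lemma sphereMeasure_univ_pos : 0 < sphereMeasure.real univ := by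
  rw [measureReal_def, ENNReal.toReal_pos_iff]
  refine ⟨?_, measure_lt_top _ _⟩
  rw [sphereMeasure, Measure.map_apply measurable_radialProj MeasurableSet.univ, preimage_univ,
    Measure.restrict_apply_univ]
  exact Metric.measure_ball_pos _ _ one_pos

lemma sphereMeasure_compl_unitSphere : sphereMeasure unitSphereᶜ = 0 := by
  have hm : MeasurableSet (unitSphereᶜ : Set E3) := Metric.isClosed_sphere.measurableSet.compl
  rw [sphereMeasure, Measure.map_apply measurable_radialProj hm]
  refine measure_mono_null (t := {0}) ?_ (le_antisymm
    ((Measure.restrict_apply_le _ _).trans (measure_singleton _).le) zero_le)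
  intro x hx
  by_contra h
  exact hx (mem_unitSphere.2 (norm_smul_inv_norm h))

lemma ae_mem_unitSphere : ∀ᵐ x ∂sphereMeasure, x ∈ unitSphere := sphereMeasure_compl_unitSphere

lemma measurePreserving_sphereMeasure (g : E3 ≃ₗᵢ[ℝ] E3) :
    MeasurePreserving g sphereMeasure sphereMeasure := by
  have h1 := (g.measurePreserving).restrict_preimage
    (Metric.isOpen_ball (x := (0 : E3)) (ε := 1)).measurableSet
  have h2 : g ⁻¹' Metric.ball (0 : E3) 1 = Metric.ball 0 1 := by
    ext x; simp
  rw [h2] at h1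
  refine ⟨g.continuous.measurable, ?_⟩
  rw [sphereMeasure, Measure.map_map g.continuous.measurable measurable_radialProj]
  have : (g ∘ fun x : E3 => ‖x‖⁻¹ • x) = (fun x : E3 => ‖x‖⁻¹ • x) ∘ g := by
    funext x; simp
  rw [this, ← Measure.map_map measurable_radialProj g.continuous.measurable, h1.map_eq]

/-- Great circles are null sets. -/
lemma ae_inner_ne_zero {N : E3} (hN : ⟪N, N⟫ = 1) : ∀ᵐ x ∂sphereMeasure, ⟪x, N⟫ ≠ 0 := by
  have hm : MeasurableSet {x : E3 | ⟪x, N⟫ ≠ 0}ᶜ :=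
    (isOpen_ne_fun (by fun_prop) (by fun_prop)).measurableSet.compl
  change sphereMeasure {x : E3 | ⟪x, N⟫ ≠ 0}ᶜ = 0
  rw [sphereMeasure, Measure.map_apply measurable_radialProj hm]
  have hplane : volume ((ℝ ∙ N)ᗮ : Set E3) = 0 := by
    refine Measure.addHaar_submodule _ _ ?_
    intro h
    have : N ∈ (ℝ ∙ N)ᗮ := h ▸ Submodule.mem_top
    rw [Submodule.mem_orthogonal_singleton_iff_inner_right, hN] at this
    exact one_ne_zero this
  refine measure_mono_null (t := (ℝ ∙ N)ᗮ) ?_ (le_antisymm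
    ((Measure.restrict_apply_le _ _).trans hplane.le) zero_le)
  intro x hx
  simp only [mem_preimage, mem_compl_iff, mem_ofPred_eq, not_not, real_inner_smul_left] at hx
  rw [SetLike.mem_coe, Submodule.mem_orthogonal_singleton_iff_inner_left]
  by_cases h0 : x = 0
  · simp [h0]
  · exact (mul_eq_zero.1 hx).resolve_left (inv_ne_zero (norm_ne_zero_iff.2 h0))

namespace SimpleQuadrilateral

variable (Q : SimpleQuadrilateral)

lemma measurableSet_inside : MeasurableSet Q.inside := by
  have ho : IsOpen (Q.inside ∪ unitSphereᶜ) := by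
    rw [isOpen_iff_mem_nhds]
    rintro x (hx | hx)
    · have := eventually_nhdsWithin_iff.1 (eventually_inside hx)
      filter_upwards [this] with y hy
      by_cases h : y ∈ unitSphere
      · exact Or.inl (hy h)
      · exact Or.inr h
    · exact mem_of_superset (Metric.isClosed_sphere.isOpen_compl.mem_nhds hx) subset_union_right
  have : Q.inside = (Q.inside ∪ unitSphereᶜ) ∩ unitSphere := by
    ext x
    constructor
    · exact fun h => ⟨Or.inl h, (Q.inside_subset h).1⟩
    · rintro ⟨h | h, h'⟩
      · exact h
      · exact absurd h' h
  rw [this]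
  exact ho.measurableSet.inter Metric.isClosed_sphere.measurableSet

end SimpleQuadrilateral

namespace QuadrilateralA2BC

variable (Q : QuadrilateralA2BC)

lemma ae_notMem_boundary : ∀ᵐ x ∂sphereMeasure, x ∉ Q.boundary := by
  have : ∀ᵐ x ∂sphereMeasure, ∀ k, ⟪x, Q.normal k⟫ ≠ 0 :=
    ae_all_iff.2 fun k => ae_inner_ne_zero (Q.isInwardNormal.isFrame k).nn
  filter_upwards [this] with x hx hb
  obtain ⟨k, hk⟩ := mem_iUnion.1 hb
  exact hx k (GeodesicArc.inner_normal (Q.isInwardNormal.isFrame k) hk)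

lemma integrable_arg_edgeFactor (k : Fin 4) :
    Integrable (fun x => (Q.edgeFactor k x).arg) sphereMeasure := by
  refine Integrable.of_bound (C := Real.pi)
    (Complex.measurable_arg.comp (Q.continuous_edgeFactor k).measurable).aestronglyMeasurable ?_
  exact Eventually.of_forall fun x => Complex.abs_arg_le_pi _

/-- The reflection in the plane of the edge conjugates `edgeFactor`. -/
lemma integral_arg_edgeFactor (k : Fin 4) :
    ∫ x, (Q.edgeFactor k x).arg ∂sphereMeasure = 0 := by
  have hF := Q.isInwardNormal.isFrame k
  set N := Q.normal k with hN
  set m := (Q.edge k).pt ((Q.edge k).len / 2) with hm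
  set R : E3 ≃ₗᵢ[ℝ] E3 := (ℝ ∙ N)ᗮ.reflection with hR
  have hRN : R N = -N := Submodule.reflection_orthogonalComplement_singleton_eq_neg N
  have hRm : R m = m := by
    refine Submodule.reflection_mem_subspace_eq_self ?_
    rw [Submodule.mem_orthogonal_singleton_iff_inner_left]
    exact (GeodesicArc.isFrame_pt hF _).pn
  have hmp := measurePreserving_sphereMeasure R
  have h1 : ∫ x, (Q.edgeFactor k (R x)).arg ∂sphereMeasure =
      ∫ x, (Q.edgeFactor k x).arg ∂sphereMeasure :=
    hmp.integral_comp R.toHomeomorph.measurableEmbedding (fun x => (Q.edgeFactor k x).arg)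
  have h2 : ∀ᵐ x ∂sphereMeasure, (Q.edgeFactor k (R x)).arg = -(Q.edgeFactor k x).arg := by
    filter_upwards [ae_inner_ne_zero hF.nn] with x hx
    have e1 : ⟪R x, N⟫ = -⟪x, N⟫ := by
      have := R.inner_map_map x N
      rw [hRN, inner_neg_right] at this
      linarith
    have e2 : ⟪R x, m⟫ = ⟪x, m⟫ := by
      have := R.inner_map_map x m
      rwa [hRm] at this
    have e3 : Q.edgeFactor k (R x) = (starRingEnd ℂ) (Q.edgeFactor k x) := by
      apply Complex.ext
      · simp only [edgeFactor, Complex.conj_re, ← hm, e2]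
      · simp only [edgeFactor, Complex.conj_im, ← hN, e1]; ring
    rw [e3, Complex.arg_conj, if_neg]
    rw [Complex.arg_eq_pi_iff, edgeFactor_im]
    rintro ⟨-, h⟩
    rw [neg_eq_zero] at h
    exact hx ((mul_eq_zero.1 h).resolve_left (Q.sin_half_len_pos k).ne')
  rw [integral_congr_ae h2, integral_neg] at h1
  linarith

/-- **Girard's theorem modulo `2π`**, in terms of the share of the sphere that is inside. -/
theorem exp_area : Complex.exp ((4 * Real.pi * (sphereMeasure.real Q.inside /
    sphereMeasure.real univ) : ℝ) * Complex.I) =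
      Complex.exp ((∑ k, Q.angle k : ℝ) * Complex.I) := by
  classical
  obtain ⟨C, hC, hexp⟩ := exists_turning_eq (Q := Q)
  have hae : ∀ᵐ x ∂sphereMeasure, Q.turning x = C := by
    filter_upwards [ae_mem_unitSphere, Q.ae_notMem_boundary] with x h1 h2
    refine hC x ⟨h1, ?_⟩
    rintro ⟨k, rfl⟩
    exact h2 (Q.vertex_mem_boundary k)
  have h1 : ∫ x, Q.turning x ∂sphereMeasure = C * sphereMeasure.real univ := by
    rw [integral_congr_ae hae, integral_const, smul_eq_mul, mul_comm]
  have h2 : ∫ x, Q.turning x ∂sphereMeasure = 4 * Real.pi * sphereMeasure.real Q.inside := by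
    have e : Q.turning = fun x => ∑ k, 2 * (Q.edgeFactor k x).arg +
        Q.inside.indicator (fun _ => 4 * Real.pi) x := by
      funext x
      simp only [turning, indicator_apply]
    rw [e, integral_add, integral_finsetSum]
    · rw [integral_indicator Q.measurableSet_inside, setIntegral_const, smul_eq_mul,
        Finset.sum_eq_zero fun k _ => by
          rw [integral_const_mul, integral_arg_edgeFactor, mul_zero]]
      ring
    · exact fun k _ => (Q.integrable_arg_edgeFactor k).const_mul 2
    · exact integrable_finsetSum _ fun k _ => (Q.integrable_arg_edgeFactor k).const_mul 2
    · exact (integrable_const _).indicator Q.measurableSet_inside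
  rw [← hexp]
  have : 4 * Real.pi * (sphereMeasure.real Q.inside / sphereMeasure.real univ) = C := by
    rw [← mul_div_assoc, ← h2, h1, mul_div_cancel_right₀ _ sphereMeasure_univ_pos.ne']
  rw [this]

end QuadrilateralA2BC

namespace SphericalTiling

variable {Q : QuadrilateralA2BC} {f : ℕ}

/-- The tile `i` as a quadrilateral. -/
def tile (T : SphericalTiling Q f) (i : Fin f) : QuadrilateralA2BC := Q.map (T.place i)

lemma exists_mem_region (T : SphericalTiling Q f) {x : E3} (hx : x ∈ unitSphere) :
    ∃ i, x ∈ (T.tile i).region := by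
  rw [← T.covers] at hx
  obtain ⟨i, hi⟩ := mem_iUnion.1 hx
  exact ⟨i, by rw [tile, Q.map_region]; exact hi⟩

lemma disjoint_inside (T : SphericalTiling Q f) {i j : Fin f} (h : i ≠ j) :
    Disjoint (T.tile i).inside (T.tile j).inside := T.nonoverlapping i j h

/-- The tiles have equal areas. -/
lemma measure_inside (T : SphericalTiling Q f) :
    (f : ℝ) * sphereMeasure.real Q.inside = sphereMeasure.real univ := by
  have h1 : ∀ i, sphereMeasure (T.tile i).inside = sphereMeasure Q.inside := by
    intro i
    have hm := (T.tile i).measurableSet_inside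
    have h := (measurePreserving_sphereMeasure (T.place i)).measure_preimage hm.nullMeasurableSet
    rw [← h]
    congr 1
    exact (preimage_image_eq _ (T.place i).injective)
  have h2 : sphereMeasure (⋃ i, (T.tile i).inside) = ∑ i, sphereMeasure (T.tile i).inside := by
    rw [measure_iUnion (fun i j h => T.disjoint_inside h)
      (fun i => (T.tile i).measurableSet_inside), tsum_fintype]
  have h3 : sphereMeasure (⋃ i, (T.tile i).inside) = sphereMeasure univ := by
    refine measure_congr ?_
    have hb : ∀ᵐ x ∂sphereMeasure, ∀ i, x ∉ (T.tile i).boundary :=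
      ae_all_iff.2 fun i => (T.tile i).ae_notMem_boundary
    filter_upwards [ae_mem_unitSphere, hb] with x hx hxb
    obtain ⟨i, hi⟩ := T.exists_mem_region hx
    have : x ∈ (⋃ i, (T.tile i).inside) :=
      mem_iUnion.2 ⟨i, ((T.tile i).region_subset hi).resolve_right (hxb i)⟩
    exact propext ⟨fun _ => trivial, fun _ => this⟩
  rw [h3] at h2
  simp only [h1, Finset.sum_const, Finset.card_univ, Fintype.card_fin, nsmul_eq_mul] at h2
  rw [measureReal_def, measureReal_def, h2]
  simp

lemma pos_of_tiling (T : SphericalTiling Q f) : 0 < f := by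
  rcases Nat.eq_zero_or_pos f with rfl | h
  · have := T.measure_inside
    have h2 := sphereMeasure_univ_pos
    simp at this
    linarith
  · exact h

/-- The angle sum of a tile, up to a multiple of `2π`. -/
theorem exists_sum_angle_eq (T : SphericalTiling Q f) : ∃ m : ℤ,
    ∑ k, Q.angle k = 4 * Real.pi / f + 2 * Real.pi * m := by
  have h := Q.exp_area
  have hf : (f : ℝ) ≠ 0 := by exact_mod_cast T.pos_of_tiling.ne'
  have e : 4 * Real.pi * (sphereMeasure.real Q.inside / sphereMeasure.real univ) =
      4 * Real.pi / f := by
    rw [← T.measure_inside]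
    have : sphereMeasure.real Q.inside ≠ 0 := by
      intro h0
      have h1 := T.measure_inside
      rw [h0, mul_zero] at h1
      exact sphereMeasure_univ_pos.ne h1
    field_simp
  rw [e] at h
  obtain ⟨m, hm⟩ := Complex.exp_eq_exp_iff_exists_int.1 h.symm
  refine ⟨m, ?_⟩
  have := congrArg Complex.im hm
  simp only [Complex.mul_im, Complex.add_im, Complex.ofReal_re, Complex.ofReal_im, Complex.I_re,
    Complex.I_im] at this
  simp at this
  linarith

end SphericalTiling

/-! ### The angle sum at a vertex -/

section Polar

variable {p u n : E3}

/-- The angular coordinate, continuous off the half-plane of direction `u` and equal there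
to `2π`. -/
def polarAngle (u n x : E3) : ℝ := Complex.arg (-(⟪x, u⟫ + ⟪x, n⟫ * Complex.I)) + Real.pi

lemma eq_polarPt (h : IsFrame p u n) {x : E3} (hx : x ∈ unitSphere)
    (h0 : 0 < Real.arccos ⟪x, p⟫) (h1 : Real.arccos ⟪x, p⟫ < Real.pi) :
    x = polarPt p u n (Real.arccos ⟪x, p⟫) (polarAngle u n x) := by
  have hxx := h.inner_eq x x
  rw [mem_unitSphere'.1 hx] at hxx
  rw [Real.arccos_pos] at h0
  have h2 : -1 < ⟪x, p⟫ := by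
    by_contra hc
    rw [Real.arccos_of_le_neg_one (not_lt.1 hc)] at h1
    exact lt_irrefl _ h1
  set z : ℂ := ⟪x, u⟫ + ⟪x, n⟫ * Complex.I with hz
  have hz2 : ‖z‖ ^ 2 = 1 - ⟪x, p⟫ ^ 2 := by
    rw [← Complex.normSq_eq_norm_sq, hz, Complex.normSq_add_mul_I]
    linarith
  have hzpos : 0 < ‖z‖ := by
    refine lt_of_le_of_ne (norm_nonneg z) fun hz0 => ?_
    rw [← hz0] at hz2
    nlinarith
  have hz0 : -z ≠ 0 := by rw [neg_ne_zero]; exact norm_pos_iff.1 hzpos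
  have hsin : Real.sin (Real.arccos ⟪x, p⟫) = ‖z‖ := by
    rw [Real.sin_arccos, ← hz2, Real.sqrt_sq hzpos.le]
  have e1 : ‖z‖ * Real.cos (polarAngle u n x) = ⟪x, u⟫ := by
    rw [polarAngle, ← hz, Real.cos_add_pi, Complex.cos_arg hz0, norm_neg]
    field_simp
    simp [hz]
  have e2 : ‖z‖ * Real.sin (polarAngle u n x) = ⟪x, n⟫ := by
    rw [polarAngle, ← hz, Real.sin_add_pi, Complex.sin_arg, norm_neg]
    field_simp
    simp [hz]
  rw [polarPt, Real.cos_arccos h2.le h0.le, hsin, smul_add, smul_smul, smul_smul, e1, e2, ← add_assoc]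
  exact h.expand x

lemma inner_polarPt (h : IsFrame p u n) (t φ : ℝ) : ⟪polarPt p u n t φ, p⟫ = Real.cos t ∧
    ⟪polarPt p u n t φ, u⟫ = Real.sin t * Real.cos φ ∧
    ⟪polarPt p u n t φ, n⟫ = Real.sin t * Real.sin φ := by
  have h1 : ⟪u, p⟫ = 0 := by rw [real_inner_comm]; exact h.pu
  have h2 : ⟪n, p⟫ = 0 := by rw [real_inner_comm]; exact h.pn
  have h3 : ⟪n, u⟫ = 0 := by rw [real_inner_comm]; exact h.un
  refine ⟨?_, ?_, ?_⟩ <;> simp only [polarPt, inner_add_left, real_inner_smul_left,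
    h.pp, h.uu, h.nn, h.pu, h.pn, h.un, h1, h2, h3] <;> ring

/-- A region that is a sector near `p` is a neighbourhood of the interior points of the sector. -/
lemma eventually_mem_of_sector (h : IsFrame p u n) {P : Set E3} {r θ : ℝ} (hθ : θ < 2 * Real.pi)
    (hP : ∀ t ∈ Ioo 0 r, ∀ φ ∈ Ico 0 (2 * Real.pi), (polarPt p u n t φ ∈ P ↔ φ ≤ θ)) {t φ : ℝ}
    (ht : t ∈ Ioo 0 r) (htpi : t < Real.pi) (hφ : φ ∈ Ioo 0 θ) :
    ∀ᶠ x in 𝓝[unitSphere] polarPt p u n t φ, x ∈ P := by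
  obtain ⟨i1, i2, i3⟩ := inner_polarPt h t φ
  set x₀ := polarPt p u n t φ with hx₀
  have hst : 0 < Real.sin t := Real.sin_pos_of_pos_of_lt_pi ht.1 htpi
  have hz : -((⟪x₀, u⟫ : ℂ) + ⟪x₀, n⟫ * Complex.I) =
      Real.sin t * (Real.cos (φ - Real.pi) + Real.sin (φ - Real.pi) * Complex.I) := by
    rw [i2, i3, Real.cos_sub_pi, Real.sin_sub_pi]; push_cast; ring
  have hφ' : φ - Real.pi ∈ Ioc (-Real.pi) Real.pi :=
    ⟨by linarith [hφ.1], by linarith [hφ.2]⟩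
  have harg : Complex.arg (-((⟪x₀, u⟫ : ℂ) + ⟪x₀, n⟫ * Complex.I)) = φ - Real.pi := by
    rw [hz, Complex.ofReal_cos (φ - Real.pi), Complex.ofReal_sin (φ - Real.pi)]
    exact Complex.arg_mul_cos_add_sin_mul_I hst hφ'
  have hslit : -((⟪x₀, u⟫ : ℂ) + ⟪x₀, n⟫ * Complex.I) ∈ Complex.slitPlane := by
    rw [Complex.mem_slitPlane_iff_arg, harg]
    refine ⟨by linarith [hφ.2], ?_⟩
    intro h0
    have h1 := congrArg Complex.normSq (h0 ▸ hz)
    rw [map_zero, map_mul, Complex.normSq_ofReal, Complex.normSq_add_mul_I,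
      add_comm, Real.sin_sq_add_cos_sq] at h1
    nlinarith
  have hc1 : ContinuousAt (polarAngle u n) x₀ := by
    refine ContinuousAt.add (ContinuousAt.comp (x := x₀)
      (f := fun x : E3 => -((⟪x, u⟫ : ℂ) + ⟪x, n⟫ * Complex.I))
      (Complex.continuousAt_arg hslit) ?_) continuousAt_const
    have : Continuous fun x : E3 => -((⟪x, u⟫ : ℂ) + ⟪x, n⟫ * Complex.I) := by fun_prop
    exact this.continuousAt
  have hv1 : polarAngle u n x₀ = φ := by rw [polarAngle, harg]; ring
  have hc2 : Continuous fun x : E3 => Real.arccos ⟪x, p⟫ :=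
    Real.continuous_arccos.comp (by fun_prop)
  have hv2 : Real.arccos ⟪x₀, p⟫ = t := by rw [i1, Real.arccos_cos ht.1.le htpi.le]
  have ev1 : ∀ᶠ x in 𝓝 x₀, polarAngle u n x ∈ Ioo 0 θ :=
    hc1.eventually_mem (by rw [hv1]; exact isOpen_Ioo.mem_nhds hφ)
  have ev2 : ∀ᶠ x in 𝓝 x₀, Real.arccos ⟪x, p⟫ ∈ Ioo 0 r :=
    hc2.continuousAt.eventually_mem (by rw [hv2]; exact isOpen_Ioo.mem_nhds ht)
  have ev3 : ∀ᶠ x in 𝓝 x₀, Real.arccos ⟪x, p⟫ < Real.pi :=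
    hc2.continuousAt.eventually_lt_const (by beta_reduce; rw [hv2]; exact htpi)
  rw [eventually_nhdsWithin_iff]
  filter_upwards [ev1, ev2, ev3] with x h1 h2 h3 hx
  rw [eq_polarPt h hx h2.1 h3]
  exact (hP _ h2 _ ⟨h1.1.le, h1.2.trans hθ⟩).2 h1.2.le

lemma polarPt_periodic (p u n : E3) (t : ℝ) :
    Function.Periodic (polarPt p u n t) (2 * Real.pi) := by
  intro φ; simp [polarPt]

/-- Two frames at `p` differ by a rotation and possibly a reflection. -/
lemma exists_polarPt_eq {e₁ e₂ : E3} (he : IsFrame p e₁ e₂) (h : IsFrame p u n) :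
    ∃ ψ s : ℝ, (s = 1 ∨ s = -1) ∧ ∀ t φ, polarPt p u n t φ = polarPt p e₁ e₂ t (ψ + s * φ) := by
  have hup : ⟪u, p⟫ = 0 := by rw [real_inner_comm]; exact h.pu
  obtain ⟨ψ, -, hψ⟩ : ∃ ψ ∈ Ioc (0 : ℝ) (0 + 2 * Real.pi),
      u = Real.cos ψ • e₁ + Real.sin ψ • e₂ :=
    GeodesicArc.exists_pt_eq
      (e := ⟨e₁, e₂, 1, inner_self_eq_one_iff.1 he.uu, inner_self_eq_one_iff.1 he.nn, he.un,
        one_pos, by linarith [Real.pi_gt_three]⟩) he.perm (mem_unitSphere'.2 h.uu) hup 0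
  have hr := (he.perm.rotate ψ).perm.perm
  rw [← hψ] at hr
  rcases hr.eq_or_eq_neg h with hn | hn
  · refine ⟨ψ, 1, Or.inl rfl, fun t φ => ?_⟩
    simp only [polarPt, hn, hψ, one_mul, Real.cos_add, Real.sin_add]
    module
  · refine ⟨ψ, -1, Or.inr rfl, fun t φ => ?_⟩
    simp only [polarPt, hn, hψ, neg_one_mul, Real.cos_add, Real.sin_add, Real.cos_neg, Real.sin_neg]
    module

open Classical in
/-- The length of the part of a small circle that lies in a sector. -/
lemma integral_sector {e₁ e₂ : E3} (he : IsFrame p e₁ e₂) (h : IsFrame p u n) {P : Set E3}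
    {θ t : ℝ} (hθ0 : 0 < θ) (hθ : θ < 2 * Real.pi)
    (hP : ∀ φ ∈ Ico 0 (2 * Real.pi), (polarPt p u n t φ ∈ P ↔ φ ≤ θ)) :
    ∫ ψ in (0 : ℝ)..(2 * Real.pi), (if polarPt p e₁ e₂ t ψ ∈ P then (1 : ℝ) else 0) = θ := by
  obtain ⟨ψ₀, s, hs, hpol⟩ := exists_polarPt_eq he h
  set F : ℝ → ℝ := fun ψ => if polarPt p e₁ e₂ t ψ ∈ P then 1 else 0 with hF
  have hper : Function.Periodic F (2 * Real.pi) := by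
    intro ψ; simp only [hF, polarPt_periodic p e₁ e₂ t ψ]
  have hG : ∫ φ in (0 : ℝ)..(2 * Real.pi), F (ψ₀ + s * φ) = θ := by
    have h1 : ∫ φ in (0 : ℝ)..(2 * Real.pi), F (ψ₀ + s * φ) =
        ∫ φ in (0 : ℝ)..(2 * Real.pi), (Iic θ).indicator (fun _ => (1 : ℝ)) φ := by
      refine intervalIntegral.integral_congr_ae ?_
      have : ∀ᵐ φ : ℝ ∂volume, φ ≠ 2 * Real.pi := by simp [ae_iff, measure_singleton]
      filter_upwards [this] with φ hφ hmem
      rw [uIoc_of_le (by linarith)] at hmem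
      have hmem' : φ ∈ Ico 0 (2 * Real.pi) := ⟨hmem.1.le, lt_of_le_of_ne hmem.2 hφ⟩
      simp only [hF, ← hpol, hP φ hmem', indicator_apply, mem_Iic]
    rw [h1, intervalIntegral.integral_of_le (by linarith), setIntegral_indicator measurableSet_Iic,
      Ioc_inter_Iic, min_eq_right hθ.le]
    simp [hθ0.le]
  rw [← hG]
  rcases hs with rfl | rfl
  · simp only [one_mul]
    rw [intervalIntegral.integral_comp_add_left (fun x => F x) ψ₀, add_zero,
      hper.intervalIntegral_add_eq ψ₀ 0, zero_add]
  · simp only [neg_one_mul, ← sub_eq_add_neg]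
    rw [intervalIntegral.integral_comp_sub_left (fun x => F x) ψ₀, sub_zero]
    have := hper.intervalIntegral_add_eq (ψ₀ - 2 * Real.pi) 0
    rw [sub_add_cancel, zero_add] at this
    exact this.symm

end Polar

namespace SphericalTiling

variable {Q : QuadrilateralA2BC} {f : ℕ}

lemma false_of_overlap (T : SphericalTiling Q f) {i j : Fin f} (hij : i ≠ j) {x : E3}
    (hi : ∀ᶠ y in 𝓝[unitSphere] x, y ∈ (T.tile i).region) (hj : x ∈ (T.tile j).region) : False := by
  obtain ⟨y, hy1, hy2⟩ := ((SimpleQuadrilateral.frequently_inside hj).and_eventually hi).exists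
  obtain ⟨z, hz1, hz2⟩ := ((SimpleQuadrilateral.frequently_inside hy2).and_eventually
    (SimpleQuadrilateral.eventually_inside hy1)).exists
  exact disjoint_left.1 (T.disjoint_inside hij) hz1 hz2

/-- A tile that contains a vertex of the tiling has a corner there. -/
lemma exists_vertex_eq (T : SphericalTiling Q f) {p : E3} (hp : p ∈ T.vertices) {j : Fin f}
    (hj : p ∈ (T.tile j).region) : ∃ k, (T.tile j).vertex k = p := by
  obtain ⟨i, k, hik⟩ := hp
  have hik' : (T.tile i).vertex k = p := hik
  have hpb : p ∈ (T.tile i).boundary := hik' ▸ (T.tile i).vertex_mem_boundary k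
  have hpr : p ∈ (T.tile i).region := by
    obtain ⟨r, hr, hsec⟩ := (T.tile i).isInwardNormal.sector k
    have hcont : Continuous fun t => polarPt ((T.tile i).vertex k) ((T.tile i).edge k).dir
      ((T.tile i).normal k) t 0 := by unfold polarPt; fun_prop
    have h0 := hcont.tendsto 0
    have e0 : polarPt ((T.tile i).vertex k) ((T.tile i).edge k).dir ((T.tile i).normal k) 0 0 = p := by
      simp [polarPt, hik']
    simp only [e0] at h0
    refine (T.tile i).isClosed_region.mem_of_tendsto (h0.mono_left (nhdsWithin_le_nhds (s := Ioi 0)))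
      ?_
    filter_upwards [Ioo_mem_nhdsGT hr] with t ht
    exact (hsec t ht 0 ⟨le_rfl, by linarith [Real.pi_pos]⟩).2 ((T.tile i).angle_pos k).le
  rcases (T.tile j).region_subset hj with h | h
  · exfalso
    have hne : i ≠ j := by
      rintro rfl
      exact ((T.tile i).inside_subset h).2 hpb
    exact T.false_of_overlap hne.symm ((SimpleQuadrilateral.eventually_inside h).mono
      fun y hy => (T.tile j).inside_subset_region hy) hpr
  · rcases (T.tile j).mem_boundary h with ⟨l, hl⟩ | ⟨l, hl⟩
    · exact ⟨l, hl.symm⟩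
    · exfalso
      rw [tile, Q.map_relInterior] at hl
      exact T.edge_to_edge i j k l (hik ▸ hl)

open Classical in
/-- The corners of tiles at a point. -/
def corners (T : SphericalTiling Q f) (p : E3) : Finset (Fin f × Fin 4) :=
  {x | (T.tile x.1).vertex x.2 = p}

lemma mem_corners {T : SphericalTiling Q f} {p : E3} {x : Fin f × Fin 4} :
    x ∈ T.corners p ↔ (T.tile x.1).vertex x.2 = p := by simp [corners]

lemma corners_fst_ne {T : SphericalTiling Q f} {p : E3} {x y : Fin f × Fin 4}
    (hx : x ∈ T.corners p) (hy : y ∈ T.corners p) (hxy : x ≠ y) : x.1 ≠ y.1 := by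
  intro h
  rw [mem_corners] at hx hy
  rw [← h, ← hx] at hy
  exact hxy (Prod.ext h ((T.tile x.1).vertex_injective hy).symm)

theorem sum_corners_angle (T : SphericalTiling Q f) {p : E3} (hp : p ∈ T.vertices) :
    ∑ x ∈ T.corners p, Q.angle x.2 = 2 * Real.pi := by
  classical
  have hps : ⟪p, p⟫ = 1 := by
    obtain ⟨i, k, rfl⟩ := hp
    exact ((T.tile i).edge k).start_inner
  obtain ⟨e₁, e₂, he⟩ := exists_isFrame hps
  have hfr : ∀ x ∈ T.corners p,
      IsFrame p ((T.tile x.1).edge x.2).dir ((T.tile x.1).normal x.2) := by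
    intro x hx
    have := (T.tile x.1).isInwardNormal.isFrame x.2
    rwa [show ((T.tile x.1).edge x.2).start = p from mem_corners.1 hx] at this
  have hsec : ∀ x ∈ T.corners p, ∃ r > 0, ∀ t ∈ Ioo 0 r, ∀ φ ∈ Ico 0 (2 * Real.pi),
      (polarPt p ((T.tile x.1).edge x.2).dir ((T.tile x.1).normal x.2) t φ ∈ (T.tile x.1).region ↔
        φ ≤ Q.angle x.2) := by
    intro x hx
    have := (T.tile x.1).isInwardNormal.sector x.2
    rwa [mem_corners.1 hx] at this
  choose! r hr hsec using hsec
  -- a circle about `p` which meets only the tiles with a corner at `p`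
  have hU : {y | ∀ j, p ∉ (T.tile j).region → y ∉ (T.tile j).region} ∈ 𝓝 p := by
    change ∀ᶠ y in 𝓝 p, ∀ j, p ∉ (T.tile j).region → y ∉ (T.tile j).region
    rw [eventually_all]
    intro j
    by_cases h : p ∈ (T.tile j).region
    · exact Eventually.of_forall fun y h' => absurd h h'
    · filter_upwards [(T.tile j).isClosed_region.isOpen_compl.mem_nhds h] with y hy _
      exact hy
  obtain ⟨c, -, hc1, hc⟩ := exists_cap_subset hps hU
  obtain ⟨t, ht0, htpi, htc, htr⟩ : ∃ t : ℝ, 0 < t ∧ t < Real.pi ∧ c < Real.cos t ∧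
      ∀ x ∈ T.corners p, t < r x := by
    have h1 : ∀ᶠ t in 𝓝[>] (0 : ℝ), t < Real.pi :=
      (eventually_lt_nhds Real.pi_pos).filter_mono nhdsWithin_le_nhds
    have h2 : ∀ᶠ t in 𝓝[>] (0 : ℝ), c < Real.cos t :=
      (Real.continuous_cos.continuousAt.eventually_const_lt
        (by rw [Real.cos_zero]; exact hc1)).filter_mono nhdsWithin_le_nhds
    have h3 : ∀ᶠ t in 𝓝[>] (0 : ℝ), ∀ x ∈ T.corners p, t < r x :=
      (Finset.eventually_all _).2 fun x hx =>
        (eventually_lt_nhds (hr x hx)).filter_mono nhdsWithin_le_nhds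
    obtain ⟨t, h⟩ := (((h1.and h2).and h3).and self_mem_nhdsWithin).exists
    exact ⟨t, h.2, h.1.1.1, h.1.1.2, h.1.2⟩
  set F : Fin f × Fin 4 → ℝ → ℝ := fun x ψ =>
    if polarPt p e₁ e₂ t ψ ∈ (T.tile x.1).region then 1 else 0 with hF
  have hint : ∀ x ∈ T.corners p, ∫ ψ in (0 : ℝ)..(2 * Real.pi), F x ψ = Q.angle x.2 :=
    fun x hx => integral_sector he (hfr x hx) (Q.angle_pos x.2) (Q.angle_lt x.2)
      (hsec x hx t ⟨ht0, htr x hx⟩)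
  have hcont : Continuous (polarPt p e₁ e₂ t) := by unfold polarPt; fun_prop
  have hii : ∀ x ∈ T.corners p, IntervalIntegrable (F x) volume 0 (2 * Real.pi) := by
    intro x _
    have hm : MeasurableSet (polarPt p e₁ e₂ t ⁻¹' (T.tile x.1).region) :=
      ((T.tile x.1).isClosed_region.preimage hcont).measurableSet
    have : F x = (polarPt p e₁ e₂ t ⁻¹' (T.tile x.1).region).indicator fun _ => 1 := by
      funext ψ; simp only [hF, indicator_apply, mem_preimage]
    rw [this, intervalIntegrable_iff]
    exact (intervalIntegrable_iff.1 intervalIntegrable_const).indicator hm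
  -- two tiles overlap on the circle only in boundary directions, which are countably many
  have hdisj : ∀ x ∈ T.corners p, ∀ y ∈ T.corners p, x ≠ y → ∀ᵐ ψ : ℝ ∂volume,
      ¬ (polarPt p e₁ e₂ t ψ ∈ (T.tile x.1).region ∧
        polarPt p e₁ e₂ t ψ ∈ (T.tile y.1).region) := by
    intro x hx y hy hxy
    obtain ⟨ψ₀, s, hs, hpol⟩ := exists_polarPt_eq he (hfr x hx)
    have hss : s * s = 1 := by rcases hs with rfl | rfl <;> norm_num
    have hcount : (range fun q : Bool × ℤ => ψ₀ + s * ((if q.1 then 0 else Q.angle x.2) +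
        q.2 * (2 * Real.pi))).Countable := countable_range _
    filter_upwards [(hcount.ae_notMem volume)] with ψ hψ
    rintro ⟨h1, h2⟩
    set φ := toIcoMod Real.two_pi_pos 0 (s * (ψ - ψ₀)) with hφ
    have hφm := toIcoMod_mem_Ico Real.two_pi_pos 0 (s * (ψ - ψ₀))
    rw [← hφ, zero_add] at hφm
    set m := toIcoDiv Real.two_pi_pos 0 (s * (ψ - ψ₀)) with hm
    have hψ' : ψ = ψ₀ + s * (φ + m * (2 * Real.pi)) := by
      have : s * (ψ - ψ₀) = φ + m * (2 * Real.pi) := by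
        rw [hφ, hm, ← zsmul_eq_mul]; exact (toIcoMod_add_toIcoDiv_zsmul _ _ _).symm
      rw [← this, ← mul_assoc, hss]; ring
    have hpt : polarPt p e₁ e₂ t ψ =
        polarPt p ((T.tile x.1).edge x.2).dir ((T.tile x.1).normal x.2) t φ := by
      rw [hψ', ← hpol, ← zsmul_eq_mul]
      exact (polarPt_periodic _ _ _ t).zsmul m φ
    rw [hpt] at h1 h2
    have hle := (hsec x hx t ⟨ht0, htr x hx⟩ φ hφm).1 h1
    rcases eq_or_lt_of_le hφm.1 with h0 | h0
    · exact hψ ⟨(true, m), by simp only [hψ', ← h0]; simp⟩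
    rcases eq_or_lt_of_le hle with h3 | h3
    · exact hψ ⟨(false, m), by simp only [hψ', h3]; simp⟩
    exact T.false_of_overlap (corners_fst_ne hx hy hxy)
      (eventually_mem_of_sector (hfr x hx) (Q.angle_lt x.2) (hsec x hx) ⟨ht0, htr x hx⟩ htpi
        ⟨h0, h3⟩) h2
  have hsum : ∀ᵐ ψ : ℝ ∂volume, ∑ x ∈ T.corners p, F x ψ = 1 := by
    have h1 : ∀ᵐ ψ : ℝ ∂volume, ∀ x ∈ T.corners p, ∀ y ∈ T.corners p, x ≠ y →
        ¬ (polarPt p e₁ e₂ t ψ ∈ (T.tile x.1).region ∧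
          polarPt p e₁ e₂ t ψ ∈ (T.tile y.1).region) := by
      rw [ae_all_iff]; intro x
      rw [ae_all_iff]; intro hx
      rw [ae_all_iff]; intro y
      rw [ae_all_iff]; intro hy
      rw [ae_all_iff]; intro hxy
      exact hdisj x hx y hy hxy
    filter_upwards [h1] with ψ hψ
    have hsph : polarPt p e₁ e₂ t ψ ∈ unitSphere := polarPt_mem_unitSphere he t ψ
    obtain ⟨j, hj⟩ := T.exists_mem_region hsph
    have hpj : p ∈ (T.tile j).region := by
      by_contra hcon
      have : polarPt p e₁ e₂ t ψ ∈ cap p c :=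
        ⟨hsph, by rw [mem_ofPred_eq, (inner_polarPt he t ψ).1]; exact htc⟩
      exact hc this j hcon hj
    obtain ⟨k, hk⟩ := T.exists_vertex_eq hp hpj
    have hjk : (j, k) ∈ T.corners p := mem_corners.2 hk
    rw [Finset.sum_eq_single_of_mem _ hjk]
    · simp only [hF, if_pos hj]
    · intro x hx hne
      simp only [hF]
      rw [if_neg]
      intro h
      exact hψ x hx _ hjk hne ⟨h, hj⟩
  rw [← Finset.sum_congr rfl hint, ← intervalIntegral.integral_finsetSum hii,
    intervalIntegral.integral_congr_ae (g := fun _ => (1 : ℝ)) (hsum.mono fun ψ h _ => h)]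
  simp

end SphericalTiling

/-! ### Edges of the tiling -/

namespace GeodesicArc

/-- The same arc traversed backwards. -/
def reverse (e : GeodesicArc) : GeodesicArc where
  start := e.finish
  dir := e.backDir
  len := e.len
  norm_start := mem_unitSphere.1 (e.pt_mem_unitSphere _)
  norm_dir := by
    obtain ⟨n, hn⟩ := e.exists_isFrame
    rw [backDir_eq, norm_neg]
    exact inner_self_eq_one_iff.1 (isFrame_pt hn e.len).uu
  orth := by
    obtain ⟨n, hn⟩ := e.exists_isFrame
    rw [backDir_eq, inner_neg_right, neg_eq_zero]
    exact (isFrame_pt hn e.len).pu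
  len_pos := e.len_pos
  len_lt := e.len_lt

lemma reverse_pt (e : GeodesicArc) (t : ℝ) : e.reverse.pt t = e.pt (e.len - t) :=
  (e.pt_len_sub t).symm

lemma reverse_vel (e : GeodesicArc) (t : ℝ) : e.reverse.vel t = -e.vel (e.len - t) := by
  rw [sub_eq_add_neg, vel_add, Real.sin_neg, Real.cos_neg, pt_len]
  simp only [vel, reverse, backDir_eq]
  module

lemma reverse_finish (e : GeodesicArc) : e.reverse.finish = e.start := by
  rw [← pt_len, reverse_pt]
  change e.pt (e.len - e.len) = _
  rw [sub_self, pt_zero]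

lemma reverse_relInterior (e : GeodesicArc) : e.reverse.relInterior = e.relInterior := by
  ext x
  constructor
  · rintro ⟨t, ht, rfl⟩
    have ht' : t ∈ Ioo 0 e.len := ht
    exact ⟨e.len - t, ⟨by linarith [ht'.2], by linarith [ht'.1]⟩, (e.reverse_pt t).symm⟩
  · rintro ⟨t, ht, rfl⟩
    refine ⟨e.len - t, ⟨by linarith [ht.2], ?_⟩, ?_⟩
    · change e.len - t < e.len
      linarith [ht.1]
    · rw [reverse_pt, sub_sub_cancel]

/-- `e` and `e'` are the same arc, up to the sense in which it is traversed. -/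
structure Same (e e' : GeodesicArc) : Prop where
  len_eq : e.len = e'.len
  relInterior_eq : e.relInterior = e'.relInterior
  ends : (e.start = e'.start ∧ e.finish = e'.finish) ∨ (e.start = e'.finish ∧ e.finish = e'.start)

lemma Same.symm {e e' : GeodesicArc} (h : e.Same e') : e'.Same e :=
  ⟨h.len_eq.symm, h.relInterior_eq.symm, h.ends.imp (fun h => ⟨h.1.symm, h.2.symm⟩)
    fun h => ⟨h.2.symm, h.1.symm⟩⟩

/-- Two arcs that touch with the same tangent vector, and neither of which has an end point inside
the other one, coincide. -/
lemma eq_of_tangent {e e' : GeodesicArc} {t t' : ℝ} (ht : t ∈ Ioo 0 e.len)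
    (ht' : t' ∈ Ioo 0 e'.len) (hpt : e.pt t = e'.pt t') (hvel : e.vel t = e'.vel t')
    (h1 : e.start ∉ e'.relInterior) (h2 : e.finish ∉ e'.relInterior)
    (h3 : e'.start ∉ e.relInterior) (h4 : e'.finish ∉ e.relInterior) :
    e.len = e'.len ∧ e.relInterior = e'.relInterior ∧ e.start = e'.start ∧ e.finish = e'.finish := by
  have key : ∀ s, e.pt (t + s) = e'.pt (t' + s) := fun s => by rw [pt_add, pt_add, hpt, hvel]
  have key1 : ∀ s, e.pt s = e'.pt (t' - t + s) := fun s => by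
    have := key (s - t)
    rw [add_sub_cancel] at this
    rw [this]; congr 1; ring
  have key2 : ∀ s, e'.pt s = e.pt (t - t' + s) := fun s => by
    rw [key1]; congr 1; ring
  have ha : t = t' := by
    rcases lt_trichotomy t t' with h | h | h
    · refine absurd ?_ h1
      rw [← e.pt_zero, key1]
      exact ⟨_, ⟨by linarith, by linarith [ht.1, ht'.2]⟩, rfl⟩
    · exact h
    · refine absurd ?_ h3
      rw [← e'.pt_zero, key2]
      exact ⟨_, ⟨by linarith, by linarith [ht'.1, ht.2]⟩, rfl⟩
  subst ha
  simp only [sub_self, zero_add] at key1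
  have hb : e.len = e'.len := by
    rcases lt_trichotomy e.len e'.len with h | h | h
    · refine absurd ?_ h2
      rw [← pt_len, key1]
      exact ⟨_, ⟨e.len_pos, h⟩, rfl⟩
    · exact h
    · refine absurd ?_ h4
      rw [← pt_len, ← key1]
      exact ⟨_, ⟨e'.len_pos, h⟩, rfl⟩
  refine ⟨hb, ?_, ?_, ?_⟩
  · rw [relInterior, relInterior, hb]
    exact image_congr fun s _ => key1 s
  · rw [← e.pt_zero, ← e'.pt_zero, key1]
  · rw [← pt_len, ← pt_len, key1, hb]

lemma same_of_mem {e e' : GeodesicArc} {n y : E3} (hn : IsFrame e.start e.dir n)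
    (hn' : IsFrame e'.start e'.dir n) (hy : y ∈ e.relInterior) (hy' : y ∈ e'.relInterior)
    (h1 : e.start ∉ e'.relInterior) (h2 : e.finish ∉ e'.relInterior)
    (h3 : e'.start ∉ e.relInterior) (h4 : e'.finish ∉ e.relInterior) : e.Same e' := by
  obtain ⟨t, ht, rfl⟩ := hy
  obtain ⟨t', ht', hpt⟩ := hy'
  have hf := (isFrame_pt hn t).swap
  have hf' := (isFrame_pt hn' t').swap
  rw [hpt] at hf'
  rcases hf'.eq_or_eq_neg hf with h | h
  · obtain ⟨a, b, c, d⟩ := eq_of_tangent ht ht' hpt.symm h h1 h2 h3 h4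
    exact ⟨a, b, Or.inl ⟨c, d⟩⟩
  · have hs : e'.len - t' ∈ Ioo 0 e'.reverse.len :=
      ⟨by linarith [ht'.2], by change _ < e'.len; linarith [ht'.1]⟩
    have hp : e.pt t = e'.reverse.pt (e'.len - t') := by
      rw [reverse_pt, sub_sub_cancel, hpt]
    have hv : e.vel t = e'.reverse.vel (e'.len - t') := by
      rw [reverse_vel, sub_sub_cancel, h]
    obtain ⟨a, b, c, d⟩ := eq_of_tangent ht hs hp hv (by rwa [reverse_relInterior])
      (by rwa [reverse_relInterior]) h4 (by rwa [reverse_finish])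
    refine ⟨a, by rwa [reverse_relInterior] at b, Or.inr ⟨c, by rwa [reverse_finish] at d⟩⟩

end GeodesicArc

namespace SphericalTiling

variable {Q : QuadrilateralA2BC} {f : ℕ}

/-- The edge of the tile `x.1` with number `x.2`. -/
def edge (T : SphericalTiling Q f) (x : Fin f × Fin 4) : GeodesicArc := (T.tile x.1).edge x.2

lemma normal_eq_neg (T : SphericalTiling Q f) {x x' : Fin f × Fin 4} (hne : x.1 ≠ x'.1) {y : E3}
    (hy : y ∈ (T.edge x).relInterior) (hy' : y ∈ (T.edge x').relInterior) :
    (T.tile x'.1).normal x'.2 = -(T.tile x.1).normal x.2 := by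
  have hF := (T.tile x.1).isInwardNormal.isFrame x.2
  have hF' := (T.tile x'.1).isInwardNormal.isFrame x'.2
  obtain ⟨t, ht, hty⟩ := hy
  obtain ⟨t', ht', hty'⟩ := hy'
  have hfr := GeodesicArc.isFrame_pt hF t
  have hfr' := GeodesicArc.isFrame_pt hF' t'
  have hin := (T.tile x.1).isInwardNormal.insideOn x.2 t ht
  have hin' := (T.tile x'.1).isInwardNormal.insideOn x'.2 t' ht'
  rw [show ((T.tile x.1).edge x.2).pt t = y from hty] at hfr hin
  rw [show ((T.tile x'.1).edge x'.2).pt t' = y from hty'] at hfr' hin'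
  set N := (T.tile x.1).normal x.2
  set N' := (T.tile x'.1).normal x'.2
  by_contra hcon
  have hv : N + N' ≠ 0 := fun h => hcon (eq_neg_of_add_eq_zero_right h)
  have hpos : 0 < ‖N + N'‖⁻¹ := inv_pos.2 (norm_pos_iff.2 hv)
  have hsq : 0 < ⟪N + N', N + N'⟫ := real_inner_self_pos.2 hv
  rw [inner_add_left, inner_add_right, inner_add_right, hfr.nn, hfr'.nn, real_inner_comm N N'] at hsq
  -- the direction bisecting the two normals points into both tiles
  set d := ‖N + N'‖⁻¹ • (N + N') with hd
  have hdd : ⟪d, d⟫ = 1 := inner_self_eq_one_iff.2 (norm_smul_inv_norm hv)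
  have hyd : ⟪y, d⟫ = 0 := by
    rw [hd, real_inner_smul_right, inner_add_right, hfr.pn, hfr'.pn]; simp
  have h1 : 0 < ⟪d, N⟫ := by
    rw [hd, real_inner_smul_left, inner_add_left, hfr.nn]
    refine mul_pos hpos ?_
    have := real_inner_comm N N'
    linarith
  have h2 : 0 < ⟪d, N'⟫ := by
    rw [hd, real_inner_smul_left, inner_add_left, hfr'.nn]
    refine mul_pos hpos ?_
    have := real_inner_comm N N'
    linarith
  have e1 := (tendsto_sideNhds hfr.pp hdd hyd hfr.pn h1).eventually hin
  have e2 := (tendsto_sideNhds hfr.pp hdd hyd hfr'.pn h2).eventually hin'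
  obtain ⟨s, hs1, hs2⟩ := (e1.and e2).exists
  exact disjoint_left.1 (T.disjoint_inside hne) hs1 hs2

lemma vertex_notMem_relInterior (T : SphericalTiling Q f) (i : Fin f) (k : Fin 4)
    (x : Fin f × Fin 4) : (T.tile i).vertex k ∉ (T.edge x).relInterior := by
  rw [edge, tile, tile, Q.map_relInterior]
  exact T.edge_to_edge i x.1 k x.2

lemma edge_start (T : SphericalTiling Q f) (x : Fin f × Fin 4) :
    (T.edge x).start = (T.tile x.1).vertex x.2 := rfl

lemma edge_finish (T : SphericalTiling Q f) (x : Fin f × Fin 4) :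
    (T.edge x).finish = (T.tile x.1).vertex (x.2 + 1) := (T.tile x.1).closed x.2

/-- Every edge of a tile is also an edge of another tile. -/
lemma exists_partner (T : SphericalTiling Q f) (x : Fin f × Fin 4) :
    ∃ y : Fin f × Fin 4, x.1 ≠ y.1 ∧ (T.edge x).Same (T.edge y) := by
  obtain ⟨i, k⟩ := x
  set P := T.tile i with hP
  have hF := P.isInwardNormal.isFrame k
  set t := (P.edge k).len / 2 with ht
  have htm : t ∈ Ioo 0 (P.edge k).len := by
    have := (P.edge k).len_pos
    exact ⟨by linarith, by linarith⟩
  set y := (P.edge k).pt t with hy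
  have hyr : y ∈ (T.edge (i, k)).relInterior := ⟨t, htm, rfl⟩
  have hfr := GeodesicArc.isFrame_pt hF t
  have hin := P.isInwardNormal.insideOn k t htm
  have hout := SimpleQuadrilateral.eventually_notMem_region hfr.pp
    (P.isInwardNormal.outsideOn k t htm)
  rw [← hy] at hin hout hfr
  have hne1 := sideNhds_neBot hfr.pp hfr.nn hfr.pn
  have hne2 := sideNhds_neBot hfr.neg.pp hfr.neg.nn hfr.neg.pn
  have hle : ∀ n : E3, sideNhds y n ≤ 𝓝 y := fun n => nhdsWithin_le_nhds
  have hyi : y ∈ P.region := P.isClosed_region.mem_of_frequently_of_tendsto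
    ((hin.mono fun z hz => P.inside_subset_region hz).frequently) (hle (P.normal k))
  obtain ⟨j, hj⟩ : ∃ j, ∃ᶠ z in sideNhds y (-P.normal k), z ∈ (T.tile j).region := by
    by_contra! hcon
    have h1 : ∀ᶠ z in sideNhds y (-P.normal k), ∀ j, z ∉ (T.tile j).region :=
      eventually_all.2 hcon
    have h2 : ∀ᶠ z in sideNhds y (-P.normal k), z ∈ unitSphere :=
      (sideNhds_le _ _) self_mem_nhdsWithin
    obtain ⟨z, hz1, hz2⟩ := (h1.and h2).exists
    obtain ⟨j, hj⟩ := T.exists_mem_region hz2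
    exact hz1 j hj
  have hij : i ≠ j := by
    rintro rfl
    obtain ⟨z, hz1, hz2⟩ := (hj.and_eventually hout).exists
    exact hz2 hz1
  have hyj : y ∈ (T.tile j).region :=
    (T.tile j).isClosed_region.mem_of_frequently_of_tendsto hj (hle _)
  have hyb : y ∈ (T.tile j).boundary := by
    refine ((T.tile j).region_subset hyj).resolve_left fun h => ?_
    exact T.false_of_overlap hij.symm ((SimpleQuadrilateral.eventually_inside h).mono
      fun z hz => (T.tile j).inside_subset_region hz) hyi
  obtain ⟨l, hl⟩ : ∃ l, y ∈ (T.edge (j, l)).relInterior := by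
    rcases (T.tile j).mem_boundary hyb with ⟨l, hl⟩ | h
    · exact absurd (hl ▸ hyr) (T.vertex_notMem_relInterior j l (i, k))
    · exact h
  have hN := T.normal_eq_neg (x := (i, k)) (x' := (j, l)) hij hyr hl
  refine ⟨(j, l), hij, GeodesicArc.same_of_mem (n := P.normal k) hF ?_ hyr hl ?_ ?_ ?_ ?_⟩
  · have := ((T.tile j).isInwardNormal.isFrame l).neg
    rw [hN, neg_neg] at this
    exact this
  · exact T.vertex_notMem_relInterior _ _ _
  · rw [edge_finish]; exact T.vertex_notMem_relInterior _ _ _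
  · exact T.vertex_notMem_relInterior _ _ _
  · rw [edge_finish]; exact T.vertex_notMem_relInterior _ _ _

/-- At most one other tile shares a given edge: two of them would lie on the same side. -/
lemma partner_unique (T : SphericalTiling Q f) {x y z : Fin f × Fin 4} (hy : x.1 ≠ y.1)
    (hxy : (T.edge x).Same (T.edge y)) (hz : x.1 ≠ z.1) (hxz : (T.edge x).Same (T.edge z)) :
    y = z := by
  obtain ⟨w, hw⟩ : ∃ w, w ∈ (T.edge x).relInterior :=
    ⟨_, _, ⟨half_pos (T.edge x).len_pos, half_lt_self (T.edge x).len_pos⟩, rfl⟩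
  have hwy := hxy.relInterior_eq ▸ hw
  have hwz := hxz.relInterior_eq ▸ hw
  have h1 := T.normal_eq_neg hy hw hwy
  have h2 := T.normal_eq_neg hz hw hwz
  by_cases h : y.1 = z.1
  · refine Prod.ext h ?_
    rw [edge, h] at hwy
    exact SimpleQuadrilateral.eq_of_mem_relInterior hwz hwy
  · exfalso
    have h3 := T.normal_eq_neg h hwy hwz
    rw [h1, h2, neg_neg] at h3
    have h4 := ((T.tile x.1).isInwardNormal.isFrame x.2).nn
    have h5 := congrArg (fun v => ⟪v, (T.tile x.1).normal x.2⟫) h3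
    simp only [inner_neg_left, h4] at h5
    norm_num at h5

/-- The edge, of another tile, that coincides with a given one. -/
def partner (T : SphericalTiling Q f) (x : Fin f × Fin 4) : Fin f × Fin 4 :=
  (T.exists_partner x).choose

lemma partner_ne (T : SphericalTiling Q f) (x : Fin f × Fin 4) : x.1 ≠ (T.partner x).1 :=
  (T.exists_partner x).choose_spec.1

lemma same_partner (T : SphericalTiling Q f) (x : Fin f × Fin 4) :
    (T.edge x).Same (T.edge (T.partner x)) :=
  (T.exists_partner x).choose_spec.2

lemma partner_partner (T : SphericalTiling Q f) (x : Fin f × Fin 4) :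
    T.partner (T.partner x) = x :=
  T.partner_unique (T.partner_ne _) (T.same_partner _) (T.partner_ne x).symm
    (T.same_partner x).symm

lemma edge_len (T : SphericalTiling Q f) (x : Fin f × Fin 4) :
    (T.edge x).len = ![Q.a, Q.b, Q.c, Q.a] x.2 := Q.len_edge x.2

/-- Edges that coincide have the same length, hence the same type `a`, `b` or `c`. -/
lemma partner_snd (T : SphericalTiling Q f) (x : Fin f × Fin 4) :
    (T.partner x).2 = x.2 ∨
      (x.2 = 0 ∧ (T.partner x).2 = 3) ∨ (x.2 = 3 ∧ (T.partner x).2 = 0) := by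
  have h := (T.same_partner x).len_eq
  rw [edge_len, edge_len] at h
  have h1 := Q.a_ne_b
  have h2 := Q.b_ne_c
  have h3 := Q.c_ne_a
  generalize (T.partner x).2 = l at *
  generalize x.2 = k at *
  fin_cases k <;> fin_cases l <;> simp_all

lemma partner_ends (T : SphericalTiling Q f) (x : Fin f × Fin 4) :
    ((T.tile x.1).vertex x.2 = (T.tile (T.partner x).1).vertex (T.partner x).2 ∧
      (T.tile x.1).vertex (x.2 + 1) = (T.tile (T.partner x).1).vertex ((T.partner x).2 + 1)) ∨
    ((T.tile x.1).vertex x.2 = (T.tile (T.partner x).1).vertex ((T.partner x).2 + 1) ∧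
      (T.tile x.1).vertex (x.2 + 1) = (T.tile (T.partner x).1).vertex (T.partner x).2) := by
  have := (T.same_partner x).ends
  rwa [edge_start, edge_start, edge_finish, edge_finish] at this

end SphericalTiling

/-! ### Quadrilaterals with equal angles at `B` and `D` -/

namespace GeodesicArc

lemma start_eq_of_finish (e : GeodesicArc) :
    e.start = Real.cos e.len • e.finish + Real.sin e.len • e.backDir := by
  rw [← pt_len_sub, sub_self, pt_zero]

lemma dir_eq_of_finish (e : GeodesicArc) :
    e.dir = Real.sin e.len • e.finish - Real.cos e.len • e.backDir := by
  have h := e.vel_add e.len (-e.len)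
  rw [add_neg_cancel, pt_len, Real.sin_neg, Real.cos_neg] at h
  have h2 : e.vel 0 = e.dir := by simp [vel]
  rw [← h2, h, backDir_eq]
  module

end GeodesicArc

/-- A reflection that reverses a vector fixes its orthogonal complement. -/
lemma reflection_eq_self_of_inner_eq_zero {v x y : E3} (hx : (ℝ ∙ v)ᗮ.reflection x = -x)
    (hx0 : x ≠ 0) (hxy : ⟪x, y⟫ = 0) : (ℝ ∙ v)ᗮ.reflection y = y := by
  rw [Submodule.reflection_orthogonal_apply, neg_inj, Submodule.reflection_eq_self_iff,
    Submodule.mem_span_singleton] at hx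
  obtain ⟨r, rfl⟩ := hx
  refine Submodule.reflection_mem_subspace_eq_self ?_
  rw [Submodule.mem_orthogonal_singleton_iff_inner_right]
  rw [real_inner_smul_left] at hxy
  refine (mul_eq_zero.1 hxy).resolve_left fun h => hx0 ?_
  rw [h, zero_smul]

/-- A geodesic from `B` and its mirror image, a geodesic from `D`, that pass through the same point
`C` at different times `b` and `c` run through `C` in opposite directions. -/
lemma reflected_geodesics {v B C D u w : E3} {b c : ℝ} (hB : (ℝ ∙ v)ᗮ.reflection B = D)
    (hu : (ℝ ∙ v)ᗮ.reflection u = w) (hC1 : C = Real.cos b • B + Real.sin b • u)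
    (hC2 : C = Real.cos c • D + Real.sin c • w) (hC0 : C ≠ 0)
    (hCz : ⟪C, -Real.sin b • B + Real.cos b • u⟫ = 0) (hbc : Real.cos (b - c) ≠ 1) :
    (-Real.sin b • B + Real.cos b • u) + (-Real.sin c • D + Real.cos c • w) = 0 := by
  have hmirror := fun hx => reflection_eq_self_of_inner_eq_zero (v := v) hx hC0 hCz
  have hσσ : ∀ x, (ℝ ∙ v)ᗮ.reflection ((ℝ ∙ v)ᗮ.reflection x) = x :=
    fun x => Submodule.reflection_reflection _ x
  have hD : (ℝ ∙ v)ᗮ.reflection D = B := by rw [← hB, hσσ]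
  have hw : (ℝ ∙ v)ᗮ.reflection w = u := by rw [← hu, hσσ]
  generalize (ℝ ∙ v)ᗮ.reflection = σ at *
  have hcb : b = c + (b - c) := by ring
  have hbc' : c = b - (b - c) := by ring
  set z1 := -Real.sin b • B + Real.cos b • u with hz1
  set z2 := -Real.sin c • D + Real.cos c • w with hz2
  have hσC1 : σ C = Real.cos (b - c) • C + Real.sin (b - c) • z2 := by
    have h1 : σ C = Real.cos b • D + Real.sin b • w := by
      rw [hC1, map_add, map_smul, map_smul, hB, hu]
    rw [h1, hz2, hC2]
    generalize b - c = d at *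
    rw [hcb, Real.cos_add, Real.sin_add]
    module
  have hσC2 : σ C = Real.cos (b - c) • C - Real.sin (b - c) • z1 := by
    have h1 : σ C = Real.cos c • B + Real.sin c • u := by
      rw [hC2, map_add, map_smul, map_smul, hD, hw]
    rw [h1, hz1, hC1]
    generalize b - c = d at *
    rw [hbc', Real.cos_sub, Real.sin_sub]
    module
  have hsin : Real.sin (b - c) • (z1 + z2) = 0 := by
    have h := hσC1.symm.trans hσC2
    have h2 : Real.sin (b - c) • (z1 + z2) =
      (Real.cos (b - c) • C + Real.sin (b - c) • z2) -
        (Real.cos (b - c) • C - Real.sin (b - c) • z1) := by module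
    rw [h2, h, sub_self]
  rcases smul_eq_zero.1 hsin with hs | h
  swap
  · exact h
  have hcos : Real.cos (b - c) = -1 := by
    have h1 := Real.sin_sq_add_cos_sq (b - c)
    rw [hs] at h1
    have h2 : (Real.cos (b - c) - 1) * (Real.cos (b - c) + 1) = 0 := by linarith
    have h3 := (mul_eq_zero.1 h2).resolve_left (sub_ne_zero.2 hbc)
    linarith
  -- now `C` is normal to the mirror, so the mirror contains `z1`
  have hσz1 : σ z1 = z1 := hmirror (by rw [hσC1, hcos, hs]; module)
  have hσz2 : σ z1 = -z2 := by
    have h1 : σ z1 = -Real.sin b • D + Real.cos b • w := by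
      rw [hz1, map_add, map_smul, map_smul, hB, hu]
    rw [h1, hz2]
    generalize b - c = d at *
    rw [hcb, Real.cos_add, Real.sin_add, hs, hcos]
    module
  rw [← hσz1, hσz2]
  simp

namespace QuadrilateralA2BC

/-- If the angles at `B` and `D` are equal, the reflection in the bisector of the angle at `A`
exchanges the half-lines from `B` and `D` on which `C` lies. As `b ≠ c`, this forces these
half-lines to meet at a straight angle. -/
theorem gamma_eq_pi (Q : QuadrilateralA2BC) (hα : Real.sin Q.α ≠ 0) (hβδ : Q.β = Q.δ) :
    Q.γ = Real.pi := by
  have hN := Q.isInwardNormal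
  set N := Q.normal
  have l0 : (Q.edge 0).len = Q.a := Q.len_edge 0
  have l1 : (Q.edge 1).len = Q.b := Q.len_edge 1
  have l2 : (Q.edge 2).len = Q.c := Q.len_edge 2
  have l3 : (Q.edge 3).len = Q.a := Q.len_edge 3
  set A := (Q.edge 0).start with hA
  set u := (Q.edge 0).dir with hu
  set w := (Q.edge 3).backDir with hw
  set B := (Q.edge 1).start with hB
  set C := (Q.edge 2).start with hC
  set D := (Q.edge 3).start with hD
  have fA : (Q.edge 3).finish = A := Q.closed 3
  have fB : (Q.edge 0).finish = B := Q.closed 0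
  have fC : (Q.edge 1).finish = C := Q.closed 1
  have fD : (Q.edge 2).finish = D := Q.closed 2
  have hF : IsFrame A u (N 0) := hN.isFrame 0
  have hwα : w = Real.cos Q.α • u + Real.sin Q.α • N 0 := hN.backDir_eq 0
  have hN3 : N 3 = Real.sin Q.α • u - Real.cos Q.α • N 0 := hN.normal_eq 0
  have hcs := Real.sin_sq_add_cos_sq Q.α
  have hwn : ‖w‖ = 1 := by
    rw [← inner_self_eq_one_iff, hwα]; exact (hF.perm.rotate Q.α).pp
  -- the reflection in the bisector of the angle at `A`
  set v := u - w with hv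
  set σ : E3 ≃ₗᵢ[ℝ] E3 := (ℝ ∙ v)ᗮ.reflection with hσ
  have hσu : σ u = w := Submodule.reflection_sub ((Q.edge 0).norm_dir.trans hwn.symm)
  have hσσ : ∀ x, σ (σ x) = x := fun x => Submodule.reflection_reflection _ x
  have hσw : σ w = u := by rw [← hσu, hσσ]
  have hAw : ⟪A, w⟫ = 0 := by
    rw [hwα, inner_add_right, real_inner_smul_right, real_inner_smul_right, hF.pu, hF.pn]; simp
  have hσA : σ A = A := by
    refine Submodule.reflection_mem_subspace_eq_self ?_
    rw [Submodule.mem_orthogonal_singleton_iff_inner_left, hv, inner_sub_right, hF.pu, hAw, sub_zero]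
  have hσN : σ (N 0) = N 3 := by
    have h1 : Real.sin Q.α • σ (N 0) = Real.sin Q.α • N 3 := by
      have h2 := hσw
      rw [hwα, map_add, map_smul, map_smul, hσu] at h2
      have h3 : Real.sin Q.α • σ (N 0) = u - Real.cos Q.α • w := by rw [← h2]; module
      rw [h3, hwα, hN3]
      have e : Real.sin Q.α ^ 2 = 1 - Real.cos Q.α ^ 2 := by linarith
      rw [smul_sub, smul_smul, ← pow_two, e]
      module
    exact smul_right_injective _ hα h1
  have hBexp : B = Real.cos Q.a • A + Real.sin Q.a • u := by rw [← fB, ← l0]; rfl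
  have hDexp : D = Real.cos Q.a • A + Real.sin Q.a • w := by
    have := (Q.edge 3).start_eq_of_finish
    rwa [l3, fA] at this
  have hσB : σ B = D := by rw [hBexp, map_add, map_smul, map_smul, hσA, hσu, ← hDexp]
  set w1 := (Q.edge 0).backDir with hw1
  have hw1exp : w1 = Real.sin Q.a • A - Real.cos Q.a • u := by rw [hw1, GeodesicArc.backDir, l0]
  have hu3exp : (Q.edge 3).dir = Real.sin Q.a • A - Real.cos Q.a • w := by
    have := (Q.edge 3).dir_eq_of_finish
    rwa [l3, fA] at this
  have hσw1 : σ w1 = (Q.edge 3).dir := by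
    rw [hw1exp, map_sub, map_smul, map_smul, hσA, hσu, ← hu3exp]
  set u1 := (Q.edge 1).dir with hu1
  set w3 := (Q.edge 2).backDir with hw3
  have hu1exp : u1 = Real.cos Q.β • w1 + Real.sin Q.β • N 0 := by
    have h1 : w1 = Real.cos Q.β • u1 + Real.sin Q.β • N 1 := hN.backDir_eq 1
    have h2 : N 0 = Real.sin Q.β • u1 - Real.cos Q.β • N 1 := hN.normal_eq 1
    rw [h1, h2]
    have e : (Real.sin Q.β ^ 2 + Real.cos Q.β ^ 2) • u1 = u1 := by
      rw [Real.sin_sq_add_cos_sq, one_smul]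
    conv_lhs => rw [← e]
    module
  have hw3exp : w3 = Real.cos Q.δ • (Q.edge 3).dir + Real.sin Q.δ • N 3 := hN.backDir_eq 3
  have hσu1 : σ u1 = w3 := by
    rw [hu1exp, map_add, map_smul, map_smul, hσw1, hσN, hw3exp, hβδ]
  have hσD : σ D = B := by rw [← hσB, hσσ]
  have hσw3 : σ w3 = u1 := by rw [← hσu1, hσσ]
  have hCexp1 : C = Real.cos Q.b • B + Real.sin Q.b • u1 := by rw [← fC, ← l1]; rfl
  have hCexp2 : C = Real.cos Q.c • D + Real.sin Q.c • w3 := by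
    have := (Q.edge 2).start_eq_of_finish
    rwa [l2, fD] at this
  -- the velocities at `C` of the geodesics from `B` and from `D`
  set z1 := -Real.sin Q.b • B + Real.cos Q.b • u1 with hz1
  set z2 := -Real.sin Q.c • D + Real.cos Q.c • w3 with hz2
  have hu2 : (Q.edge 2).dir = -z2 := by
    have := (Q.edge 2).dir_eq_of_finish
    rw [l2, fD] at this
    rw [this, hz2]; module
  have hb1 : (Q.edge 1).backDir = -z1 := by
    rw [GeodesicArc.backDir, l1, hz1]; module
  have hγ : (Q.edge 1).backDir = Real.cos Q.γ • (Q.edge 2).dir + Real.sin Q.γ • N 2 :=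
    hN.backDir_eq 2
  have hstraight : z1 + z2 = 0 → Q.γ = Real.pi := by
    intro h
    have h1 : (Q.edge 1).backDir = -(Q.edge 2).dir := by
      rw [hb1, hu2, eq_neg_of_add_eq_zero_left h]
    have h2 := congrArg (fun x => ⟪x, (Q.edge 2).dir⟫) hγ
    have hF2 := hN.isFrame 2
    have h3 : ⟪N 2, (Q.edge 2).dir⟫ = 0 := by rw [real_inner_comm]; exact hF2.un
    simp only [h1, inner_neg_left, inner_add_left, real_inner_smul_left, hF2.uu, h3] at h2
    have h4 : Real.cos (Q.γ - Real.pi) = 1 := by rw [Real.cos_sub_pi]; linarith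
    have hpos : 0 < Q.γ := Q.angle_pos 2
    have hlt : Q.γ < 2 * Real.pi := Q.angle_lt 2
    rw [Real.cos_eq_one_iff_of_lt_of_lt (by linarith) (by linarith)] at h4
    linarith
  have hcos : Real.cos (Q.b - Q.c) ≠ 1 := by
    have hb := (Q.edge 1).len_pos
    have hb' := (Q.edge 1).len_lt
    have hc := (Q.edge 2).len_pos
    have hc' := (Q.edge 2).len_lt
    rw [l1] at hb hb'
    rw [l2] at hc hc'
    intro h
    rw [Real.cos_eq_one_iff_of_lt_of_lt (by linarith) (by linarith)] at h
    exact Q.b_ne_c (by linarith)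
  have hC0 : C ≠ 0 := by
    intro h
    have h6 := (Q.edge 2).norm_start
    rw [← hC, h, norm_zero] at h6
    exact zero_ne_one h6
  have hCz : ⟪C, z1⟫ = 0 := by
    have h1 := (GeodesicArc.isFrame_pt (hN.isFrame 1) (Q.edge 1).len).pu
    have h2 : (Q.edge 1).vel (Q.edge 1).len = z1 := by rw [GeodesicArc.vel, l1]
    rwa [GeodesicArc.pt_len, fC, h2] at h1
  exact hstraight (reflected_geodesics hσB hσu1 hCexp1 hCexp2 hC0 hCz hcos)

end QuadrilateralA2BC

/-! ### Counting angles at the vertices -/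

lemma Finset.even_card_of_involution {ι : Type*} (s : Finset ι) (g : ι → ι)
    (hs : ∀ i ∈ s, g i ∈ s) (hne : ∀ i ∈ s, g i ≠ i) (hg : ∀ i ∈ s, g (g i) = i) :
    Even s.card := by
  have h : ∑ _i ∈ s, (1 : ZMod 2) = 0 :=
    Finset.sum_involution (fun i _ => g i) (fun _ _ => by decide) (fun i hi _ => hne i hi)
      hs hg
  rw [Finset.sum_const, nsmul_eq_mul, mul_one, ZMod.natCast_eq_zero_iff] at h
  exact even_iff_two_dvd.2 h

namespace SphericalTiling

variable {Q : QuadrilateralA2BC} {f : ℕ}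

open Classical in
/-- The tiles whose vertex number `k` is `p`. -/
def tilesAt (T : SphericalTiling Q f) (p : E3) (k : Fin 4) : Finset (Fin f) :=
  Finset.univ.filter fun i => (T.tile i).vertex k = p

lemma mem_tilesAt (T : SphericalTiling Q f) {p : E3} {k : Fin 4} {i : Fin f} :
    i ∈ T.tilesAt p k ↔ (T.tile i).vertex k = p := by simp [tilesAt]

lemma angleCombination_eq (T : SphericalTiling Q f) (p : E3) (k : Fin 4) :
    T.angleCombination p k = (T.tilesAt p k).card := by
  rw [angleCombination, ← Set.ncard_coe_finset]
  congr 1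
  ext i
  simp only [Finset.mem_coe, mem_tilesAt]
  rfl

lemma sum_corners (T : SphericalTiling Q f) (p : E3) {M : Type*} [Semiring M] (g : Fin 4 → M) :
    ∑ x ∈ T.corners p, g x.2 = ∑ k, (T.angleCombination p k : M) * g k := by
  classical
  have h : ∀ k, ((T.corners p).filter fun x => x.2 = k).card = T.angleCombination p k := by
    intro k
    rw [angleCombination_eq]
    refine Finset.card_bij' (fun x _ => x.1) (fun i _ => (i, k)) ?_ ?_ ?_ ?_
    · rintro ⟨i, l⟩ hx
      obtain ⟨h1, h2⟩ := Finset.mem_filter.1 hx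
      obtain rfl : l = k := h2
      exact T.mem_tilesAt.2 (T.mem_corners.1 h1)
    · intro i hi
      exact Finset.mem_filter.2 ⟨T.mem_corners.2 (T.mem_tilesAt.1 hi), rfl⟩
    · rintro ⟨i, l⟩ hx
      obtain ⟨h1, h2⟩ := Finset.mem_filter.1 hx
      obtain rfl : l = k := h2
      rfl
    · intro i _
      rfl
  rw [← Finset.sum_fiberwise (T.corners p) (fun x => x.2)]
  refine Finset.sum_congr rfl fun k _ => ?_
  rw [← h k, ← nsmul_eq_mul, ← Finset.sum_const]
  exact Finset.sum_congr rfl fun x hx => by rw [(Finset.mem_filter.1 hx).2]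

/-- The angle sum equation at a vertex. -/
lemma sum_angleCombination_mul_angle (T : SphericalTiling Q f) {p : E3} (hp : p ∈ T.vertices) :
    ∑ k, (T.angleCombination p k : ℝ) * Q.angle k = 2 * Real.pi := by
  rw [← T.sum_corners p, T.sum_corners_angle hp]

lemma three_le_sum_angleCombination (T : SphericalTiling Q f) {p : E3} (hp : p ∈ T.vertices) :
    3 ≤ ∑ k, T.angleCombination p k := by
  obtain ⟨i, k, rfl⟩ := hp
  have h := T.sum_corners (T.place i (Q.vertex k)) (M := ℕ) (fun _ => 1)
  simp only [mul_one, Nat.cast_id, Finset.sum_const, smul_eq_mul] at h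
  rw [← h]
  refine (T.three_le_degree i k).trans_eq ?_
  rw [← Set.ncard_coe_finset]
  congr 1
  ext x
  simp only [Finset.mem_coe, mem_corners]
  rfl

open Classical in
/-- The set of vertices, as a finite set. -/
def vertexFinset (T : SphericalTiling Q f) : Finset E3 :=
  Finset.univ.image fun x : Fin f × Fin 4 => (T.tile x.1).vertex x.2

lemma mem_vertexFinset (T : SphericalTiling Q f) {p : E3} :
    p ∈ T.vertexFinset ↔ p ∈ T.vertices := by
  simp only [vertexFinset, Finset.mem_image, Finset.mem_univ, true_and, Prod.exists]
  rfl

lemma vertex_mem_vertices (T : SphericalTiling Q f) (i : Fin f) (k : Fin 4) :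
    (T.tile i).vertex k ∈ T.vertices := ⟨i, k, rfl⟩

/-- Every angle of the tile occurs once in each of the `f` tiles. -/
lemma sum_vertexFinset_angleCombination (T : SphericalTiling Q f) (k : Fin 4) :
    ∑ p ∈ T.vertexFinset, T.angleCombination p k = f := by
  classical
  have h := Finset.card_eq_sum_card_fiberwise (s := (Finset.univ : Finset (Fin f)))
    (f := fun i => (T.tile i).vertex k) (t := T.vertexFinset)
    (fun i _ => T.mem_vertexFinset.2 (T.vertex_mem_vertices i k))
  rw [Finset.card_univ, Fintype.card_fin] at h
  refine Eq.trans (Finset.sum_congr rfl fun p _ => ?_) h.symm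
  rw [angleCombination_eq]
  rfl

lemma four_le_card_vertexFinset (T : SphericalTiling Q f) : 4 ≤ T.vertexFinset.card := by
  have h := Finset.card_le_card_of_injOn (s := (Finset.univ : Finset (Fin 4)))
    (t := T.vertexFinset) (fun k => (T.tile ⟨0, T.pos_of_tiling⟩).vertex k)
    (fun k _ => T.mem_vertexFinset.2 (T.vertex_mem_vertices _ k))
    (T.tile ⟨0, T.pos_of_tiling⟩).vertex_injective.injOn
  simpa using h

/-- The angle sum of the tile. Up to a multiple of `2π` it is given by the area; the multiple is
found by counting vertices: there are at least four of them, and at most `4f/3` as they have degree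
at least three. -/
theorem sum_angle_eq (T : SphericalTiling Q f) :
    ∑ k, Q.angle k = 2 * Real.pi + 4 * Real.pi / f := by
  obtain ⟨m, hm⟩ := T.exists_sum_angle_eq
  have hf : (0 : ℝ) < f := Nat.cast_pos.2 T.pos_of_tiling
  have hfZ : (0 : ℤ) < f := Int.natCast_pos.2 T.pos_of_tiling
  have h1 : (T.vertexFinset.card : ℝ) * (2 * Real.pi) = f * ∑ k, Q.angle k := by
    calc (T.vertexFinset.card : ℝ) * (2 * Real.pi)
        = ∑ p ∈ T.vertexFinset, ∑ k, (T.angleCombination p k : ℝ) * Q.angle k := by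
          rw [Finset.sum_congr rfl fun p hp =>
            T.sum_angleCombination_mul_angle (T.mem_vertexFinset.1 hp)]
          simp
      _ = ∑ k, (f : ℝ) * Q.angle k := by
          rw [Finset.sum_comm]
          refine Finset.sum_congr rfl fun k _ => ?_
          rw [← Finset.sum_mul, ← Nat.cast_sum, T.sum_vertexFinset_angleCombination]
      _ = _ := (Finset.mul_sum _ _ _).symm
  have h2 : T.vertexFinset.card * 3 ≤ 4 * f := by
    calc T.vertexFinset.card * 3 ≤ ∑ p ∈ T.vertexFinset, ∑ k, T.angleCombination p k := by
          rw [← smul_eq_mul]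
          exact Finset.card_nsmul_le_sum _ _ _ fun p hp =>
            T.three_le_sum_angleCombination (T.mem_vertexFinset.1 hp)
      _ = 4 * f := by
          rw [Finset.sum_comm]
          simp [T.sum_vertexFinset_angleCombination]
  have h3 := T.four_le_card_vertexFinset
  have h4 : (T.vertexFinset.card : ℤ) = 2 + f * m := by
    have : (T.vertexFinset.card : ℝ) = 2 + f * m := by
      rw [hm] at h1
      have hpi := Real.pi_pos
      field_simp at h1
      nlinarith
    exact_mod_cast this
  have h5 : m = 1 := by
    zify at h2 h3
    rw [h4] at h2 h3
    refine le_antisymm ?_ ?_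
    · by_contra! h
      nlinarith
    · by_contra! h
      nlinarith
  rw [hm, h5]
  push_cast
  ring

/-! ### Pairing the edges at a vertex -/

lemma partner_snd_eq_zero_or (T : SphericalTiling Q f) {x : Fin f × Fin 4}
    (hx : x.2 = 0 ∨ x.2 = 3) : (T.partner x).2 = 0 ∨ (T.partner x).2 = 3 := by
  rcases T.partner_snd x with h | h | h
  · rwa [h]
  · exact Or.inr h.2
  · exact Or.inl h.2

/-- The edges `BC` (and likewise the edges `CD`) at a vertex are shared by two tiles each, so that
the number of angles at the vertex that have such a side is even. -/
lemma even_angleCombination_add (T : SphericalTiling Q f) (p : E3) {k : Fin 4} (h0 : k ≠ 0)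
    (h3 : k ≠ 3) : Even (T.angleCombination p k + T.angleCombination p (k + 1)) := by
  classical
  have hp : ∀ i, (T.partner (i, k)).2 = k := fun i => by
    rcases T.partner_snd (i, k) with h | h | h
    · exact h
    · exact absurd h.1 h0
    · exact absurd h.1 h3
  have hp' : ∀ i, T.partner (i, k) = ((T.partner (i, k)).1, k) := fun i => Prod.ext rfl (hp i)
  have hdisj : Disjoint (T.tilesAt p k) (T.tilesAt p (k + 1)) := by
    refine Finset.disjoint_left.2 fun i h1 h2 => ?_
    have := (T.tile i).vertex_injective ((T.mem_tilesAt.1 h1).trans (T.mem_tilesAt.1 h2).symm)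
    simp at this
  rw [angleCombination_eq, angleCombination_eq, ← Finset.card_union_of_disjoint hdisj]
  refine Finset.even_card_of_involution _ (fun i => (T.partner (i, k)).1) ?_ ?_ ?_
  · intro i hi
    have h := T.partner_ends (i, k)
    simp only [hp] at h
    simp only [Finset.mem_union, mem_tilesAt] at hi ⊢
    grind
  · exact fun i _ => (T.partner_ne (i, k)).symm
  · intro i _
    rw [← hp', partner_partner]

lemma tilesAt_eq_empty (T : SphericalTiling Q f) {p : E3} {k : Fin 4}
    (h : T.angleCombination p k = 0) (i : Fin f) : (T.tile i).vertex k ≠ p := by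
  rw [angleCombination_eq, Finset.card_eq_zero] at h
  intro hi
  simpa [h] using T.mem_tilesAt.2 hi

/-- An angle `α` at a vertex has two `a`-edges as sides, and the tiles beyond them contribute
`α`, `β` or `δ` to the vertex. -/
lemma angleCombination_zero_ne_one (T : SphericalTiling Q f) {p : E3}
    (h1 : T.angleCombination p 1 = 0) (h3 : T.angleCombination p 3 = 0) :
    T.angleCombination p 0 ≠ 1 := by
  intro h0
  rw [angleCombination_eq, Finset.card_eq_one] at h0
  obtain ⟨i, hi⟩ := h0
  have hi' : (T.tile i).vertex 0 = p := T.mem_tilesAt.1 (by simp [hi])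
  have huniq : ∀ j, (T.tile j).vertex 0 = p → j = i := fun j hj => by
    simpa [hi] using T.mem_tilesAt.2 hj
  have hne := T.partner_ne (i, 0)
  have hends := T.partner_ends (i, 0)
  have h1' := T.tilesAt_eq_empty h1 (T.partner (i, 0)).1
  have h3' := T.tilesAt_eq_empty h3 (T.partner (i, 0)).1
  have hu := huniq (T.partner (i, 0)).1
  rcases T.partner_snd_eq_zero_or (x := (i, 0)) (Or.inl rfl) with h | h <;>
    rw [h] at hends <;> simp only [zero_add, show (3 : Fin 4) + 1 = 0 from rfl] at hends <;>
    grind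

/-- At a vertex `α^n`, the tile beyond the edge `AB` of a tile contributes an `α` as well. -/
lemma partner_of_alpha (T : SphericalTiling Q f) {p : E3}
    (h1 : T.angleCombination p 1 = 0) (h3 : T.angleCombination p 3 = 0) {i : Fin f}
    (hi : (T.tile i).vertex 0 = p) : ∃ j, i ≠ j ∧ (T.tile j).vertex 0 = p ∧
      ((T.partner (i, 0) = (j, 0) ∧ (T.tile i).vertex 1 = (T.tile j).vertex 1) ∨
        (T.partner (i, 0) = (j, 3) ∧ (T.tile i).vertex 1 = (T.tile j).vertex 3)) := by
  have hne := T.partner_ne (i, 0)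
  have hends := T.partner_ends (i, 0)
  have h1' := T.tilesAt_eq_empty h1 (T.partner (i, 0)).1
  have h3' := T.tilesAt_eq_empty h3 (T.partner (i, 0)).1
  refine ⟨(T.partner (i, 0)).1, hne, ?_⟩
  rcases T.partner_snd_eq_zero_or (x := (i, 0)) (Or.inl rfl) with h | h <;>
    rw [h] at hends <;> simp only [zero_add, show (3 : Fin 4) + 1 = 0 from rfl] at hends
  · have h' : T.partner (i, 0) = ((T.partner (i, 0)).1, 0) := Prod.ext rfl h
    grind
  · have h' : T.partner (i, 0) = ((T.partner (i, 0)).1, 3) := Prod.ext rfl h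
    grind

/-- As three is odd, the edges at a vertex `α³` cannot be matched `AB` with `AB` and `AD` with
`AD`; an edge `AB` that is matched with an edge `AD` leads to a vertex with a `β` and a `δ`. -/
lemma exists_beta_delta (T : SphericalTiling Q f) {p : E3}
    (h0 : T.angleCombination p 0 = 3) (h1 : T.angleCombination p 1 = 0)
    (h3 : T.angleCombination p 3 = 0) :
    ∃ p' ∈ T.vertices, 1 ≤ T.angleCombination p' 1 ∧ 1 ≤ T.angleCombination p' 3 := by
  by_contra! hcon
  have key : ∀ i ∈ T.tilesAt p 0, (T.partner (i, 0)).1 ∈ T.tilesAt p 0 ∧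
      T.partner (i, 0) = ((T.partner (i, 0)).1, 0) := by
    intro i hi
    obtain ⟨j, hij, hj, ⟨h, -⟩ | ⟨h, hv⟩⟩ := T.partner_of_alpha h1 h3 (T.mem_tilesAt.1 hi)
    · rw [h]
      exact ⟨T.mem_tilesAt.2 hj, rfl⟩
    · exfalso
      have := hcon _ (T.vertex_mem_vertices i 1)
      simp only [angleCombination_eq, Nat.lt_one_iff, Finset.card_eq_zero] at this
      have h5 := this (Finset.card_pos.2 ⟨i, T.mem_tilesAt.2 rfl⟩)
      have h6 : j ∈ T.tilesAt ((T.tile i).vertex 1) 3 := T.mem_tilesAt.2 hv.symm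
      simp [h5] at h6
  have := Finset.even_card_of_involution (T.tilesAt p 0) (fun i => (T.partner (i, 0)).1)
    (fun i hi => (key i hi).1) (fun i _ => (T.partner_ne (i, 0)).symm) (fun i hi => by
      rw [← (key i hi).2, partner_partner])
  rw [← angleCombination_eq, h0] at this
  exact absurd this (by decide)

/-- At a vertex without `α`, an edge `DA` that starts there is matched with an edge `BA` or `DA`;
if there are more `δ` than `β` at the vertex, the latter has to occur. -/
lemma exists_partner_delta (T : SphericalTiling Q f) {p : E3}
    (h0 : T.angleCombination p 0 = 0) (h13 : T.angleCombination p 1 < T.angleCombination p 3) :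
    ∃ i j, T.partner (i, 3) = (j, 3) ∧ (T.tile i).vertex 0 = (T.tile j).vertex 0 := by
  by_contra! hcon
  have key : ∀ i ∈ T.tilesAt p 3, (T.partner (i, 3)).1 ∈ T.tilesAt p 1 ∧
      T.partner (i, 3) = ((T.partner (i, 3)).1, 0) := by
    intro i hi
    have hi' := T.mem_tilesAt.1 hi
    have hends := T.partner_ends (i, 3)
    have h0' := T.tilesAt_eq_empty h0 (T.partner (i, 3)).1
    have hc := hcon i (T.partner (i, 3)).1
    rw [mem_tilesAt]
    rcases T.partner_snd_eq_zero_or (x := (i, 3)) (Or.inr rfl) with h | h <;>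
      rw [h] at hends <;> simp only [zero_add, show (3 : Fin 4) + 1 = 0 from rfl] at hends
    · have h' : T.partner (i, 3) = ((T.partner (i, 3)).1, 0) := Prod.ext rfl h
      grind
    · have h' : T.partner (i, 3) = ((T.partner (i, 3)).1, 3) := Prod.ext rfl h
      grind
  have := Finset.card_le_card_of_injOn (fun i => (T.partner (i, 3)).1)
    (fun i hi => (key i hi).1) (s := T.tilesAt p 3) (t := T.tilesAt p 1) (by
      intro i hi j hj hij
      have h := (key i hi).2.trans ((congrArg (fun m => (m, (0 : Fin 4))) hij).trans
        (key j hj).2.symm)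
      have := congrArg T.partner h
      rw [partner_partner, partner_partner] at this
      exact congrArg Prod.fst this)
  rw [← angleCombination_eq, ← angleCombination_eq] at this
  omega

/-- If `α³` and `αβ²` are the only vertices with several `α` or several `β`, then two tiles cannot
share their edges `AD` with both ends matched. Indeed, such tiles meet at a vertex `α³`, where two
tiles then share their edges `AB`. These lead to a vertex `αβ²` at which no tile is left for the
other side of the edge `AB` of the tile that contributes the `α`. -/
lemma false_of_partner_delta (T : SphericalTiling Q f)
    (hα : ∀ p ∈ T.vertices, 2 ≤ T.angleCombination p 0 → T.angleCombination p 0 = 3 ∧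
      T.angleCombination p 1 = 0 ∧ T.angleCombination p 3 = 0)
    (hβ : ∀ p ∈ T.vertices, 2 ≤ T.angleCombination p 1 → T.angleCombination p 0 = 1 ∧
      T.angleCombination p 1 = 2 ∧ T.angleCombination p 3 = 0)
    {i j : Fin f} (hij : T.partner (i, 3) = (j, 3))
    (hv : (T.tile i).vertex 0 = (T.tile j).vertex 0) : False := by
  have hne : i ≠ j := by
    have := T.partner_ne (i, 3)
    rwa [hij] at this
  have two_le : ∀ {i j : Fin f} {k : Fin 4}, i ≠ j → (T.tile i).vertex k = (T.tile j).vertex k →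
      2 ≤ T.angleCombination ((T.tile i).vertex k) k := by
    intro i j k hne h
    rw [angleCombination_eq]
    exact Finset.one_lt_card.2 ⟨i, T.mem_tilesAt.2 rfl, j, T.mem_tilesAt.2 h.symm, hne⟩
  obtain ⟨-, h1, h3⟩ := hα _ (T.vertex_mem_vertices i 0) (two_le hne hv)
  set p := (T.tile i).vertex 0 with hp
  obtain ⟨m, m', hmm, hmv⟩ : ∃ m m', T.partner (m, 0) = (m', 0) ∧
      (T.tile m).vertex 1 = (T.tile m').vertex 1 := by
    by_contra! hcon
    have key : ∀ m ∈ T.tilesAt p 0, (T.partner (m, 0)).1 ∈ T.tilesAt p 0 ∧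
        T.partner (m, 0) = ((T.partner (m, 0)).1, 3) := by
      intro m hm
      obtain ⟨j, -, hj, ⟨h, hv⟩ | ⟨h, -⟩⟩ := T.partner_of_alpha h1 h3 (T.mem_tilesAt.1 hm)
      · exact absurd hv (hcon _ _ h)
      · rw [h]
        exact ⟨T.mem_tilesAt.2 hj, rfl⟩
    have hsurj := Finset.surjOn_of_injOn_of_card_le (fun m => (T.partner (m, 0)).1)
      (fun m hm => (key m hm).1) (s := T.tilesAt p 0) (t := T.tilesAt p 0) (by
        intro m hm m' hm' h
        have h := (key m hm).2.trans ((congrArg (fun n => (n, (3 : Fin 4))) h).trans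
          (key m' hm').2.symm)
        have := congrArg T.partner h
        rw [partner_partner, partner_partner] at this
        exact congrArg Prod.fst this) le_rfl
    obtain ⟨m, hm, hmi⟩ := hsurj (T.mem_tilesAt.2 hp.symm)
    have h := (key m hm).2
    rw [show (T.partner (m, 0)).1 = i from hmi] at h
    have h' := congrArg T.partner h
    rw [partner_partner, hij] at h'
    exact absurd (congrArg Prod.snd h') (by simp)
  have hmne : m ≠ m' := by
    have := T.partner_ne (m, 0)
    rwa [hmm] at this
  obtain ⟨h0', h1', h3'⟩ := hβ _ (T.vertex_mem_vertices m 1) (two_le hmne hmv)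
  set p' := (T.tile m).vertex 1 with hp'
  have hpair : T.tilesAt p' 1 = {m, m'} := by
    rw [angleCombination_eq] at h1'
    refine (Finset.eq_of_subset_of_card_le ?_ ?_).symm
    · intro x hx
      rw [mem_tilesAt]
      rcases Finset.mem_insert.1 hx with rfl | hx
      · rfl
      · rw [Finset.mem_singleton.1 hx, hmv]
    · rw [h1', Finset.card_pair hmne]
  have hmm' : T.partner (m', 0) = (m, 0) := by rw [← hmm, partner_partner]
  rw [angleCombination_eq, Finset.card_eq_one] at h0'
  obtain ⟨t, ht⟩ := h0'
  have ht' : (T.tile t).vertex 0 = p' := T.mem_tilesAt.1 (by simp [ht])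
  have huniq : ∀ j, (T.tile j).vertex 0 = p' → j = t := fun j hj => by
    simpa [ht] using T.mem_tilesAt.2 hj
  have hne' := T.partner_ne (t, 0)
  have hends := T.partner_ends (t, 0)
  have hu := huniq (T.partner (t, 0)).1
  have h3'' := T.tilesAt_eq_empty h3' (T.partner (t, 0)).1
  rcases T.partner_snd_eq_zero_or (x := (t, 0)) (Or.inl rfl) with h | h <;>
    rw [h] at hends <;> simp only [zero_add, show (3 : Fin 4) + 1 = 0 from rfl] at hends
  · have hu1 : (T.tile (T.partner (t, 0)).1).vertex 1 = p' := by grind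
    have hpt : T.partner (t, 0) = ((T.partner (t, 0)).1, 0) := Prod.ext rfl h
    have hmem : (T.partner (t, 0)).1 ∈ T.tilesAt p' 1 := T.mem_tilesAt.2 hu1
    have hback := T.partner_partner (t, 0)
    rw [hpt] at hback
    have hcontra : ∀ n, (T.tile n).vertex 1 = p' → n ≠ t := by
      rintro n hn rfl
      exact absurd ((T.tile n).vertex_injective (hn.trans ht'.symm)) (by decide)
    rw [hpair, Finset.mem_insert, Finset.mem_singleton] at hmem
    rcases hmem with h' | h' <;> rw [h'] at hback
    · rw [hmm] at hback
      exact hcontra m' hmv.symm (congrArg Prod.fst hback)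
    · rw [hmm'] at hback
      exact hcontra m rfl (congrArg Prod.fst hback)
  · grind

end SphericalTiling

/-! ### The possible vertices -/

/-- Let `α = β = 2π/3`, and let `x ≤ y` be the other two angles, in units of `π`. A vertex has fewer
angles `y` than `x`, or is `y⁴`, or has equally many of them; the latter only for `x²y²` and for
vertices without `x` and `y`. The excluded combinations are `αy²` and `βxy`. -/
lemma multiplicity_lt_or {x y : ℝ} (hx : 0 < x) (hxy : x ≤ y) (hsum : 2 / 3 < x + y)
    {p q r s : ℕ} (h : 2 / 3 * ((p : ℝ) + q) + r * x + s * y = 2)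
    (hqr : Even (q + r)) (hrs : Even (r + s)) (hdeg : 3 ≤ p + q + r + s)
    (h1 : ¬(p = 1 ∧ q = 0 ∧ r = 0 ∧ s = 2)) (h2 : ¬(p = 0 ∧ q = 1 ∧ r = 1 ∧ s = 1)) :
    s < r ∨ (s = 4 ∧ p = 0 ∧ q = 0 ∧ r = 0) ∨ (s = r ∧ (s = 0 ∨ q = 0)) := by
  by_contra! hcon
  obtain ⟨hrs', hc1, hc2⟩ := hcon
  have hy : 1 / 3 < y := by linarith
  have hrx : 0 ≤ (r : ℝ) * x := by positivity
  have hsy : 0 ≤ (s : ℝ) * y := by positivity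
  have hs : s < 6 := by
    by_contra! hs
    have hs' : (6 : ℝ) ≤ s := by exact_mod_cast hs
    have : (0 : ℝ) ≤ p + q := by positivity
    nlinarith
  obtain ⟨m, hm⟩ : ∃ m, m = p + q := ⟨_, rfl⟩
  have hm3 : m < 4 := by
    by_contra! hm3
    have : (4 : ℝ) ≤ p + q := by rw [hm] at hm3; exact_mod_cast hm3
    nlinarith
  have hmR : (p : ℝ) + q = m := by rw [hm]; push_cast; rfl
  rw [hmR] at h
  rw [Nat.even_add] at hqr hrs
  rw [Nat.even_iff, Nat.even_iff] at hqr hrs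
  interval_cases m <;> interval_cases s <;> interval_cases r <;>
    first
    | omega
    | (push_cast at h; linarith)

/-- The angle sum equation if the two angles other than `2π/3` are `π/2` and `5π/18`. -/
lemma add_eq_three_or_lt {p q r s : ℕ} (h : 12 * (p + q) + 9 * r + 5 * s = 36) :
    (p + q = 3 ∧ r = 0 ∧ s = 0) ∨ p + q < 2 := by
  have h1 : r < 5 := by omega
  have h2 : s < 8 := by omega
  interval_cases r <;> interval_cases s <;> omega

lemma mem_sevenCombinations {p q r s : ℕ} (h : 4 * (p + q) + 3 * r + 2 * s = 12)
    (hqr : Even (q + r)) (hrs : Even (r + s)) : ![p, q, r, s] ∈ sevenCombinations := by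
  rw [Nat.even_iff] at hqr hrs
  have h1 : r < 5 := by omega
  have h2 : s < 7 := by omega
  interval_cases r <;> interval_cases s <;> try omega
  all_goals
    have h3 : p < 4 := by omega
    have h4 : q < 4 := by omega
    interval_cases p <;> interval_cases q <;>
      first
      | omega
      | simp [sevenCombinations]

/-- With `δ = π/2`, a vertex that has a `β` and a `δ` is `βγ³δ`. -/
lemma eq_of_delta_eq_half {g : ℝ} (hg : 1 / 6 < g) {p q r s : ℕ}
    (h : 2 / 3 * ((p : ℝ) + q) + r * g + s * (1 / 2) = 2)
    (hqr : Even (q + r)) (hrs : Even (r + s)) (hq : 1 ≤ q) (hs : 1 ≤ s)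
    (hex : ¬(p = 0 ∧ q = 1 ∧ r = 1 ∧ s = 1)) : g = 5 / 18 := by
  obtain ⟨m, hm⟩ : ∃ m, m = p + q := ⟨_, rfl⟩
  have hmR : (p : ℝ) + q = m := by rw [hm]; push_cast; rfl
  have hm1 : (1 : ℝ) ≤ m := by exact_mod_cast hm ▸ le_add_left hq
  have hs1 : (1 : ℝ) ≤ s := by exact_mod_cast hs
  rw [hmR] at h
  have hr0 : 0 ≤ (r : ℝ) * g := by positivity
  have hr : r < 5 := by
    by_contra! hr
    have : (5 : ℝ) ≤ r := by exact_mod_cast hr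
    nlinarith
  have hs3 : s < 3 := by
    have : (s : ℝ) < 3 := by linarith
    exact_mod_cast this
  have hm3 : m < 3 := by
    have : (m : ℝ) < 3 := by linarith
    exact_mod_cast this
  rw [Nat.even_iff] at hqr hrs
  interval_cases m <;> interval_cases s <;> interval_cases r <;>
    first
    | omega
    | (push_cast at h; linarith)

/-- With `γ = π/2`, a vertex that has a `β` and a `δ` is `β²δ²` or `βγδ³`. -/
lemma eq_of_gamma_eq_half {d : ℝ} (hd : 1 / 6 < d) {p q r s : ℕ}
    (h : 2 / 3 * ((p : ℝ) + q) + r * (1 / 2) + s * d = 2)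
    (hqr : Even (q + r)) (hrs : Even (r + s)) (hq : 1 ≤ q) (hs : 1 ≤ s)
    (hex : ¬(p = 0 ∧ q = 1 ∧ r = 1 ∧ s = 1)) :
    d = 1 / 3 ∨ (d = 5 / 18 ∧ p = 0 ∧ q = 1 ∧ s = 3) := by
  obtain ⟨m, hm⟩ : ∃ m, m = p + q := ⟨_, rfl⟩
  have hmR : (p : ℝ) + q = m := by rw [hm]; push_cast; rfl
  have hm1 : (1 : ℝ) ≤ m := by exact_mod_cast hm ▸ le_add_left hq
  have hs1 : (1 : ℝ) ≤ s := by exact_mod_cast hs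
  rw [hmR] at h
  have hr0 : 0 ≤ (s : ℝ) * d := by positivity
  have hs8 : s < 8 := by
    by_contra! hs8
    have : (8 : ℝ) ≤ s := by exact_mod_cast hs8
    nlinarith
  have hr3 : r < 3 := by
    have : (r : ℝ) < 3 := by linarith
    exact_mod_cast this
  have hm3 : m < 3 := by
    by_contra! hm3
    have : (3 : ℝ) ≤ m := by exact_mod_cast hm3
    nlinarith
  rw [Nat.even_iff] at hqr hrs
  interval_cases m <;> interval_cases r <;> interval_cases s <;>
    first
    | omega
    | (exfalso; push_cast at h; linarith)
    | (left; push_cast at h; linarith)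
    | (right; push_cast at h; exact ⟨by linarith, by omega, by omega, rfl⟩)

/-- Of two quantities with equal totals one cannot be at least as large as the other everywhere,
unless they agree everywhere. -/
lemma Finset.exists_lt_of_sum_eq {ι : Type*} {s : Finset ι} {u v : ι → ℕ}
    (h : ∑ i ∈ s, u i = ∑ i ∈ s, v i) {i : ι} (hi : i ∈ s) (hne : u i ≠ v i) :
    ∃ j ∈ s, v j < u j := by
  by_contra! hcon
  exact hne ((Finset.sum_eq_sum_iff_of_le hcon).1 h i hi)

namespace SphericalTiling

variable {Q : QuadrilateralA2BC} {f : ℕ}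

/-- The angle sum equation at a vertex, in units of `π`, if `α = β = 2π/3`. -/
lemma angle_sum_div_pi (T : SphericalTiling Q f) (hα : Q.α = 2 * Real.pi / 3)
    (hβ : Q.β = 2 * Real.pi / 3) {p : E3} (hp : p ∈ T.vertices) :
    2 / 3 * ((T.angleCombination p 0 : ℝ) + T.angleCombination p 1) +
      T.angleCombination p 2 * (Q.γ / Real.pi) + T.angleCombination p 3 * (Q.δ / Real.pi) = 2 := by
  have h := T.sum_angleCombination_mul_angle hp
  have hpi := Real.pi_pos
  simp only [Fin.sum_univ_four, QuadrilateralA2BC.angle, Matrix.cons_val] at h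
  rw [hα, hβ] at h
  field_simp at h ⊢
  linarith

lemma three_le_add_angleCombination (T : SphericalTiling Q f) {p : E3} (hp : p ∈ T.vertices) :
    3 ≤ T.angleCombination p 0 + T.angleCombination p 1 + T.angleCombination p 2 +
      T.angleCombination p 3 := by
  have h := T.three_le_sum_angleCombination hp
  rwa [Fin.sum_univ_four] at h

/-- If `α = β = δ = 2π/3`, then `γ = π`, and then no vertex of degree at least three has a `γ`. -/
lemma delta_ne (T : SphericalTiling Q f) (hα : Q.α = 2 * Real.pi / 3)
    (hβ : Q.β = 2 * Real.pi / 3) : Q.δ / Real.pi ≠ 2 / 3 := by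
  intro hδ
  have hpi := Real.pi_pos
  have hδ' : Q.δ = 2 * Real.pi / 3 := by
    field_simp at hδ
    linarith
  have hγ := Q.gamma_eq_pi (by
    rw [hα]
    exact (Real.sin_pos_of_pos_of_lt_pi (by positivity) (by linarith)).ne') (hβ.trans hδ'.symm)
  have hp := T.vertex_mem_vertices ⟨0, T.pos_of_tiling⟩ 2
  set p := (T.tile ⟨0, T.pos_of_tiling⟩).vertex 2 with hpdef
  have h := T.angle_sum_div_pi hα hβ hp
  rw [hδ, hγ, div_self hpi.ne'] at h
  have hdeg := T.three_le_add_angleCombination hp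
  have hpos : 0 < T.angleCombination p 2 := by
    rw [angleCombination_eq]
    exact Finset.card_pos.2 ⟨_, T.mem_tilesAt.2 hpdef.symm⟩
  have h' : 2 * (T.angleCombination p 0 + T.angleCombination p 1) + 3 * T.angleCombination p 2 +
      2 * T.angleCombination p 3 = 6 := by
    have : (2 * (T.angleCombination p 0 + T.angleCombination p 1) + 3 * T.angleCombination p 2 +
      2 * T.angleCombination p 3 : ℝ) = 6 := by linarith
    exact_mod_cast this
  omega

/-- The values `π/2` and `5π/18` of the angles `γ, δ`, in either order, leave `α³` and `αβ²` as the
only vertices with several `α` or several `β`. Then there is no vertex without `α` that has more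
`δ` than `β`. -/
lemma false_of_five_div_eighteen (T : SphericalTiling Q f) (hα : Q.α = 2 * Real.pi / 3)
    (hβ : Q.β = 2 * Real.pi / 3)
    (h : (Q.γ / Real.pi = 1 / 2 ∧ Q.δ / Real.pi = 5 / 18) ∨
      (Q.γ / Real.pi = 5 / 18 ∧ Q.δ / Real.pi = 1 / 2))
    {p : E3} (h0 : T.angleCombination p 0 = 0)
    (h13 : T.angleCombination p 1 < T.angleCombination p 3) : False := by
  have key : ∀ p ∈ T.vertices,
      12 * (T.angleCombination p 0 + T.angleCombination p 1) + 9 * T.angleCombination p 2 +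
        5 * T.angleCombination p 3 = 36 ∨
      12 * (T.angleCombination p 0 + T.angleCombination p 1) + 5 * T.angleCombination p 2 +
        9 * T.angleCombination p 3 = 36 := by
    intro p hp
    have hs := T.angle_sum_div_pi hα hβ hp
    rcases h with ⟨h1, h2⟩ | ⟨h1, h2⟩ <;> rw [h1, h2] at hs
    · left
      have : (12 * (T.angleCombination p 0 + T.angleCombination p 1) +
        9 * T.angleCombination p 2 + 5 * T.angleCombination p 3 : ℝ) = 36 := by linarith
      exact_mod_cast this
    · right
      have : (12 * (T.angleCombination p 0 + T.angleCombination p 1) +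
        5 * T.angleCombination p 2 + 9 * T.angleCombination p 3 : ℝ) = 36 := by linarith
      exact_mod_cast this
  have par : ∀ p, Even (T.angleCombination p 1 + T.angleCombination p 2) := fun p =>
    T.even_angleCombination_add p (k := 1) (by decide) (by decide)
  obtain ⟨i, j, hij, hv⟩ := T.exists_partner_delta h0 h13
  refine T.false_of_partner_delta (fun p hp h2 => ?_) (fun p hp h2 => ?_) hij hv
  all_goals
    have h4 := Nat.even_iff.1 (par p)
    rcases key p hp with h3 | h3
    · have := add_eq_three_or_lt h3
      omega
    · rw [add_right_comm] at h3
      have := add_eq_three_or_lt h3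
      omega

/-- The number of tiles and the remaining angles. The larger of `γ, δ` is `π/2`, because the balance
of `γ` and `δ` over all vertices forces a vertex at which only this angle occurs. -/
theorem angles_eq (T : SphericalTiling Q f) (hα : Q.α = 2 * Real.pi / 3)
    (hβ : Q.β = 2 * Real.pi / 3)
    (hbd : ∃ p ∈ T.vertices, 1 ≤ T.angleCombination p 1 ∧ 1 ≤ T.angleCombination p 3)
    (hex : ∀ p ∈ T.vertices, ¬(T.angleCombination p 0 = 0 ∧ T.angleCombination p 1 = 1 ∧
      T.angleCombination p 2 = 1 ∧ T.angleCombination p 3 = 1)) :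
    f = 24 ∧ Q.γ / Real.pi = 1 / 2 ∧ Q.δ / Real.pi = 1 / 3 := by
  have hpi := Real.pi_pos
  have hf : (0 : ℝ) < f := Nat.cast_pos.2 T.pos_of_tiling
  have hg : 0 < Q.γ / Real.pi := div_pos (Q.angle_pos 2) hpi
  have hd : 0 < Q.δ / Real.pi := div_pos (Q.angle_pos 3) hpi
  have hsum : Q.γ / Real.pi + Q.δ / Real.pi = 2 / 3 + 4 / f := by
    have h := T.sum_angle_eq
    simp only [Fin.sum_univ_four, QuadrilateralA2BC.angle, Matrix.cons_val] at h
    rw [hα, hβ] at h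
    field_simp at h ⊢
    linarith
  have he : (0 : ℝ) < 4 / f := by positivity
  have par1 : ∀ p, Even (T.angleCombination p 1 + T.angleCombination p 2) := fun p =>
    T.even_angleCombination_add p (k := 1) (by decide) (by decide)
  have par2 : ∀ p, Even (T.angleCombination p 2 + T.angleCombination p 3) := fun p =>
    T.even_angleCombination_add p (k := 2) (by decide) (by decide)
  have hδ := T.delta_ne hα hβ
  have hbal : ∑ p ∈ T.vertexFinset, T.angleCombination p 3 =
      ∑ p ∈ T.vertexFinset, T.angleCombination p 2 := by
    rw [T.sum_vertexFinset_angleCombination, T.sum_vertexFinset_angleCombination]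
  obtain ⟨w, hw, hw1, hw3⟩ := hbd
  have hwsum := T.angle_sum_div_pi hα hβ hw
  rcases le_or_gt (Q.γ / Real.pi) (Q.δ / Real.pi) with hle | hlt
  · have hcl : ∀ p ∈ T.vertices, _ := fun p hp =>
      multiplicity_lt_or hg hle (by linarith) (T.angle_sum_div_pi hα hβ hp) (par1 p) (par2 p)
        (T.three_le_add_angleCombination hp) (fun h => hδ (by
          have := T.angle_sum_div_pi hα hβ hp
          rw [h.1, h.2.1, h.2.2.1, h.2.2.2] at this
          norm_num at this
          linarith)) (hex p hp)
    -- `w` has more `γ` than `δ`, so that some other vertex has more `δ` than `γ`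
    obtain ⟨v, hv, hv3', hv0, hv1, hv3⟩ : ∃ v ∈ T.vertices, T.angleCombination v 3 = 4 ∧
        T.angleCombination v 0 = 0 ∧ T.angleCombination v 1 = 0 ∧
        T.angleCombination v 2 = 0 := by
      by_cases hww : T.angleCombination w 3 = T.angleCombination w 2
      · have := hcl w hw
        omega
      · obtain ⟨v, hv, hlt⟩ := Finset.exists_lt_of_sum_eq hbal (T.mem_vertexFinset.2 hw) hww
        rw [mem_vertexFinset] at hv
        have := hcl v hv
        exact ⟨v, hv, by omega⟩
    have hd2 : Q.δ / Real.pi = 1 / 2 := by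
      have := T.angle_sum_div_pi hα hβ hv
      rw [hv0, hv1, hv3, hv3'] at this
      norm_num at this
      linarith
    rw [hd2] at hwsum hsum
    have hg5 := eq_of_delta_eq_half (by linarith) hwsum (par1 w) (par2 w) hw1 hw3 (hex w hw)
    exact (T.false_of_five_div_eighteen hα hβ (Or.inr ⟨hg5, hd2⟩) hv0 (by omega)).elim
  · have hcl : ∀ p ∈ T.vertices, _ := fun p hp =>
      multiplicity_lt_or (p := T.angleCombination p 0) (q := T.angleCombination p 1)
        (r := T.angleCombination p 3) (s := T.angleCombination p 2) hd hlt.le (by linarith)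
        (by linarith [T.angle_sum_div_pi hα hβ hp])
        (by have := (par1 p).add (par2 p); rw [Nat.even_iff] at this ⊢; omega)
        (by rw [add_comm]; exact par2 p) (by linarith [T.three_le_add_angleCombination hp])
        (fun h => T.angleCombination_zero_ne_one h.2.1 h.2.2.1 h.1)
        (fun h => hex p hp ⟨h.1, h.2.1, h.2.2.2, h.2.2.1⟩)
    obtain ⟨v, hv, hv2, hv0, hv1, hv3⟩ : ∃ v ∈ T.vertices, T.angleCombination v 2 = 4 ∧
        T.angleCombination v 0 = 0 ∧ T.angleCombination v 1 = 0 ∧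
        T.angleCombination v 3 = 0 := by
      by_cases hww : T.angleCombination w 2 = T.angleCombination w 3
      · have := hcl w hw
        omega
      · obtain ⟨v, hv, hlt⟩ := Finset.exists_lt_of_sum_eq hbal.symm (T.mem_vertexFinset.2 hw) hww
        rw [mem_vertexFinset] at hv
        have := hcl v hv
        exact ⟨v, hv, by omega⟩
    have hg2 : Q.γ / Real.pi = 1 / 2 := by
      have := T.angle_sum_div_pi hα hβ hv
      rw [hv0, hv1, hv2, hv3] at this
      norm_num at this
      linarith
    rw [hg2] at hwsum hsum
    rcases eq_of_gamma_eq_half (by linarith) hwsum (par1 w) (par2 w) hw1 hw3 (hex w hw) with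
      h | ⟨h, h0, h1, h3⟩
    · refine ⟨?_, hg2, h⟩
      rw [h] at hsum
      have : (f : ℝ) = 24 := by
        field_simp at hsum
        linarith
      exact_mod_cast this
    · exact (T.false_of_five_div_eighteen hα hβ (Or.inl ⟨hg2, h⟩) h0 (by omega)).elim

end SphericalTiling

end

theorem mainTheorem5 (Q : QuadrilateralA2BC) (f : ℕ) (T : SphericalTiling Q f)
    (h_alpha3 : ![3, 0, 0, 0] ∈ T.avc)
    (h_alpha_beta2 : ![1, 2, 0, 0] ∈ T.avc)
    (h_beta_gamma_delta : ![0, 1, 1, 1] ∉ T.avc) :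
    f = 24 ∧ T.avc ⊆ sevenCombinations ∧
      ∀ v ∈ sevenCombinations,
        (v 0 : ℝ) * Q.α + (v 1 : ℝ) * Q.β + (v 2 : ℝ) * Q.γ + (v 3 : ℝ) * Q.δ
          = 2 * Real.pi := by
  have hpi := Real.pi_pos
  obtain ⟨p, hp, hp3⟩ := h_alpha3
  obtain ⟨p', hp', hp'2⟩ := h_alpha_beta2
  have hα : Q.α = 2 * Real.pi / 3 := by
    have h := T.sum_angleCombination_mul_angle hp
    rw [hp3] at h
    simp [Fin.sum_univ_four, QuadrilateralA2BC.angle] at h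
    linarith
  have hβ : Q.β = 2 * Real.pi / 3 := by
    have h := T.sum_angleCombination_mul_angle hp'
    rw [hp'2] at h
    simp [Fin.sum_univ_four, QuadrilateralA2BC.angle] at h
    linarith
  obtain ⟨hf, hγ, hδ⟩ := T.angles_eq hα hβ
    (T.exists_beta_delta (congrFun hp3 0) (congrFun hp3 1) (congrFun hp3 3))
    (fun v hv h => h_beta_gamma_delta ⟨v, hv, by
      ext k
      fin_cases k
      exacts [h.1, h.2.1, h.2.2.1, h.2.2.2]⟩)
  refine ⟨hf, ?_, ?_⟩
  · rintro _ ⟨v, hv, rfl⟩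
    have h := T.angle_sum_div_pi hα hβ hv
    have h1 := T.even_angleCombination_add v (k := 1) (by decide) (by decide)
    have h2 := T.even_angleCombination_add v (k := 2) (by decide) (by decide)
    rw [hγ, hδ] at h
    have h' : 4 * (T.angleCombination v 0 + T.angleCombination v 1) +
        3 * T.angleCombination v 2 + 2 * T.angleCombination v 3 = 12 := by
      have : (4 * (T.angleCombination v 0 + T.angleCombination v 1) +
        3 * T.angleCombination v 2 + 2 * T.angleCombination v 3 : ℝ) = 12 := by linarith
      exact_mod_cast this
    have hvec : T.angleCombination v = ![T.angleCombination v 0, T.angleCombination v 1,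
        T.angleCombination v 2, T.angleCombination v 3] := by
      ext k
      fin_cases k <;> rfl
    rw [hvec]
    exact mem_sevenCombinations h' h1 h2
  · have hγ' : Q.γ = Real.pi / 2 := by
      field_simp at hγ
      linarith
    have hδ' : Q.δ = Real.pi / 3 := by
      field_simp at hδ
      linarith
    rintro v (rfl | rfl | rfl | rfl | rfl | rfl | rfl) <;>
      simp only [Matrix.cons_val] <;> rw [hα, hβ, hγ', hδ'] <;> push_cast <;> ring
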